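/- **Setting.** Let $E$ be a Hausdorff space whose Borel $\sigma$-algebra is generated by the continuous functions, $\mu$ a $\sigma$-finite measure on it, and $\mathcal H=L^2(E,\mu)$ (real) with inner product $(\cdot,\cdot)$. A *Dirichlet form* $(\mathcal A,\mathcal V)$ on $\mathcal H$ is a bilinear form on a dense subspace $\mathcal V$ with $\mathcal A(u,u)\ge 0$, complete for $\|u\|_{\mathcal V}^2=\mathcal A(u,u)+(u,u)$, satisfying the weak sector condition $|\mathcal A_1(u,v)|\le K\mathcal A_1(u,u)^{1/2}\mathcal A_1(v,v)^{1/2}$ with $\mathcal A_1=\mathcal A+(\cdot,\cdot)$, and such that for $u\in\mathcal V$ one has $w:=u^+\wedge 1\in\mathcal V$, $\mathcal A(u+w,u-w)\ge 0$ and $\mathcal A(u-w,u+w)\ge 0$. It is *sectorial* if $|\mathcal A(u,v)|\le K\mathcal A(u,u)^{1/2}\mathcal A(v,v)^{1/2}$. A bounded operator $S$ on $\mathcal H$ is sub-Markovian if $0\le f\le 1$ implies $0\le Sf\le 1$. The index $b$ denotes the $\mu$-essentially bounded elements of a function space. Let $(\mathcal A,\mathcal V)$ be a Dirichlet form and assume: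 * (H1) $(\Lambda,D(\Lambda,\mathcal H))$ generates a sub-Markovian $C_0$-semigroup of contractions on $\mathcal H$ that restricts to a $C_0$-semigroup on $\mathcal V$. Let $(\Lambda,\mathcal F)$ be the closure of $\Lambda:D(\Lambda,\mathcal H)\cap\mathcal V\to\mathcal V'$, let $\mathcal E(u,v)=\mathcal A(u,v)-{}_{\mathcal V'}\langle\Lambda u,v\rangle_{\mathcal V}$ for $u\in\mathcal F$, $v\in\mathcal V$ be the associated generalized Dirichlet form, and let $(T_t)_{t>0}$ be the $C_0$-semigroup of contractions on $\mathcal H$ whose resolvent $G_\alpha=\int_0^\infty e^{-\alpha t}T_t\,dt$ satisfies $G_\alpha(\mathcal H)\subset\mathcal F$ and $\mathcal E(G_\alpha f,v)+\alpha(G_\alpha f,v)=(f,v)$ for $\alpha>0$, $f\in\mathcal H$, $v\in\mathcal V$. Let $(L,D(L))$ be its generator. * (H2) The adjoint semigroup $(\widehat T_t)_{t>0}$ is sub-Markovian. Hence $T_t|_{L^1\cap L^2}$ extends to $L^1(E,\mu)$, and for $0\le f\in L^1(E,\mu)$ one sets $Gf=\lim_{n\to\infty}\int_0^nT_tf\,dt\le\infty$.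 * (H3) There are a sectorial Dirichlet form $(\mathcal E^0,D(\mathcal E^0))$ on $\mathcal H$ with $D(L)_b\subset D(\mathcal E^0)$ and a linear operator $(N,D(N))$ on $\mathcal H$ such that, for all $u\in D(L)_b$ and $v\in D(N)\cap D(\mathcal E^0)$, $$(-Lu,v)=\mathcal E^0(u,v)+\int_E u\,Nv\,d\mu,\qquad \mathcal E^0(u,u)\le\mathcal E(u,u)=(-Lu,u).$$ $(T_t)$ is *transient* if there is $g\in L^1(E,\mu)$ with $g>0$ and $Gg<\infty$ $\mu$-a.e.; it is *recurrent* if for every $0\le f\in L^1(E,\mu)$ one has $Gf(x)\in\{0,\infty\}$ for $\mu$-a.e. $x$; it is *strictly irreducible* if every measurable $B$ with $T_t(f1_B)=0$ $\mu$-a.e. on $E\setminus B$ for all $t>0$, $f\in\mathcal H$, satisfies $\mu(B)=0$ or $\mu(E\setminus B)=0$. The *extended Dirichlet space* of $\mathcal E^0$ is the set of $\mu$-a.e. finite measurable $u$ for which there is an $\mathcal E^0$-Cauchy sequence $(u_n)\subset D(\mathcal E^0)$ with $u_n\to u$ $\mu$-a.e.; for such $u$ and $v\in D(\mathcal E^0)$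 put $\mathcal E^0(u,v)=\lim_n\mathcal E^0(u_n,v)$, which does not depend on the sequence. Let $D=\{u\in D(N)\cap D(\mathcal E^0): Nu\in L^1(E,\mu)\}$. **Theorem.** Suppose that $(T_t)$ is transient. Then there is $g\in L^1(E,\mu)_b$ with $g>0$ $\mu$-a.e. and $Gg\in L^\infty(E,\mu)$, and for every such $g$: $Gg$ is in the extended Dirichlet space of $\mathcal E^0$; $G_\alpha g\in D(\mathcal E^0)$ for all $\alpha>0$, and $\lim_{\alpha\downarrow 0}\mathcal E^0(G_\alpha g,u)$ exists and equals $\mathcal E^0(Gg,u)$ for all $u\in D(\mathcal E^0)$; and for all $u\in D$ $$(u,g)=\mathcal E^0(Gg,u)+\int_E Gg\cdot Nu\,d\mu .$$ **Corollary.** Suppose there is a sequence $(\chi_n)\subset D$ with $0\le\chi_n\le1$ and $\chi_n\to1$ $\mu$-a.e. such that $\lim_{n\to\infty}\bigl(\mathcal E^0(h,\chi_n)+\int_E h\,N\chi_n\,d\mu\bigr)=0$ for every nonnegative bounded $h$ in the extended Dirichlet space of $\mathcal E^0$. (a) If $\mu\ne0$, then $(T_t)$ is not transient. (b) If $(T_t)$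 is strictly irreducible, then it is recurrent. -/

import Mathlib

open MeasureTheory Filter Topology Set
open scoped ENNReal

noncomputable section

namespace GenDirichlet

variable {E : Type*} [MeasurableSpace E] {μ : Measure E}

/-- A (class of a) function is `μ`-essentially bounded. -/
def EssBdd (μ : Measure E) (f : E → ℝ) : Prop := ∃ C : ℝ, ∀ᵐ x ∂μ, |f x| ≤ C

/-! ## Bilinear forms on `L²(E, μ)` -/

/-- A bilinear form on a linear subspace `dom` of `L²(E, μ)`. -/
structure L2Form (μ : Measure E) where
  dom : Submodule ℝ (Lp ℝ 2 μ)
  form : dom →ₗ[ℝ] dom →ₗ[ℝ] ℝ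

namespace L2Form

/-- `A₁(u, v) = A(u, v) + (u, v)`. -/
def form₁ (A : L2Form μ) (u v : A.dom) : ℝ :=
  A.form u v + inner ℝ (u : Lp ℝ 2 μ) (v : Lp ℝ 2 μ)

/-- The squared form norm `‖u‖²_V = A(u, u) + (u, u)`. -/
def normSq (A : L2Form μ) (u : A.dom) : ℝ := A.form₁ u u

/-- A (not necessarily symmetric) Dirichlet form: a densely defined, nonnegative, closed bilinear
form on `L²(E, μ)` that satisfies the weak sector condition and the (two) unit contraction
properties. -/
structure IsDirichlet (A : L2Form μ) : Prop where
  dense : Dense (A.dom : Set (Lp ℝ 2 μ))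
  nonneg : ∀ u : A.dom, 0 ≤ A.form u u
  complete : ∀ s : ℕ → A.dom,
    (∀ ε > (0 : ℝ), ∃ n₀ : ℕ, ∀ m ≥ n₀, ∀ n ≥ n₀, A.normSq (s m - s n) < ε) →
      ∃ u : A.dom, Tendsto (fun n => A.normSq (s n - u)) atTop (𝓝 0)
  weakSector : ∃ K : ℝ, ∀ u v : A.dom,
    |A.form₁ u v| ≤ K * Real.sqrt (A.form₁ u u) * Real.sqrt (A.form₁ v v)
  unitContraction : ∀ u : A.dom, ∃ w : A.dom,
    ((w : Lp ℝ 2 μ) =ᵐ[μ] fun x => min (max ((u : Lp ℝ 2 μ) x) 0) 1) ∧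
      0 ≤ A.form (u + w) (u - w) ∧ 0 ≤ A.form (u - w) (u + w)

/-- The strong sector condition. -/
def IsSectorial (A : L2Form μ) : Prop :=
  ∃ K : ℝ, ∀ u v : A.dom,
    |A.form u v| ≤ K * Real.sqrt (A.form u u) * Real.sqrt (A.form v v)

/-- `A(w, v)` for `w ∈ L²(E, μ)`, set to `0` when `w` is not in the domain. -/
def eval (A : L2Form μ) (w : Lp ℝ 2 μ) (v : A.dom) : ℝ :=
  open Classical in if h : w ∈ A.dom then A.form ⟨w, h⟩ v else 0

/-- The sequence `s` in the domain is Cauchy for the form and converges to `u` almost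
everywhere. -/
def Approximates (A : L2Form μ) (s : ℕ → A.dom) (u : E → ℝ) : Prop :=
  (∀ ε > (0 : ℝ), ∃ n₀ : ℕ, ∀ m ≥ n₀, ∀ n ≥ n₀, A.form (s m - s n) (s m - s n) < ε) ∧
    ∀ᵐ x ∂μ, Tendsto (fun n => (s n : Lp ℝ 2 μ) x) atTop (𝓝 (u x))

/-- Membership in the extended Dirichlet space. -/
def InExtended (A : L2Form μ) (u : E → ℝ) : Prop :=
  AEStronglyMeasurable u μ ∧ ∃ s : ℕ → A.dom, A.Approximates s u

/-- The form `A(u, v)` for `u` in the extended Dirichlet space and `v` in the domain: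
`A(u, v) = lim A(uₙ, v)` along an approximating sequence `(uₙ)` of `u`. For a Dirichlet form with
the strong sector condition the limit exists and does not depend on the sequence. -/
def extForm (A : L2Form μ) (u : E → ℝ) (v : A.dom) : ℝ :=
  open Classical in
  if h : ∃ s : ℕ → A.dom, A.Approximates s u then
    limUnder atTop (fun n => A.form (h.choose n) v)
  else 0

end L2Form

/-! ## Semigroups on `L²(E, μ)` -/

/-- A bounded operator on `L²` is sub-Markovian if `0 ≤ f ≤ 1` implies `0 ≤ S f ≤ 1`. -/
def IsSubMarkov (S : Lp ℝ 2 μ →L[ℝ] Lp ℝ 2 μ) : Prop :=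
  ∀ f : Lp ℝ 2 μ, (∀ᵐ x ∂μ, 0 ≤ f x ∧ f x ≤ 1) → ∀ᵐ x ∂μ, 0 ≤ S f x ∧ S f x ≤ 1

/-- A `C₀`-semigroup of contractions on `L²(E, μ)`. Only the operators with index `t ≥ 0` are
meaningful. -/
structure ContractionSemigroup (μ : Measure E) where
  op : ℝ → Lp ℝ 2 μ →L[ℝ] Lp ℝ 2 μ
  op_zero : op 0 = ContinuousLinearMap.id ℝ (Lp ℝ 2 μ)
  op_add : ∀ s t : ℝ, 0 ≤ s → 0 ≤ t → op (s + t) = (op s).comp (op t)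
  norm_le : ∀ t : ℝ, 0 ≤ t → ‖op t‖ ≤ 1
  continuous_zero : ∀ f : Lp ℝ 2 μ, Tendsto (fun t => op t f) (𝓝[>] 0) (𝓝 f)

namespace ContractionSemigroup

/-- The constant semigroup of identities. -/
def trivial (μ : Measure E) : ContractionSemigroup μ where
  op _ := ContinuousLinearMap.id ℝ (Lp ℝ 2 μ)
  op_zero := rfl
  op_add _ _ _ _ := rfl
  norm_le _ _ := ContinuousLinearMap.norm_id_le
  continuous_zero _ := tendsto_const_nhds

/-- `u` is in the domain of the generator of the semigroup and the generator maps `u` to `f`. -/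
def HasGenerator (T : ContractionSemigroup μ) (u f : Lp ℝ 2 μ) : Prop :=
  Tendsto (fun t : ℝ => t⁻¹ • (T.op t u - u)) (𝓝[>] 0) (𝓝 f)

/-- The resolvent `G_α f = ∫₀^∞ e^{-αt} T_t f dt`, `α > 0`. -/
def resolvent (T : ContractionSemigroup μ) (α : ℝ) (f : Lp ℝ 2 μ) : Lp ℝ 2 μ :=
  ∫ t in Ioi (0 : ℝ), Real.exp (-α * t) • T.op t f

/-- All operators of the semigroup are sub-Markovian. -/
def IsSubMarkovian (T : ContractionSemigroup μ) : Prop := ∀ t : ℝ, 0 < t → IsSubMarkov (T.op t)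

/-- The adjoint semigroup is sub-Markovian. -/
def IsDualSubMarkovian (T : ContractionSemigroup μ) : Prop :=
  ∀ t : ℝ, 0 < t → IsSubMarkov (ContinuousLinearMap.adjoint (T.op t))

/-- The semigroup can be restricted to a `C₀`-semigroup (of bounded operators) on the form domain
`V`, equipped with the form norm. -/
structure RestrictsTo (U : ContractionSemigroup μ) (A : L2Form μ) : Prop where
  map_mem : ∀ t : ℝ, 0 ≤ t → ∀ u : A.dom, U.op t u ∈ A.dom
  bounded : ∀ (t : ℝ) (ht : 0 ≤ t), ∃ C : ℝ, ∀ u : A.dom,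
    A.normSq ⟨U.op t u, map_mem t ht u⟩ ≤ C * A.normSq u
  continuous : ∀ u : A.dom, ∀ ε > (0 : ℝ), ∃ δ > (0 : ℝ), ∀ (t : ℝ) (ht : 0 ≤ t), t < δ →
    A.normSq (⟨U.op t u, map_mem t ht u⟩ - u) < ε

end ContractionSemigroup

/-! ## The generalized Dirichlet form of `(A, V)` and `(Λ, D(Λ, H))`

`Λ` is the generator of the semigroup `U`. -/

/-- The closure in `V × V'` of the graph of `Λ : D(Λ, H) ∩ V → V'`, where `Λ u` acts on `V` by
`v ↦ (Λ u, v)` and where `V'` carries the dual norm of the form norm on `V`. -/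
def closureGraph (A : L2Form μ) (U : ContractionSemigroup μ) : Set (A.dom × (A.dom →ₗ[ℝ] ℝ)) :=
  {p | ∃ (s : ℕ → A.dom) (r : ℕ → Lp ℝ 2 μ),
    (∀ n, U.HasGenerator (s n) (r n)) ∧
    Tendsto (fun n => A.normSq (s n - p.1)) atTop (𝓝 0) ∧
    ∀ ε > (0 : ℝ), ∃ n₀ : ℕ, ∀ n ≥ n₀, ∀ v : A.dom,
      |inner ℝ (r n) (v : Lp ℝ 2 μ) - p.2 v| ≤ ε * Real.sqrt (A.normSq v)}

/-- The space `F`, the domain of the closure of `Λ`. -/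
def spaceF (A : L2Form μ) (U : ContractionSemigroup μ) : Set A.dom :=
  {u | ∃ l : A.dom →ₗ[ℝ] ℝ, (u, l) ∈ closureGraph A U}

/-- The closure of `Λ`, as a map from `F` to linear functionals on `V`
(and `0` outside of `F`). -/
def closureOp (A : L2Form μ) (U : ContractionSemigroup μ) (u : A.dom) : A.dom →ₗ[ℝ] ℝ :=
  open Classical in
  if h : ∃ l : A.dom →ₗ[ℝ] ℝ, (u, l) ∈ closureGraph A U then h.choose else 0

/-- The generalized Dirichlet form `E(u, v) = A(u, v) - ⟨Λ u, v⟩` for `u ∈ F`, `v ∈ V`. -/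
def genForm (A : L2Form μ) (U : ContractionSemigroup μ) (u v : A.dom) : ℝ :=
  A.form u v - closureOp A U u v

/-- `T` corresponds to the generalized Dirichlet form: its resolvent satisfies `G_α(H) ⊆ F` and
`E(G_α f, v) + α (G_α f, v) = (f, v)` for `f ∈ H`, `v ∈ V`, `α > 0`. This determines the resolvent,
hence `T_t` for all `t ≥ 0`. -/
def IsAssociated (A : L2Form μ) (U T : ContractionSemigroup μ) : Prop :=
  ∀ α : ℝ, 0 < α → ∀ f : Lp ℝ 2 μ, ∃ w : A.dom,
    (w : Lp ℝ 2 μ) = T.resolvent α f ∧ w ∈ spaceF A U ∧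
      ∀ v : A.dom, genForm A U w v + α * inner ℝ (w : Lp ℝ 2 μ) (v : Lp ℝ 2 μ)
        = inner ℝ f (v : Lp ℝ 2 μ)

/-- The semigroup `(T_t)` of the generalized Dirichlet form given by `A` and `U`. (The alternative
is never used when `A` is a Dirichlet form and `U` is sub-Markovian and restricts to `V`.) -/
def semigroup (A : L2Form μ) (U : ContractionSemigroup μ) : ContractionSemigroup μ :=
  open Classical in
  if h : ∃ T : ContractionSemigroup μ, IsAssociated A U T then h.choose
  else ContractionSemigroup.trivial μ

/-! ## Potential operator, transience, recurrence -/

/-- `S₁` is a continuous linear operator on `L¹` that agrees with `S` on `L¹ ∩ L²`. -/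
def IsL1Extension (S : Lp ℝ 2 μ →L[ℝ] Lp ℝ 2 μ) (S₁ : Lp ℝ 1 μ →L[ℝ] Lp ℝ 1 μ) : Prop :=
  ∀ (f₁ : Lp ℝ 1 μ) (f₂ : Lp ℝ 2 μ), f₁ =ᵐ[μ] f₂ → S₁ f₁ =ᵐ[μ] S f₂

/-- The continuous extension to `L¹` of the restriction of `S` to `L¹ ∩ L²`. It is unique since
`L¹ ∩ L²` is dense, and it exists if the adjoint of `S` is sub-Markovian. -/
def l1Extension (S : Lp ℝ 2 μ →L[ℝ] Lp ℝ 2 μ) : Lp ℝ 1 μ →L[ℝ] Lp ℝ 1 μ :=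
  open Classical in
  if h : ∃ S₁ : Lp ℝ 1 μ →L[ℝ] Lp ℝ 1 μ, IsL1Extension S S₁ then h.choose else 0

namespace ContractionSemigroup

/-- The potential `G f = lim_{n → ∞} ∫₀ⁿ T_t f dt ≤ ∞` of `0 ≤ f ∈ L¹(E, μ)`. The integral is an
`L¹`-valued one of the `L¹`-version of the semigroup; it is nonnegative and increasing in `n`
almost everywhere, so that the limit is a supremum. -/
def potential (T : ContractionSemigroup μ) (f : Lp ℝ 1 μ) (x : E) : ℝ≥0∞ :=
  ⨆ n : ℕ, ENNReal.ofReal ((∫ t in (0 : ℝ)..(n : ℝ), l1Extension (T.op t) f : Lp ℝ 1 μ) x)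

/-- Recurrence: `G f ∈ {0, ∞}` a.e. for every `0 ≤ f ∈ L¹`. -/
def IsRecurrent (T : ContractionSemigroup μ) : Prop :=
  ∀ f : Lp ℝ 1 μ, (∀ᵐ x ∂μ, 0 ≤ f x) → ∀ᵐ x ∂μ, T.potential f x = 0 ∨ T.potential f x = ∞

/-- Transience: `G g < ∞` a.e. for some `g ∈ L¹` with `g > 0` a.e. -/
def IsTransient (T : ContractionSemigroup μ) : Prop :=
  ∃ g : Lp ℝ 1 μ, (∀ᵐ x ∂μ, 0 < g x) ∧ ∀ᵐ x ∂μ, T.potential g x < ∞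

/-- `B` is weakly invariant: `T_t (f 1_B) = 0` a.e. on the complement of `B` for all `t > 0` and
`f ∈ L²`. -/
def IsWeaklyInvariant (T : ContractionSemigroup μ) (B : Set E) : Prop :=
  ∃ hB : MeasurableSet B, ∀ t : ℝ, 0 < t → ∀ f : Lp ℝ 2 μ,
    ∀ᵐ x ∂μ, x ∉ B → T.op t (((Lp.memLp f).indicator hB).toLp (B.indicator f)) x = 0

/-- Strict irreducibility: weakly invariant sets are null or have a null complement. -/
def IsStrictlyIrreducible (T : ContractionSemigroup μ) : Prop :=
  ∀ B : Set E, T.IsWeaklyInvariant B → μ B = 0 ∨ μ Bᶜ = 0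

/-- `g` is a bounded integrable function with `g > 0` a.e. whose potential `G g` is in `L^∞`. -/
structure IsReference (T : ContractionSemigroup μ) (g : Lp ℝ 1 μ) : Prop where
  pos : ∀ᵐ x ∂μ, 0 < g x
  bdd : EssBdd μ g
  potential_bdd : ∃ C : ℝ, ∀ᵐ x ∂μ, T.potential g x ≤ ENNReal.ofReal C

/-- Such a `g` is in `L²`. -/
theorem IsReference.memLp_two {T : ContractionSemigroup μ} {g : Lp ℝ 1 μ}
    (hg : T.IsReference g) : MemLp g 2 μ := by
  obtain ⟨C, hC⟩ := hg.bdd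
  have h1 : Integrable g μ := memLp_one_iff_integrable.1 (Lp.memLp g)
  refine (memLp_two_iff_integrable_sq h1.aestronglyMeasurable).2 ?_
  have h2 : Integrable (fun x => g x * g x) μ :=
    h1.bdd_mul h1.aestronglyMeasurable (by simpa [Real.norm_eq_abs] using hC)
  simpa [sq] using h2

/-- `g` as an element of `L²`. -/
def IsReference.toL2 {T : ContractionSemigroup μ} {g : Lp ℝ 1 μ} (hg : T.IsReference g) :
    Lp ℝ 2 μ := hg.memLp_two.toLp g

end ContractionSemigroup

/-! ## Linear perturbations of a sectorial Dirichlet form -/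

/-- With `(L, D(L))` the generator of `T`, so that the generalized Dirichlet form is
`E(u, v) = (-L u, v)` for `u ∈ D(L)`: bounded elements of `D(L)` are in `D(E⁰)`,
`E(u, v) = E⁰(u, v) + ∫ u N v dμ` for `u ∈ D(L)` bounded, `v ∈ D(N) ∩ D(E⁰)`, and
`E⁰(u, u) ≤ E(u, u)` for `u ∈ D(L)` bounded. -/
structure IsLinearPerturbation (T : ContractionSemigroup μ) (E₀ : L2Form μ)
    (N : Lp ℝ 2 μ →ₗ.[ℝ] Lp ℝ 2 μ) : Prop where
  mem_dom : ∀ u f : Lp ℝ 2 μ, T.HasGenerator u f → EssBdd μ u → u ∈ E₀.dom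
  decomposition : ∀ (u : E₀.dom) (f : Lp ℝ 2 μ), T.HasGenerator u f →
    EssBdd μ (u : Lp ℝ 2 μ) → ∀ (v : E₀.dom) (hv : (v : Lp ℝ 2 μ) ∈ N.domain),
      inner ℝ (-f) (v : Lp ℝ 2 μ) =
        E₀.form u v + ∫ x, (u : Lp ℝ 2 μ) x * N ⟨v, hv⟩ x ∂μ
  domination : ∀ (u : E₀.dom) (f : Lp ℝ 2 μ), T.HasGenerator u f →
    EssBdd μ (u : Lp ℝ 2 μ) → E₀.form u u ≤ inner ℝ (-f) (u : Lp ℝ 2 μ)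

/-- The space `D = {u ∈ D(N) ∩ D(E⁰) : N u ∈ L¹(E, μ)}`. -/
structure SpaceD (E₀ : L2Form μ) (N : Lp ℝ 2 μ →ₗ.[ℝ] Lp ℝ 2 μ) where
  val : Lp ℝ 2 μ
  mem_op : val ∈ N.domain
  mem_form : val ∈ E₀.dom
  integrable : Integrable (N ⟨val, mem_op⟩) μ

namespace SpaceD

variable {E₀ : L2Form μ} {N : Lp ℝ 2 μ →ₗ.[ℝ] Lp ℝ 2 μ}

/-- `u` as an element of `D(E⁰)`. -/
def inForm (u : SpaceD E₀ N) : E₀.dom := ⟨u.val, u.mem_form⟩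

/-- `N u`. -/
def image (u : SpaceD E₀ N) : Lp ℝ 2 μ := N ⟨u.val, u.mem_op⟩

end SpaceD

/-- There are `χₙ ∈ D`, `0 ≤ χₙ ≤ 1`, `χₙ → 1` a.e., with `E⁰(h, χₙ) + ∫ h N χₙ dμ → 0` for every
nonnegative bounded `h` in the extended Dirichlet space of `E⁰`. -/
def HasCutoffs (E₀ : L2Form μ) (N : Lp ℝ 2 μ →ₗ.[ℝ] Lp ℝ 2 μ) : Prop :=
  ∃ χ : ℕ → SpaceD E₀ N,
    (∀ n, ∀ᵐ x ∂μ, 0 ≤ (χ n).val x ∧ (χ n).val x ≤ 1) ∧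
    (∀ᵐ x ∂μ, Tendsto (fun n => (χ n).val x) atTop (𝓝 1)) ∧
    ∀ h : E → ℝ, E₀.InExtended h → (∀ᵐ x ∂μ, 0 ≤ h x) → EssBdd μ h →
      Tendsto (fun n => E₀.extForm h (χ n).inForm + ∫ x, h x * (χ n).image x ∂μ) atTop (𝓝 0)

end GenDirichlet

end

/-!
Why the theorem is true.

*Operators on `L¹`.* Since the adjoint semigroup is sub-Markovian, `T_t` is positive and contracts
the `L¹` norm on `L¹ ∩ L²`, so it extends to a contraction of `L¹`
(`exists_isL1Extension`), and by Scheffé's lemma the extended semigroup is strongly continuous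
(`IsDualSubMarkovian.l1_isContractionSemigroup`). Hence the integrals in the definition of the
potential are genuine Bochner integrals, they agree with the integrals in `L²`, and `G_α f ↑ G f`
almost everywhere as `α ↓ 0` (`IsDualSubMarkovian.tendsto_resolvent`).

*Reference functions.* That `(T_t)` itself is sub-Markovian is used only in the form of the weak
maximum principle `(f - α G_α f, (G_α f - c)⁺) ≥ 0`
(`L2Form.IsDirichlet.inner_sub_cutoff_nonneg`). It follows from the identity that defines `G_α`,
the contraction property of `A` and the inequality `⟨Λ u, u - u⁺ ∧ c⟩ ≤ 0`. It implies that a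
potential `G f` is bounded by its supremum on `{f > 0}`; a function `g₀ > 0` with `G g₀ < ∞` can
therefore be damped on the layers of `G g₀` to a reference function
(`IsTransient.exists_isReference`).

*The potential of a reference function `g`.* The functions `u = G_α g` are bounded and belong to
the domain of the generator `L`, with `-L u = g - α u`; so
`E⁰(u, u) + α (u, u) ≤ (g, u) ≤ ‖Gg‖_∞ ‖g‖₁`.
The energies are bounded and `α G_α g → 0` in `L²`. It remains to pass to the limit in
`(g - α u, v) = E⁰(u, v) + ∫ u N v dμ`. The main point is the following fact on sectorial Dirichlet
forms (`L2Form.IsDirichlet.tendsto_zero_of_ae_tendsto`): a sequence with bounded energy that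
converges to `0` a.e. converges to `0` weakly for the form. It shows that the extended form can be
computed along every a.e. convergent sequence with bounded energy, while convex combinations of
the `G_α g` (a Banach-Saks argument, `exists_cauchy_convexHull`) show that `Gg` is in the extended
Dirichlet space.

*Recurrence.* The identity for the cutoffs `χₙ` gives `∫ g dμ = lim (χₙ, g) = 0`, which is absurd
for `g > 0` and `μ ≠ 0`. For integrable `g > 0` the set `{Gg = ∞}` is weakly invariant; so a strictly
irreducible semigroup that is not transient has `Gg = ∞` a.e., and Hopf's maximal inequality shows
`Gf = 0` a.e. on `{Gf < ∞}` for every integrable `f ≥ 0`.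
-/

namespace GenDirichlet

variable {E : Type*} [MeasurableSpace E] {μ : Measure E}

/-! ### Order and convergence in `L^p` -/

section LpTools

variable {p : ℝ≥0∞}

instance Lp.instIsOrderedModule : IsOrderedModule ℝ (Lp ℝ p μ) :=
  .of_smul_nonneg fun c hc f hf => by
    rw [← Lp.coeFn_nonneg] at hf ⊢
    filter_upwards [hf, Lp.coeFn_smul c f] with x hx h
    rw [h]
    exact mul_nonneg hc hx

/-- Dominated convergence in `L^p`. -/
theorem tendsto_Lp_of_dominated [Fact (1 ≤ p)] (hp : p ≠ ∞) {f : ℕ → Lp ℝ p μ} {g : Lp ℝ p μ}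
    {b : E → ℝ} (hb : MemLp b p μ) (hfb : ∀ n, ∀ᵐ x ∂μ, |f n x| ≤ b x)
    (hfg : ∀ᵐ x ∂μ, Tendsto (fun n => f n x) atTop (𝓝 (g x))) :
    Tendsto f atTop (𝓝 g) := by
  have hp0 : p ≠ 0 := (lt_of_lt_of_le one_pos Fact.out).ne'
  have hpr : 0 < p.toReal := ENNReal.toReal_pos hp0 hp
  have hgb : ∀ᵐ x ∂μ, |g x| ≤ b x := by
    filter_upwards [hfg, ae_all_iff.2 hfb] with x h1 h2
    exact le_of_tendsto h1.abs (Eventually.of_forall h2)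
  rw [Lp.tendsto_Lp_iff_tendsto_eLpNorm']
  have key : Tendsto (fun n => ∫⁻ x, ‖(f n - g : E → ℝ) x‖ₑ ^ p.toReal ∂μ) atTop
      (𝓝 (∫⁻ x, 0 ∂μ)) := by
    refine tendsto_lintegral_of_dominated_convergence'
      (fun x => ‖(2 * b x : ℝ)‖ₑ ^ p.toReal) ?_ ?_ ?_ ?_
    · intro n
      exact (((Lp.aestronglyMeasurable (f n)).sub (Lp.aestronglyMeasurable g)).enorm).pow_const _
    · intro n
      filter_upwards [hfb n, hgb] with x h1 h2
      refine ENNReal.rpow_le_rpow ?_ hpr.le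
      rw [enorm_le_iff_norm_le, Real.norm_eq_abs, Real.norm_eq_abs]
      refine le_trans ?_ (le_abs_self _)
      simp only [Pi.sub_apply]
      exact (abs_sub _ _).trans (by linarith)
    · have h := (hb.const_mul 2).eLpNorm_lt_top
      rw [eLpNorm_eq_lintegral_rpow_enorm_toReal hp0 hp] at h
      exact (ENNReal.rpow_lt_top_iff_of_pos (by positivity)).1 h |>.ne
    · filter_upwards [hfg] with x hx
      have h1 : Tendsto (fun n => ‖f n x - g x‖ₑ) atTop (𝓝 0) := by
        rw [tendsto_iff_norm_sub_tendsto_zero] at hx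
        have := ENNReal.tendsto_ofReal hx
        simpa only [ofReal_norm, ENNReal.ofReal_zero] using this
      have h2 := h1.ennrpow_const p.toReal
      rwa [ENNReal.zero_rpow_of_pos hpr] at h2
  rw [lintegral_zero] at key
  have h3 := key.ennrpow_const (1 / p.toReal)
  rw [ENNReal.zero_rpow_of_pos (by positivity)] at h3
  simpa only [eLpNorm_eq_lintegral_rpow_enorm_toReal hp0 hp] using h3

theorem exists_subseq_ae_tendsto [Fact (1 ≤ p)] {f : ℕ → Lp ℝ p μ} {g : Lp ℝ p μ}
    (h : Tendsto f atTop (𝓝 g)) :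
    ∃ ns : ℕ → ℕ, StrictMono ns ∧ ∀ᵐ x ∂μ, Tendsto (fun i => f (ns i) x) atTop (𝓝 (g x)) :=
  (tendstoInMeasure_of_tendsto_eLpNorm (lt_of_lt_of_le one_pos Fact.out : (0 : ℝ≥0∞) < p).ne'
    (fun n => Lp.aestronglyMeasurable (f n)) (Lp.aestronglyMeasurable g)
    ((Lp.tendsto_Lp_iff_tendsto_eLpNorm' f g).1 h)).exists_seq_tendsto_ae

theorem inner_eq_integral (f g : Lp ℝ 2 μ) : inner ℝ f g = ∫ x, f x * g x ∂μ := by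
  rw [L2.inner_def]
  exact integral_congr_ae (Eventually.of_forall fun x => by simp [mul_comm])

theorem integrable_mul_L2 (f g : Lp ℝ 2 μ) : Integrable (fun x => f x * g x) μ :=
  (Lp.memLp f).integrable_mul (Lp.memLp g)

theorem integrable_L1 (f : Lp ℝ 1 μ) : Integrable f μ := L1.integrable_coeFn f

theorem setIntegral_eq_inner {s : Set E} (hs : MeasurableSet s) (hμs : μ s ≠ ∞) (f : Lp ℝ 2 μ) :
    ∫ x in s, f x ∂μ = inner ℝ f (indicatorConstLp 2 hs hμs (1 : ℝ)) := by
  rw [real_inner_comm, L2.inner_indicatorConstLp_one]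

theorem integrableOn_Lp [Fact (1 ≤ p)] (f : Lp ℝ p μ) {s : Set E} (hμs : μ s < ∞) :
    IntegrableOn f s μ := by
  have : Fact (μ s < ∞) := ⟨hμs⟩
  exact ((Lp.memLp f).restrict s).integrable Fact.out

theorem Lp_nonneg_of_setIntegral [SigmaFinite μ] [Fact (1 ≤ p)] {f : Lp ℝ p μ}
    (h : ∀ s, MeasurableSet s → μ s < ∞ → 0 ≤ ∫ x in s, f x ∂μ) : 0 ≤ f := by
  rw [← Lp.coeFn_nonneg]
  exact ae_nonneg_of_forall_setIntegral_nonneg_of_sigmaFinite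
    (fun s _ hμs => integrableOn_Lp f hμs) h

theorem setIntegral_integral_L2 {X : Type*} [MeasurableSpace X] {ν : Measure X}
    {φ : X → Lp ℝ 2 μ} (hφ : Integrable φ ν) {s : Set E} (hs : MeasurableSet s)
    (hμs : μ s < ∞) :
    ∫ x in s, (∫ t, φ t ∂ν : Lp ℝ 2 μ) x ∂μ = ∫ t, ∫ x in s, φ t x ∂μ ∂ν := by
  have h := (integral_inner (𝕜 := ℝ) hφ (indicatorConstLp 2 hs hμs.ne (1 : ℝ))).symm
  simpa only [L2.inner_indicatorConstLp_one] using h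

theorem setIntegral_integral_L1 {X : Type*} [MeasurableSpace X] {ν : Measure X}
    {φ : X → Lp ℝ 1 μ} (hφ : Integrable φ ν) (s : Set E) :
    ∫ x in s, (∫ t, φ t ∂ν : Lp ℝ 1 μ) x ∂μ = ∫ t, ∫ x in s, φ t x ∂μ ∂ν := by
  let ℓ : Lp ℝ 1 μ →L[ℝ] ℝ :=
    { toFun := fun f => ∫ x in s, f x ∂μ
      map_add' := fun f g => by
        rw [← integral_add (integrable_L1 f).integrableOn (integrable_L1 g).integrableOn]
        exact integral_congr_ae (ae_restrict_of_ae (Lp.coeFn_add f g))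
      map_smul' := fun c f => by
        rw [RingHom.id_apply, smul_eq_mul, ← integral_const_mul]
        exact integral_congr_ae (ae_restrict_of_ae (Lp.coeFn_smul c f))
      cont := continuous_setIntegral s }
  exact (ℓ.integral_comp_comm hφ).symm

/-- Bochner integrals in `L¹` and in `L²` of functions that agree almost everywhere agree. -/
theorem integral_L1_ae_eq_integral_L2 [SigmaFinite μ] {X : Type*} [MeasurableSpace X]
    {ν : Measure X} {φ₁ : X → Lp ℝ 1 μ} {φ₂ : X → Lp ℝ 2 μ} (h₁ : Integrable φ₁ ν)
    (h₂ : Integrable φ₂ ν) (h : ∀ᵐ t ∂ν, φ₁ t =ᵐ[μ] φ₂ t) :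
    (∫ t, φ₁ t ∂ν : Lp ℝ 1 μ) =ᵐ[μ] (∫ t, φ₂ t ∂ν : Lp ℝ 2 μ) := by
  refine ae_eq_of_forall_setIntegral_eq_of_sigmaFinite
    (fun s _ hμs => (integrable_L1 _).integrableOn) (fun s _ hμs => integrableOn_Lp _ hμs) ?_
  intro s hs hμs
  rw [setIntegral_integral_L1 h₁, setIntegral_integral_L2 h₂ hs hμs]
  refine integral_congr_ae ?_
  filter_upwards [h] with t ht
  exact integral_congr_ae (ae_restrict_of_ae ht)

end LpTools

/-! ### Truncation: `L¹ ∩ L²` is dense in `L¹` -/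

/-- The truncation `f 1_{|f| ≤ k}` of an integrable function; it is in `L¹ ∩ L²`. -/
noncomputable def trunc (f : Lp ℝ 1 μ) (k : ℕ) : Lp ℝ 1 μ :=
  ((Lp.memLp f).indicator (s := {x | |f x| ≤ k})
    ((Lp.stronglyMeasurable f).measurable.abs measurableSet_Iic)).toLp _

theorem trunc_coeFn (f : Lp ℝ 1 μ) (k : ℕ) :
    trunc f k =ᵐ[μ] indicator {x | |f x| ≤ k} f := MemLp.coeFn_toLp _

theorem memLp_two_of_bdd {f : Lp ℝ 1 μ} {C : ℝ} (hC : ∀ᵐ x ∂μ, |f x| ≤ C) : MemLp f 2 μ := by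
  have h1 := integrable_L1 f
  refine (memLp_two_iff_integrable_sq h1.aestronglyMeasurable).2 ?_
  have h2 : Integrable (fun x => f x * f x) μ :=
    h1.bdd_mul h1.aestronglyMeasurable (by simpa [Real.norm_eq_abs] using hC)
  simpa [sq] using h2

theorem trunc_memLp_two (f : Lp ℝ 1 μ) (k : ℕ) : MemLp (trunc f k) 2 μ := by
  refine memLp_two_of_bdd (C := k) ?_
  filter_upwards [trunc_coeFn f k] with x hx
  rw [hx]
  by_cases h : x ∈ {x | |f x| ≤ k}
  · rwa [indicator_of_mem h]
  · rw [indicator_of_notMem h, abs_zero]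
    positivity

theorem trunc_nonneg {f : Lp ℝ 1 μ} (hf : 0 ≤ f) (k : ℕ) : 0 ≤ trunc f k := by
  rw [← Lp.coeFn_nonneg] at hf ⊢
  filter_upwards [trunc_coeFn f k, hf] with x h1 h2
  rw [h1]
  by_cases hx : x ∈ {x | |f x| ≤ k}
  · rwa [indicator_of_mem hx]
  · rw [indicator_of_notMem hx]
    rfl

theorem tendsto_trunc (f : Lp ℝ 1 μ) : Tendsto (trunc f) atTop (𝓝 f) := by
  refine tendsto_Lp_of_dominated ENNReal.one_ne_top (Lp.memLp f).norm (fun n => ?_) ?_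
  · filter_upwards [trunc_coeFn f n] with x hx
    rw [hx, ← Real.norm_eq_abs]
    exact norm_indicator_le_norm_self _ _
  · filter_upwards [ae_all_iff.2 (trunc_coeFn f)] with x hx
    obtain ⟨n₀, hn₀⟩ := exists_nat_ge |f x|
    refine tendsto_const_nhds.congr' ?_
    filter_upwards [eventually_ge_atTop n₀] with n hn
    have : x ∈ {x | |f x| ≤ n} := hn₀.trans (by exact_mod_cast hn)
    rw [hx n, indicator_of_mem this]

/-! ### Operators with a sub-Markovian adjoint, and their extension to `L¹` -/

section DualSubMarkov

variable [SigmaFinite μ] {S R : Lp ℝ 2 μ →L[ℝ] Lp ℝ 2 μ} {S₁ S₁' R₁ : Lp ℝ 1 μ →L[ℝ] Lp ℝ 1 μ}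

omit [SigmaFinite μ] in
theorem setIntegral_op_eq (S : Lp ℝ 2 μ →L[ℝ] Lp ℝ 2 μ) (f : Lp ℝ 2 μ) {s : Set E}
    (hs : MeasurableSet s) (hμs : μ s ≠ ∞) :
    ∫ x in s, S f x ∂μ =
      ∫ x, f x * ContinuousLinearMap.adjoint S (indicatorConstLp 2 hs hμs (1 : ℝ)) x ∂μ := by
  rw [setIntegral_eq_inner hs hμs, ← ContinuousLinearMap.adjoint_inner_right, inner_eq_integral]

omit [SigmaFinite μ] in
theorem IsSubMarkov.indicator_mem_Icc (hS : IsSubMarkov S) {s : Set E} (hs : MeasurableSet s)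
    (hμs : μ s ≠ ∞) :
    ∀ᵐ x ∂μ, 0 ≤ S (indicatorConstLp 2 hs hμs (1 : ℝ)) x ∧
      S (indicatorConstLp 2 hs hμs (1 : ℝ)) x ≤ 1 := by
  refine hS _ ?_
  filter_upwards [indicatorConstLp_coeFn (p := 2) (hs := hs) (hμs := hμs) (c := (1 : ℝ))] with x hx
  rw [hx]
  by_cases h : x ∈ s <;> simp [h]

theorem op_nonneg (hS : IsSubMarkov (ContinuousLinearMap.adjoint S)) {f : Lp ℝ 2 μ}
    (hf : 0 ≤ f) : 0 ≤ S f := by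
  refine Lp_nonneg_of_setIntegral fun s hs hμs => ?_
  rw [setIntegral_op_eq S f hs hμs.ne]
  rw [← Lp.coeFn_nonneg] at hf
  refine integral_nonneg_of_ae ?_
  filter_upwards [hS.indicator_mem_Icc hs hμs.ne, hf] with x h1 h2
  exact mul_nonneg h2 h1.1

theorem op_mono (hS : IsSubMarkov (ContinuousLinearMap.adjoint S)) {f g : Lp ℝ 2 μ}
    (hfg : f ≤ g) : S f ≤ S g := by
  rw [← sub_nonneg, ← map_sub]
  exact op_nonneg hS (sub_nonneg.2 hfg)

theorem abs_op_le (hS : IsSubMarkov (ContinuousLinearMap.adjoint S)) (f : Lp ℝ 2 μ) :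
    |S f| ≤ S |f| := by
  refine sup_le (op_mono hS (le_abs_self f)) ?_
  rw [← map_neg]
  exact op_mono hS (neg_le_abs f)

/-- An operator whose adjoint is sub-Markovian does not increase the `L¹` norm of nonnegative
functions: `∫_s S f = (f, S* 1_s) ≤ ∫ f`. -/
theorem eLpNorm_one_op_le_of_nonneg (hS : IsSubMarkov (ContinuousLinearMap.adjoint S))
    {f : Lp ℝ 2 μ} (hf : 0 ≤ f) : eLpNorm (S f) 1 μ ≤ eLpNorm f 1 μ := by
  by_cases hfin : eLpNorm f 1 μ = ∞
  · rw [hfin]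
    exact le_top
  have hfi : Integrable f μ :=
    memLp_one_iff_integrable.1 ⟨Lp.aestronglyMeasurable f, lt_top_iff_ne_top.2 hfin⟩
  have hSf := op_nonneg hS hf
  rw [← Lp.coeFn_nonneg] at hf hSf
  have hset : ∀ s, MeasurableSet s → μ s < ∞ → ∫⁻ x in s, ‖S f x‖ₑ ∂μ ≤ eLpNorm f 1 μ := by
    intro s hs hμs
    have h1 : ∫⁻ x in s, ‖S f x‖ₑ ∂μ = ENNReal.ofReal (∫ x in s, S f x ∂μ) := by
      rw [ofReal_integral_eq_lintegral_ofReal (integrableOn_Lp _ hμs) (ae_restrict_of_ae hSf)]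
      refine lintegral_congr_ae (ae_restrict_of_ae ?_)
      filter_upwards [hSf] with x hx
      rw [Real.enorm_of_nonneg hx]
    have h2 : eLpNorm f 1 μ = ENNReal.ofReal (∫ x, f x ∂μ) := by
      rw [eLpNorm_one_eq_lintegral_enorm, ofReal_integral_eq_lintegral_ofReal hfi hf]
      refine lintegral_congr_ae ?_
      filter_upwards [hf] with x hx
      rw [Real.enorm_of_nonneg hx]
    rw [h1, h2, setIntegral_op_eq S f hs hμs.ne]
    refine ENNReal.ofReal_le_ofReal (integral_mono_ae (integrable_mul_L2 _ _) hfi ?_)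
    filter_upwards [hS.indicator_mem_Icc hs hμs.ne, hf] with x h3 h4
    exact mul_le_of_le_one_right h4 h3.2
  rw [eLpNorm_one_eq_lintegral_enorm, ← setLIntegral_univ, ← iUnion_spanningSets μ,
    setLIntegral_iUnion_of_directed _ (monotone_spanningSets μ).directed_le]
  exact iSup_le fun n => hset _ (measurableSet_spanningSets μ n) (measure_spanningSets_lt_top μ n)

theorem eLpNorm_one_op_le (hS : IsSubMarkov (ContinuousLinearMap.adjoint S)) (f : Lp ℝ 2 μ) :
    eLpNorm (S f) 1 μ ≤ eLpNorm f 1 μ := by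
  have h1 := abs_op_le hS f
  rw [← Lp.coeFn_le] at h1
  calc eLpNorm (S f) 1 μ ≤ eLpNorm (S |f|) 1 μ := by
        refine eLpNorm_mono_ae ?_
        filter_upwards [h1, Lp.coeFn_abs (S f)] with x h2 h3
        rw [h3] at h2
        exact h2.trans (le_abs_self _)
    _ ≤ eLpNorm (|f| : Lp ℝ 2 μ) 1 μ := eLpNorm_one_op_le_of_nonneg hS (abs_nonneg f)
    _ = eLpNorm f 1 μ := by
        refine eLpNorm_congr_norm_ae ?_
        filter_upwards [Lp.coeFn_abs f] with x hx
        rw [hx, Real.norm_eq_abs, Real.norm_eq_abs, abs_abs]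

theorem exists_isL1Extension (hS : IsSubMarkov (ContinuousLinearMap.adjoint S)) :
    ∃ S₁ : Lp ℝ 1 μ →L[ℝ] Lp ℝ 1 μ, IsL1Extension S S₁ := by
  let M : Submodule ℝ (Lp ℝ 1 μ) :=
    { carrier := {f | MemLp f 2 μ}
      add_mem' := fun {f g} hf hg => (memLp_congr_ae (Lp.coeFn_add f g)).2 (MemLp.add hf hg)
      zero_mem' := (memLp_congr_ae (Lp.coeFn_zero ℝ 1 μ)).2 MemLp.zero
      smul_mem' := fun c f hf => (memLp_congr_ae (Lp.coeFn_smul c f)).2 (MemLp.const_smul hf c) }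
  have hM : ∀ f : M, MemLp (f : Lp ℝ 1 μ) 2 μ := fun f => f.2
  let ι : M → Lp ℝ 2 μ := fun f => (hM f).toLp _
  have hι : ∀ f : M, ι f =ᵐ[μ] (f : Lp ℝ 1 μ) := fun f => MemLp.coeFn_toLp _
  have hSι : ∀ f : M, MemLp (S (ι f)) 1 μ := fun f =>
    ⟨Lp.aestronglyMeasurable _, (eLpNorm_one_op_le hS _).trans_lt
      (by rw [eLpNorm_congr_ae (hι f)]; exact (Lp.memLp (f : Lp ℝ 1 μ)).2)⟩
  have hadd : ∀ f g : M, ι (f + g) = ι f + ι g := fun f g => by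
    refine Lp.ext ?_
    filter_upwards [hι (f + g), hι f, hι g, Lp.coeFn_add (ι f) (ι g),
      Lp.coeFn_add (f : Lp ℝ 1 μ) g] with x h1 h2 h3 h4 h5
    rw [h1, h4, Pi.add_apply, h2, h3, Submodule.coe_add, h5, Pi.add_apply]
  have hsmul : ∀ (c : ℝ) (f : M), ι (c • f) = c • ι f := fun c f => by
    refine Lp.ext ?_
    filter_upwards [hι (c • f), hι f, Lp.coeFn_smul c (ι f),
      Lp.coeFn_smul c (f : Lp ℝ 1 μ)] with x h1 h2 h3 h4
    rw [h1, h3, Pi.smul_apply, h2, Submodule.coe_smul, h4, Pi.smul_apply]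
  let F : M →ₗ[ℝ] Lp ℝ 1 μ :=
    { toFun := fun f => (hSι f).toLp _
      map_add' := fun f g => by
        refine Lp.ext ?_
        filter_upwards [(hSι (f + g)).coeFn_toLp, (hSι f).coeFn_toLp, (hSι g).coeFn_toLp,
          Lp.coeFn_add ((hSι f).toLp _) ((hSι g).toLp _),
          Lp.coeFn_add (S (ι f)) (S (ι g))] with x h1 h2 h3 h4 h5
        rw [h1, h4, Pi.add_apply, h2, h3, hadd, map_add, h5, Pi.add_apply]
      map_smul' := fun c f => by
        refine Lp.ext ?_
        filter_upwards [(hSι (c • f)).coeFn_toLp, (hSι f).coeFn_toLp,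
          Lp.coeFn_smul c ((hSι f).toLp _), Lp.coeFn_smul c (S (ι f))] with x h1 h2 h3 h4
        rw [h1, RingHom.id_apply, h3, Pi.smul_apply, h2, hsmul, map_smul, h4, Pi.smul_apply] }
  have hF : ∀ f : M, ‖F f‖ ≤ 1 * ‖M.subtype f‖ := fun f => by
    rw [one_mul]
    change ‖(hSι f).toLp _‖ ≤ ‖(f : Lp ℝ 1 μ)‖
    rw [Lp.norm_toLp, Lp.norm_def, ← eLpNorm_congr_ae (hι f)]
    refine ENNReal.toReal_mono ?_ (eLpNorm_one_op_le hS _)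
    rw [eLpNorm_congr_ae (hι f)]
    exact (Lp.memLp (f : Lp ℝ 1 μ)).2.ne
  have hdense : DenseRange M.subtype := fun f =>
    mem_closure_of_tendsto (tendsto_trunc f)
      (Eventually.of_forall fun k => ⟨⟨trunc f k, trunc_memLp_two f k⟩, rfl⟩)
  refine ⟨F.extendOfNorm M.subtype, fun f₁ f₂ h => ?_⟩
  have hf : MemLp f₁ 2 μ := (memLp_congr_ae h).2 (Lp.memLp f₂)
  have h1 : ι ⟨f₁, hf⟩ = f₂ := Lp.ext ((hι _).trans h)
  have h2 := LinearMap.extendOfNorm_eq hdense ⟨1, hF⟩ ⟨f₁, hf⟩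
  rw [Submodule.subtype_apply] at h2
  rw [h2, ← h1]
  exact (hSι _).coeFn_toLp

theorem isL1Extension_l1Extension (hS : IsSubMarkov (ContinuousLinearMap.adjoint S)) :
    IsL1Extension S (l1Extension S) := by
  have h := exists_isL1Extension hS
  rw [l1Extension, dif_pos h]
  exact h.choose_spec

omit [SigmaFinite μ] in
theorem IsL1Extension.trunc_ae_eq (h : IsL1Extension S S₁) (f : Lp ℝ 1 μ) (k : ℕ) :
    S₁ (trunc f k) =ᵐ[μ] S ((trunc_memLp_two f k).toLp _) :=
  h _ _ (MemLp.coeFn_toLp _).symm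

omit [SigmaFinite μ] in
theorem IsL1Extension.unique (h : IsL1Extension S S₁) (h' : IsL1Extension S S₁') : S₁ = S₁' := by
  ext1 f
  refine tendsto_nhds_unique (((S₁.continuous.tendsto f).comp (tendsto_trunc f)))
    (((S₁'.continuous.tendsto f).comp (tendsto_trunc f)).congr fun k => ?_)
  exact Lp.ext ((h'.trunc_ae_eq f k).trans (h.trunc_ae_eq f k).symm)

theorem IsL1Extension.nonneg (h : IsL1Extension S S₁)
    (hS : IsSubMarkov (ContinuousLinearMap.adjoint S)) {f : Lp ℝ 1 μ} (hf : 0 ≤ f) :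
    0 ≤ S₁ f := by
  refine ge_of_tendsto' ((S₁.continuous.tendsto f).comp (tendsto_trunc f)) fun k => ?_
  rw [Function.comp_apply, ← Lp.coeFn_nonneg]
  have h0 : 0 ≤ (trunc_memLp_two f k).toLp _ := by
    rw [← Lp.coeFn_nonneg]
    filter_upwards [(trunc_memLp_two f k).coeFn_toLp,
      (Lp.coeFn_nonneg _).2 (trunc_nonneg hf k)] with x h1 h2
    rwa [h1]
  filter_upwards [h.trunc_ae_eq f k, (Lp.coeFn_nonneg _).2 (op_nonneg hS h0)] with x h1 h2
  rwa [h1]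

theorem IsL1Extension.norm_apply_le (h : IsL1Extension S S₁)
    (hS : IsSubMarkov (ContinuousLinearMap.adjoint S)) (f : Lp ℝ 1 μ) : ‖S₁ f‖ ≤ ‖f‖ := by
  refine le_of_tendsto_of_tendsto' ((S₁.continuous.tendsto f).comp (tendsto_trunc f)).norm
    (tendsto_trunc f).norm fun k => ?_
  rw [Function.comp_apply, Lp.norm_def, Lp.norm_def, eLpNorm_congr_ae (h.trunc_ae_eq f k)]
  refine ENNReal.toReal_mono (Lp.memLp (trunc f k)).2.ne ((eLpNorm_one_op_le hS _).trans_eq ?_)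
  exact eLpNorm_congr_ae (MemLp.coeFn_toLp _)

omit [SigmaFinite μ] in
theorem IsL1Extension.comp (h : IsL1Extension S S₁) (h' : IsL1Extension R R₁) :
    IsL1Extension (S.comp R) (S₁.comp R₁) :=
  fun f₁ f₂ hf => h _ _ (h' f₁ f₂ hf)

end DualSubMarkov

/-! ### Strongly continuous contraction semigroups on a Banach space -/

section AbstractSemigroup

variable {X : Type*} [NormedAddCommGroup X] [NormedSpace ℝ X]

/-- A strongly continuous semigroup of contractions on a normed space; only the operators with
index `t ≥ 0` are meaningful. It is used for the semigroup on `L²` and for its version on `L¹`. -/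
structure IsContractionSemigroup (Q : ℝ → X →L[ℝ] X) : Prop where
  zero : Q 0 = ContinuousLinearMap.id ℝ X
  add : ∀ s t : ℝ, 0 ≤ s → 0 ≤ t → Q (s + t) = (Q s).comp (Q t)
  norm_le : ∀ t : ℝ, 0 ≤ t → ∀ f, ‖Q t f‖ ≤ ‖f‖
  tendsto : ∀ f, Tendsto (fun t => Q t f) (𝓝[>] 0) (𝓝 f)

namespace IsContractionSemigroup

variable {Q : ℝ → X →L[ℝ] X}

theorem continuousOn (hQ : IsContractionSemigroup Q) (f : X) :
    ContinuousOn (fun t => Q t f) (Ici 0) := by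
  have key : ∀ s t : ℝ, 0 ≤ s → s ≤ t → ‖Q t f - Q s f‖ ≤ ‖Q (t - s) f - f‖ := by
    intro s t hs hst
    have h : Q t f = Q s (Q (t - s) f) := by
      conv_lhs => rw [show t = s + (t - s) by ring, hQ.add s (t - s) hs (sub_nonneg.2 hst)]
      rfl
    rw [h, ← map_sub]
    exact hQ.norm_le s hs _
  rw [Metric.continuousOn_iff]
  intro s hs ε hε
  have h := hQ.tendsto f
  rw [Metric.tendsto_nhdsWithin_nhds] at h
  obtain ⟨δ, hδ, h⟩ := h ε hε
  refine ⟨δ, hδ, fun t ht hts => ?_⟩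
  rcases lt_trichotomy s t with hlt | rfl | hlt
  · rw [dist_eq_norm]
    refine (key s t hs hlt.le).trans_lt ?_
    rw [← dist_eq_norm]
    refine h (sub_pos.2 hlt : (0 : ℝ) < t - s) ?_
    rw [Real.dist_eq] at hts ⊢
    simpa using hts
  · simpa using hε
  · rw [dist_comm, dist_eq_norm]
    refine (key t s ht hlt.le).trans_lt ?_
    rw [← dist_eq_norm]
    refine h (sub_pos.2 hlt : (0 : ℝ) < s - t) ?_
    rw [dist_comm, Real.dist_eq] at hts
    rw [Real.dist_eq]
    simpa using hts

theorem intervalIntegrable (hQ : IsContractionSemigroup Q) (f : X) {a b : ℝ} (ha : 0 ≤ a)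
    (hb : 0 ≤ b) : IntervalIntegrable (fun t => Q t f) volume a b :=
  ((hQ.continuousOn f).mono fun _ ht => (le_inf ha hb).trans ht.1).intervalIntegrable

theorem apply_integral [CompleteSpace X] (hQ : IsContractionSemigroup Q) (f : X) {s b : ℝ}
    (hs : 0 ≤ s) (hb : 0 ≤ b) :
    Q s (∫ t in (0 : ℝ)..b, Q t f) = ∫ t in s..(s + b), Q t f := by
  rw [← ContinuousLinearMap.intervalIntegral_comp_comm _ (hQ.intervalIntegrable f le_rfl hb)]
  have h : ∫ t in (0 : ℝ)..b, Q s (Q t f) = ∫ t in (0 : ℝ)..b, Q (s + t) f := by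
    refine intervalIntegral.integral_congr fun t ht => ?_
    rw [uIcc_of_le hb] at ht
    rw [hQ.add s t hs ht.1]
    rfl
  rw [h, intervalIntegral.integral_comp_add_left (fun t => Q t f), add_zero]

theorem apply_integral_eq_sub [CompleteSpace X] (hQ : IsContractionSemigroup Q) (f : X) {s b : ℝ}
    (hs : 0 ≤ s) (hb : 0 ≤ b) :
    Q s (∫ t in (0 : ℝ)..b, Q t f) =
      (∫ t in (0 : ℝ)..(s + b), Q t f) - ∫ t in (0 : ℝ)..s, Q t f := by
  rw [hQ.apply_integral f hs hb, intervalIntegral.integral_interval_sub_left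
    (hQ.intervalIntegrable f le_rfl (add_nonneg hs hb)) (hQ.intervalIntegrable f le_rfl hs)]

theorem integral_nat_mul [CompleteSpace X] (hQ : IsContractionSemigroup Q) (f : X) {m : ℝ}
    (hm : 0 ≤ m) (n : ℕ) :
    ∫ t in (0 : ℝ)..(n * m), Q t f =
      ∑ k ∈ Finset.range n, ((Q m) ^ k) (∫ t in (0 : ℝ)..m, Q t f) := by
  induction n with
  | zero => simp
  | succ n ih =>
    have h := hQ.apply_integral_eq_sub f hm (mul_nonneg n.cast_nonneg hm)
    rw [ih] at h
    rw [Finset.sum_range_succ', Nat.cast_succ, add_mul, one_mul, add_comm (n * m) m,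
      eq_add_of_sub_eq h.symm, map_sum]
    simp [pow_succ']

theorem norm_integral_le (hQ : IsContractionSemigroup Q) (f : X) {b : ℝ} (hb : 0 ≤ b) :
    ‖∫ t in (0 : ℝ)..b, Q t f‖ ≤ b * ‖f‖ := by
  have h := intervalIntegral.norm_integral_le_of_norm_le_const (a := 0) (b := b)
    (f := fun t => Q t f) (C := ‖f‖) fun t ht => by
      rw [uIoc_of_le hb] at ht
      exact hQ.norm_le t ht.1.le f
  rwa [sub_zero, abs_of_nonneg hb, mul_comm] at h

theorem integral_add_vec (hQ : IsContractionSemigroup Q) (f g : X) {b : ℝ} (hb : 0 ≤ b) :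
    ∫ t in (0 : ℝ)..b, Q t (f + g) =
      (∫ t in (0 : ℝ)..b, Q t f) + ∫ t in (0 : ℝ)..b, Q t g := by
  simp_rw [map_add]
  exact intervalIntegral.integral_add (hQ.intervalIntegrable f le_rfl hb)
    (hQ.intervalIntegrable g le_rfl hb)

theorem integral_sub_vec (hQ : IsContractionSemigroup Q) (f g : X) {b : ℝ} (hb : 0 ≤ b) :
    ∫ t in (0 : ℝ)..b, Q t (f - g) =
      (∫ t in (0 : ℝ)..b, Q t f) - ∫ t in (0 : ℝ)..b, Q t g := by
  simp_rw [map_sub]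
  exact intervalIntegral.integral_sub (hQ.intervalIntegrable f le_rfl hb)
    (hQ.intervalIntegrable g le_rfl hb)

theorem tendsto_integral (hQ : IsContractionSemigroup Q) {f : ℕ → X} {g : X}
    (h : Tendsto f atTop (𝓝 g)) {b : ℝ} (hb : 0 ≤ b) :
    Tendsto (fun k => ∫ t in (0 : ℝ)..b, Q t (f k)) atTop (𝓝 (∫ t in (0 : ℝ)..b, Q t g)) := by
  rw [tendsto_iff_norm_sub_tendsto_zero] at h ⊢
  refine squeeze_zero (fun _ => norm_nonneg _) (fun k => ?_) (by simpa using h.const_mul b)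
  rw [← hQ.integral_sub_vec _ _ hb]
  exact hQ.norm_integral_le _ hb

end IsContractionSemigroup

end AbstractSemigroup

/-! ### The semigroup on `L¹` -/

theorem norm_eq_integral_of_nonneg {f : Lp ℝ 1 μ} (hf : 0 ≤ f) : ‖f‖ = ∫ x, f x ∂μ := by
  rw [L1.norm_eq_integral_norm]
  refine integral_congr_ae ?_
  filter_upwards [(Lp.coeFn_nonneg f).2 hf] with x hx
  exact Real.norm_of_nonneg hx

/-- Scheffé's lemma: an a.e. convergent sequence of nonnegative functions whose `L¹` norms do not
exceed that of the limit converges in `L¹`. -/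
theorem tendsto_L1_of_ae_tendsto_of_norm_le {f : ℕ → Lp ℝ 1 μ} {g : Lp ℝ 1 μ}
    (hf : ∀ n, 0 ≤ f n) (hg : 0 ≤ g) (hle : ∀ n, ‖f n‖ ≤ ‖g‖)
    (hfg : ∀ᵐ x ∂μ, Tendsto (fun n => f n x) atTop (𝓝 (g x))) :
    Tendsto f atTop (𝓝 g) := by
  have hint : ∀ n, Integrable (fun x => max (g x - f n x) 0) μ := fun n =>
    ((integrable_L1 g).sub (integrable_L1 (f n))).pos_part
  -- `|f - g| = (f - g) + 2 (g - f)⁺`, and the integral of the first term is nonpositive.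
  have hbound : ∀ n, ‖f n - g‖ ≤ 2 * ∫ x, max (g x - f n x) 0 ∂μ := by
    intro n
    have h1 : ‖f n - g‖ = ∫ x, ((f n x - g x) + 2 * max (g x - f n x) 0) ∂μ := by
      rw [L1.norm_eq_integral_norm]
      refine integral_congr_ae ?_
      filter_upwards [Lp.coeFn_sub (f n) g] with x hx
      rw [hx, Pi.sub_apply, Real.norm_eq_abs]
      rcases le_total (f n x) (g x) with h | h
      · rw [abs_of_nonpos (by linarith), max_eq_left (by linarith)]
        ring
      · rw [abs_of_nonneg (by linarith), max_eq_right (by linarith)]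
        ring
    have h2 : Integrable (fun x => f n x - g x) μ := (integrable_L1 _).sub (integrable_L1 _)
    rw [h1, integral_add h2 ((hint n).const_mul 2),
      integral_sub (integrable_L1 _) (integrable_L1 _), integral_const_mul,
      ← norm_eq_integral_of_nonneg (hf n), ← norm_eq_integral_of_nonneg hg]
    linarith [hle n]
  rw [tendsto_iff_norm_sub_tendsto_zero]
  have hlim : Tendsto (fun n => ∫ x, max (g x - f n x) 0 ∂μ) atTop (𝓝 (∫ _, 0 ∂μ)) := ?_
  · refine squeeze_zero (fun _ => norm_nonneg _) hbound ?_
    simpa using hlim.const_mul 2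
  refine tendsto_integral_of_dominated_convergence (fun x => g x) (fun n => (hint n).1)
    (integrable_L1 g) (fun n => ?_) ?_
  · filter_upwards [(Lp.coeFn_nonneg _).2 (hf n), (Lp.coeFn_nonneg _).2 hg] with x h1 h2
    rw [Real.norm_of_nonneg (le_max_right _ _)]
    exact max_le (sub_le_self _ h1) h2
  · filter_upwards [hfg] with x hx
    have : Tendsto (fun n => max (g x - f n x) 0) atTop (𝓝 (max (g x - g x) 0)) :=
      (tendsto_const_nhds.sub hx).max tendsto_const_nhds
    simpa using this

namespace ContractionSemigroup

theorem isContractionSemigroup (T : ContractionSemigroup μ) : IsContractionSemigroup T.op where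
  zero := T.op_zero
  add := T.op_add
  norm_le t ht f := by
    simpa using (T.op t).le_of_opNorm_le (T.norm_le t ht) f
  tendsto := T.continuous_zero

/-- The semigroup on `L¹` that extends the given one. -/
noncomputable def l1Op (T : ContractionSemigroup μ) (t : ℝ) : Lp ℝ 1 μ →L[ℝ] Lp ℝ 1 μ :=
  l1Extension (T.op t)

variable {T : ContractionSemigroup μ}

theorem IsDualSubMarkovian.adjoint_op (hT : T.IsDualSubMarkovian) {t : ℝ} (ht : 0 ≤ t) :
    IsSubMarkov (ContinuousLinearMap.adjoint (T.op t)) := by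
  rcases ht.eq_or_lt with rfl | ht
  · intro f hf
    have : ContinuousLinearMap.adjoint (T.op 0) f = f := by
      refine ext_inner_left ℝ fun v => ?_
      rw [ContinuousLinearMap.adjoint_inner_right, T.op_zero]
      rfl
    rwa [this]
  · exact hT t ht

variable [SigmaFinite μ]

theorem IsDualSubMarkovian.op_nonneg (hT : T.IsDualSubMarkovian) {t : ℝ} (ht : 0 ≤ t)
    {f : Lp ℝ 2 μ} (hf : 0 ≤ f) : 0 ≤ T.op t f :=
  GenDirichlet.op_nonneg (hT.adjoint_op ht) hf

theorem IsDualSubMarkovian.isL1Extension (hT : T.IsDualSubMarkovian) {t : ℝ} (ht : 0 ≤ t) :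
    IsL1Extension (T.op t) (T.l1Op t) :=
  isL1Extension_l1Extension (hT.adjoint_op ht)

theorem IsDualSubMarkovian.l1Op_nonneg (hT : T.IsDualSubMarkovian) {t : ℝ} (ht : 0 ≤ t)
    {f : Lp ℝ 1 μ} (hf : 0 ≤ f) : 0 ≤ T.l1Op t f :=
  (hT.isL1Extension ht).nonneg (hT.adjoint_op ht) hf

theorem IsDualSubMarkovian.l1Op_mono (hT : T.IsDualSubMarkovian) {t : ℝ} (ht : 0 ≤ t)
    {f g : Lp ℝ 1 μ} (hfg : f ≤ g) : T.l1Op t f ≤ T.l1Op t g := by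
  rw [← sub_nonneg, ← map_sub]
  exact hT.l1Op_nonneg ht (sub_nonneg.2 hfg)

theorem IsDualSubMarkovian.norm_l1Op_le (hT : T.IsDualSubMarkovian) {t : ℝ} (ht : 0 ≤ t)
    (f : Lp ℝ 1 μ) : ‖T.l1Op t f‖ ≤ ‖f‖ :=
  (hT.isL1Extension ht).norm_apply_le (hT.adjoint_op ht) f

theorem IsDualSubMarkovian.tendsto_l1Op_of_nonneg (hT : T.IsDualSubMarkovian) {f : Lp ℝ 1 μ}
    (hf : 0 ≤ f) (hf2 : MemLp f 2 μ) : Tendsto (fun t => T.l1Op t f) (𝓝[>] 0) (𝓝 f) := by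
  refine tendsto_of_seq_tendsto fun t ht => ?_
  have ht' := tendsto_nhdsWithin_iff.1 ht
  obtain ⟨n₀, hn₀⟩ := eventually_atTop.1 ht'.2
  refine tendsto_of_subseq_tendsto fun ns hns => ?_
  have h2 : Tendsto (fun k => T.op (t (ns (k + n₀))) (hf2.toLp f)) atTop (𝓝 (hf2.toLp f)) :=
    (((T.continuous_zero (hf2.toLp f)).comp ht).comp hns).comp (tendsto_add_atTop_nat n₀)
  obtain ⟨N₁, hN₁⟩ := eventually_atTop.1 (hns.eventually_ge_atTop n₀)
  obtain ⟨ms, hms, hae⟩ := exists_subseq_ae_tendsto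
    (h2.comp (tendsto_add_atTop_nat N₁))
  refine ⟨fun k => ms k + N₁ + n₀, ?_⟩
  have hpos : ∀ k, 0 ≤ t (ns (ms k + N₁ + n₀)) := fun k =>
    (hn₀ _ (hN₁ _ (by omega))).le
  refine tendsto_L1_of_ae_tendsto_of_norm_le (fun k => hT.l1Op_nonneg (hpos k) hf) hf
    (fun k => hT.norm_l1Op_le (hpos k) f) ?_
  have hagree : ∀ k, T.l1Op (t (ns (ms k + N₁ + n₀))) f =ᵐ[μ]
      T.op (t (ns (ms k + N₁ + n₀))) (hf2.toLp f) := fun k =>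
    hT.isL1Extension (hpos k) _ _ hf2.coeFn_toLp.symm
  filter_upwards [hae, ae_all_iff.2 hagree, hf2.coeFn_toLp] with x h3 h4 h5
  rw [h5] at h3
  exact h3.congr fun k => (h4 k).symm

/-- The `L¹` version of a semigroup with sub-Markovian adjoint is a strongly continuous semigroup
of contractions. -/
theorem IsDualSubMarkovian.l1_isContractionSemigroup (hT : T.IsDualSubMarkovian) :
    IsContractionSemigroup T.l1Op where
  zero := (hT.isL1Extension le_rfl).unique fun f₁ f₂ h => by
    rw [T.op_zero]
    exact h
  add s t hs ht := (hT.isL1Extension (add_nonneg hs ht)).unique <| by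
    rw [T.op_add s t hs ht]
    exact (hT.isL1Extension hs).comp (hT.isL1Extension ht)
  norm_le t ht f := hT.norm_l1Op_le ht f
  tendsto f := by
    have hclosed : ∀ g : Lp ℝ 1 μ, (∀ k, Tendsto (fun t => T.l1Op t (trunc g k)) (𝓝[>] 0)
        (𝓝 (trunc g k))) → Tendsto (fun t => T.l1Op t g) (𝓝[>] 0) (𝓝 g) := by
      intro g hg
      rw [Metric.tendsto_nhds]
      intro ε hε
      obtain ⟨k, hk⟩ := ((Metric.tendsto_nhds.1 (tendsto_trunc g)) (ε / 3) (by positivity)).exists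
      filter_upwards [(Metric.tendsto_nhds.1 (hg k)) (ε / 3) (by positivity),
        self_mem_nhdsWithin] with t ht ht0
      have h1 : dist (T.l1Op t g) (T.l1Op t (trunc g k)) ≤ dist (trunc g k) g := by
        rw [dist_eq_norm, ← map_sub, dist_comm, dist_eq_norm]
        exact hT.norm_l1Op_le (le_of_lt ht0) _
      calc dist (T.l1Op t g) g
          ≤ dist (T.l1Op t g) (T.l1Op t (trunc g k)) + dist (T.l1Op t (trunc g k)) (trunc g k)
            + dist (trunc g k) g := dist_triangle4 _ _ _ _
        _ < ε := by linarith
    have hpos : ∀ g : Lp ℝ 1 μ, 0 ≤ g → Tendsto (fun t => T.l1Op t g) (𝓝[>] 0) (𝓝 g) :=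
      fun g hg => hclosed g fun k =>
        hT.tendsto_l1Op_of_nonneg (trunc_nonneg hg k) (trunc_memLp_two g k)
    have h := (hpos f⁺ (posPart_nonneg f)).sub (hpos f⁻ (negPart_nonneg f))
    rw [posPart_sub_negPart] at h
    refine h.congr fun t => ?_
    rw [← map_sub, posPart_sub_negPart]

end ContractionSemigroup

/-! ### The potential operator and the resolvent -/

namespace ContractionSemigroup

/-- The partial potential `∫₀ᵇ T_t f dt` of `f ∈ L¹`. -/
noncomputable def partialPotential (T : ContractionSemigroup μ) (f : Lp ℝ 1 μ) (b : ℝ) :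
    Lp ℝ 1 μ := ∫ t in (0 : ℝ)..b, T.l1Op t f

variable {T : ContractionSemigroup μ}

theorem potential_eq (T : ContractionSemigroup μ) (f : Lp ℝ 1 μ) (x : E) :
    T.potential f x = ⨆ n : ℕ, ENNReal.ofReal (T.partialPotential f n x) := rfl

theorem aemeasurable_potential (T : ContractionSemigroup μ) (f : Lp ℝ 1 μ) :
    AEMeasurable (T.potential f) μ := by
  have h : T.potential f = fun x => ⨆ n : ℕ, ENNReal.ofReal (T.partialPotential f n x) := rfl
  rw [h]
  exact .iSup fun n =>
    (Lp.aestronglyMeasurable (T.partialPotential f n)).aemeasurable.ennreal_ofReal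

theorem integrableOn_resolvent (T : ContractionSemigroup μ) {α : ℝ} (hα : 0 < α) (f : Lp ℝ 2 μ) :
    IntegrableOn (fun t => Real.exp (-α * t) • T.op t f) (Ioi 0) := by
  refine Integrable.mono' ((exp_neg_integrableOn_Ioi 0 hα).mul_const ‖f‖) ?_ ?_
  · refine ContinuousOn.aestronglyMeasurable ?_ measurableSet_Ioi
    exact (by fun_prop : Continuous fun t : ℝ => Real.exp (-α * t)).continuousOn.smul
      ((T.isContractionSemigroup.continuousOn f).mono Ioi_subset_Ici_self)
  · filter_upwards [self_mem_ae_restrict measurableSet_Ioi] with t ht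
    rw [norm_smul, Real.norm_of_nonneg (Real.exp_pos _).le]
    exact mul_le_mul_of_nonneg_left
      (T.isContractionSemigroup.norm_le t (le_of_lt ht) f) (Real.exp_pos _).le

theorem integrableOn_op (T : ContractionSemigroup μ) (f : Lp ℝ 2 μ) (b : ℝ) :
    IntegrableOn (fun t => T.op t f) (Ioc 0 b) := by
  rcases le_total 0 b with hb | hb
  · have h := T.isContractionSemigroup.intervalIntegrable f le_rfl hb
    rwa [intervalIntegrable_iff_integrableOn_Ioc_of_le hb] at h
  · simp [Ioc_eq_empty_of_le hb]

variable [SigmaFinite μ]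

namespace IsDualSubMarkovian

section L1

variable {f g : Lp ℝ 1 μ}

theorem partialPotential_nonneg (hT : T.IsDualSubMarkovian) (hf : 0 ≤ f) {b : ℝ} (hb : 0 ≤ b) :
    0 ≤ T.partialPotential f b := by
  rw [partialPotential, intervalIntegral.integral_of_le hb]
  refine integral_nonneg_of_ae ?_
  filter_upwards [self_mem_ae_restrict measurableSet_Ioc] with t ht
  exact hT.l1Op_nonneg ht.1.le hf

theorem l1Op_partialPotential (hT : T.IsDualSubMarkovian) (f : Lp ℝ 1 μ) {s b : ℝ} (hs : 0 ≤ s)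
    (hb : 0 ≤ b) :
    T.l1Op s (T.partialPotential f b) = T.partialPotential f (s + b) - T.partialPotential f s :=
  hT.l1_isContractionSemigroup.apply_integral_eq_sub f hs hb

theorem l1Op_partialPotential_le (hT : T.IsDualSubMarkovian) (hf : 0 ≤ f) {s b : ℝ} (hs : 0 ≤ s)
    (hb : 0 ≤ b) : T.l1Op s (T.partialPotential f b) ≤ T.partialPotential f (s + b) := by
  rw [hT.l1Op_partialPotential f hs hb]
  exact sub_le_self _ (hT.partialPotential_nonneg hf hs)

theorem partialPotential_mono (hT : T.IsDualSubMarkovian) (hf : 0 ≤ f) {a b : ℝ} (ha : 0 ≤ a)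
    (hab : a ≤ b) : T.partialPotential f a ≤ T.partialPotential f b := by
  have h := hT.l1Op_partialPotential f ha (sub_nonneg.2 hab)
  rw [add_sub_cancel] at h
  rw [← sub_nonneg, ← h]
  exact hT.l1Op_nonneg ha (hT.partialPotential_nonneg hf (sub_nonneg.2 hab))

theorem partialPotential_sub (hT : T.IsDualSubMarkovian) (f g : Lp ℝ 1 μ) {b : ℝ} (hb : 0 ≤ b) :
    T.partialPotential (f - g) b = T.partialPotential f b - T.partialPotential g b :=
  hT.l1_isContractionSemigroup.integral_sub_vec f g hb

theorem partialPotential_le_of_le (hT : T.IsDualSubMarkovian) (hfg : f ≤ g) {b : ℝ}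
    (hb : 0 ≤ b) : T.partialPotential f b ≤ T.partialPotential g b := by
  rw [← sub_nonneg, ← hT.partialPotential_sub _ _ hb]
  exact hT.partialPotential_nonneg (sub_nonneg.2 hfg) hb

theorem ofReal_partialPotential_le_potential (hT : T.IsDualSubMarkovian) (hf : 0 ≤ f) {b : ℝ}
    (hb : 0 ≤ b) : ∀ᵐ x ∂μ, ENNReal.ofReal (T.partialPotential f b x) ≤ T.potential f x := by
  have h := hT.partialPotential_mono hf hb (Nat.le_ceil b)
  rw [← Lp.coeFn_le] at h
  filter_upwards [h] with x hx
  exact (ENNReal.ofReal_le_ofReal hx).trans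
    (le_iSup (fun n : ℕ => ENNReal.ofReal (T.partialPotential f n x)) ⌈b⌉₊)

theorem potential_mono (hT : T.IsDualSubMarkovian) (hfg : f ≤ g) :
    ∀ᵐ x ∂μ, T.potential f x ≤ T.potential g x := by
  have h : ∀ n : ℕ, ∀ᵐ x ∂μ, T.partialPotential f n x ≤ T.partialPotential g n x := fun n =>
    (Lp.coeFn_le _ _).2 (hT.partialPotential_le_of_le hfg n.cast_nonneg)
  filter_upwards [ae_all_iff.2 h] with x hx
  exact iSup_mono fun n => ENNReal.ofReal_le_ofReal (hx n)

end L1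

section L2

variable {f : Lp ℝ 1 μ} {f₂ : Lp ℝ 2 μ}

theorem partialPotential_ae_eq (hT : T.IsDualSubMarkovian) (hff : f =ᵐ[μ] f₂) {b : ℝ}
    (hb : 0 ≤ b) :
    T.partialPotential f b =ᵐ[μ] (∫ t in Ioc (0 : ℝ) b, T.op t f₂ : Lp ℝ 2 μ) := by
  rw [partialPotential, intervalIntegral.integral_of_le hb]
  have h := hT.l1_isContractionSemigroup.intervalIntegrable f le_rfl hb
  rw [intervalIntegrable_iff_integrableOn_Ioc_of_le hb] at h
  refine integral_L1_ae_eq_integral_L2 h (T.integrableOn_op f₂ b) ?_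
  filter_upwards [self_mem_ae_restrict measurableSet_Ioc] with t ht
  exact hT.isL1Extension ht.1.le _ _ hff

theorem resolvent_nonneg (hT : T.IsDualSubMarkovian) (hf : 0 ≤ f₂) (α : ℝ) :
    0 ≤ T.resolvent α f₂ := by
  refine integral_nonneg_of_ae ?_
  filter_upwards [self_mem_ae_restrict measurableSet_Ioi] with t ht
  exact smul_nonneg (Real.exp_pos _).le (hT.op_nonneg (le_of_lt ht) hf)

theorem exp_smul_integral_le_resolvent (hT : T.IsDualSubMarkovian) (hf : 0 ≤ f₂) {α : ℝ}
    (hα : 0 < α) (b : ℝ) :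
    Real.exp (-α * b) • (∫ t in Ioc (0 : ℝ) b, T.op t f₂) ≤ T.resolvent α f₂ := by
  have hi := T.integrableOn_resolvent hα f₂
  have hsub : Ioc (0 : ℝ) b ⊆ Ioi 0 := fun t ht => ht.1
  calc Real.exp (-α * b) • (∫ t in Ioc (0 : ℝ) b, T.op t f₂)
      = ∫ t in Ioc (0 : ℝ) b, Real.exp (-α * b) • T.op t f₂ := (integral_smul _ _).symm
    _ ≤ ∫ t in Ioc (0 : ℝ) b, Real.exp (-α * t) • T.op t f₂ := by
        refine integral_mono_ae ((T.integrableOn_op f₂ b).fun_smul _) (hi.mono_set hsub) ?_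
        filter_upwards [self_mem_ae_restrict measurableSet_Ioc] with t ht
        refine smul_le_smul_of_nonneg_right (Real.exp_le_exp.2 ?_) (hT.op_nonneg ht.1.le hf)
        exact mul_le_mul_of_nonpos_left ht.2 (by linarith)
    _ ≤ T.resolvent α f₂ := by
        refine setIntegral_mono_set hi ?_ hsub.eventuallyLE
        filter_upwards [self_mem_ae_restrict measurableSet_Ioi] with t ht
        exact smul_nonneg (Real.exp_pos _).le (hT.op_nonneg (le_of_lt ht) hf)

theorem ofReal_resolvent_le_potential (hT : T.IsDualSubMarkovian) (hf : 0 ≤ f₂)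
    (hff : f =ᵐ[μ] f₂) {α : ℝ} (hα : 0 < α) :
    ∀ᵐ x ∂μ, ENNReal.ofReal (T.resolvent α f₂ x) ≤ T.potential f x := by
  have hi := T.integrableOn_resolvent hα f₂
  have hlim : Tendsto (fun n : ℕ => ∫ t in (0 : ℝ)..n, Real.exp (-α * t) • T.op t f₂) atTop
      (𝓝 (T.resolvent α f₂)) :=
    intervalIntegral_tendsto_integral_Ioi 0 hi tendsto_natCast_atTop_atTop
  obtain ⟨ns, -, hns⟩ := exists_subseq_ae_tendsto hlim
  have hle : ∀ n : ℕ, ∀ᵐ x ∂μ, (∫ t in (0 : ℝ)..n, Real.exp (-α * t) • T.op t f₂ : Lp ℝ 2 μ) x ≤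
      T.partialPotential f n x := by
    intro n
    have h1 : (∫ t in (0 : ℝ)..n, Real.exp (-α * t) • T.op t f₂) ≤
        ∫ t in Ioc (0 : ℝ) n, T.op t f₂ := by
      rw [intervalIntegral.integral_of_le n.cast_nonneg]
      refine integral_mono_ae (hi.mono_set fun t ht => ht.1) (T.integrableOn_op f₂ n) ?_
      filter_upwards [self_mem_ae_restrict measurableSet_Ioc] with t ht
      conv_rhs => rw [← one_smul ℝ (T.op t f₂)]
      refine smul_le_smul_of_nonneg_right (Real.exp_le_one_iff.2 ?_) (hT.op_nonneg ht.1.le hf)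
      nlinarith [ht.1]
    rw [← Lp.coeFn_le] at h1
    filter_upwards [h1, hT.partialPotential_ae_eq hff n.cast_nonneg] with x h2 h3
    rwa [h3]
  filter_upwards [hns, ae_all_iff.2 hle] with x h1 h2
  refine le_of_tendsto' (ENNReal.tendsto_ofReal h1) fun i => ?_
  exact (ENNReal.ofReal_le_ofReal (h2 (ns i))).trans
    (le_iSup (fun n : ℕ => ENNReal.ofReal (T.partialPotential f n x)) (ns i))

/-- `G_α f → G f` in `[0, ∞]` almost everywhere as `α ↓ 0`. -/
theorem tendsto_resolvent (hT : T.IsDualSubMarkovian) (hf : 0 ≤ f₂)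
    (hff : f =ᵐ[μ] f₂) {α : ℕ → ℝ} (hα : ∀ k, 0 < α k) (hα0 : Tendsto α atTop (𝓝 0)) :
    ∀ᵐ x ∂μ, Tendsto (fun k => ENNReal.ofReal (T.resolvent (α k) f₂ x)) atTop
      (𝓝 (T.potential f x)) := by
  have hlow : ∀ (k n : ℕ), ∀ᵐ x ∂μ,
      Real.exp (-α k * n) * T.partialPotential f n x ≤ T.resolvent (α k) f₂ x := by
    intro k n
    have h := hT.exp_smul_integral_le_resolvent hf (hα k) n
    rw [← Lp.coeFn_le] at h
    filter_upwards [h, hT.partialPotential_ae_eq hff n.cast_nonneg,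
      Lp.coeFn_smul (Real.exp (-α k * n)) (∫ t in Ioc (0 : ℝ) n, T.op t f₂)] with x h1 h2 h3
    rw [h3, Pi.smul_apply, smul_eq_mul, ← h2] at h1
    exact h1
  filter_upwards [ae_all_iff.2 fun k => hT.ofReal_resolvent_le_potential hf hff (hα k),
    ae_all_iff.2 fun k => ae_all_iff.2 (hlow k)] with x hup hlow
  refine tendsto_order.2 ⟨fun a ha => ?_, fun a ha =>
    Eventually.of_forall fun k => (hup k).trans_lt ha⟩
  rw [potential_eq, lt_iSup_iff] at ha
  obtain ⟨n, hn⟩ := ha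
  have h1 : Tendsto (fun k => ENNReal.ofReal (Real.exp (-α k * n) * T.partialPotential f n x))
      atTop (𝓝 (ENNReal.ofReal (T.partialPotential f n x))) := by
    refine ENNReal.tendsto_ofReal ?_
    have : Tendsto (fun k => Real.exp (-α k * n)) atTop (𝓝 (Real.exp (-0 * n))) :=
      (Real.continuous_exp.tendsto _).comp (hα0.neg.mul_const _)
    simpa using this.mul_const (T.partialPotential f n x)
  filter_upwards [(tendsto_order.1 h1).1 a hn] with k hk
  exact hk.trans_le (ENNReal.ofReal_le_ofReal (hlow k n))

end L2

end IsDualSubMarkovian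

end ContractionSemigroup

/-! ### The resolvent maps into the domain of the generator -/

namespace ContractionSemigroup

variable {T : ContractionSemigroup μ}

theorem op_resolvent (T : ContractionSemigroup μ) {α : ℝ} (hα : 0 < α) (f : Lp ℝ 2 μ) {h : ℝ}
    (hh : 0 ≤ h) :
    T.op h (T.resolvent α f) = Real.exp (α * h) •
      (T.resolvent α f - ∫ t in (0 : ℝ)..h, Real.exp (-α * t) • T.op t f) := by
  have hi := T.integrableOn_resolvent hα f
  have h1 : T.op h (T.resolvent α f) =
      ∫ t in Ioi (0 : ℝ), Real.exp (α * h) • (Real.exp (-α * (t + h)) • T.op (t + h) f) := by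
    rw [resolvent, ← ContinuousLinearMap.integral_comp_comm _ hi]
    refine setIntegral_congr_fun measurableSet_Ioi fun t ht => ?_
    have hadd : T.op (t + h) f = T.op h (T.op t f) := by
      rw [add_comm, T.op_add h t hh (le_of_lt ht)]
      rfl
    change T.op h (Real.exp (-α * t) • T.op t f) =
      Real.exp (α * h) • (Real.exp (-α * (t + h)) • T.op (t + h) f)
    rw [map_smul, hadd, smul_smul, ← Real.exp_add]
    congr 2
    ring
  have h2 := (measurePreserving_add_right volume h).setIntegral_preimage_emb
    (measurableEmbedding_addRight h) (fun t => Real.exp (-α * t) • T.op t f) (Ioi h)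
  rw [preimage_add_const_Ioi, sub_self] at h2
  rw [h1, integral_smul, h2, ← intervalIntegral.integral_Ioi_sub_Ioi hi hh, resolvent,
    sub_sub_cancel]

theorem hasGenerator_resolvent (T : ContractionSemigroup μ) {α : ℝ} (hα : 0 < α)
    (f : Lp ℝ 2 μ) : T.HasGenerator (T.resolvent α f) (α • T.resolvent α f - f) := by
  set φ : ℝ → Lp ℝ 2 μ := fun t => Real.exp (-α * t) • T.op t f with hφ
  have hcont : ContinuousOn φ (Ici 0) :=
    (by fun_prop : Continuous fun t : ℝ => Real.exp (-α * t)).continuousOn.smul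
      (T.isContractionSemigroup.continuousOn f)
  have hφ0 : φ 0 = f := by simp [hφ, T.op_zero]
  have hint : HasDerivWithinAt (fun u => ∫ t in (0 : ℝ)..u, φ t) (φ 0) (Ici 0) 0 := by
    refine intervalIntegral.integral_hasDerivWithinAt_right (t := Ioi 0) (by simp) ?_
      ((hcont 0 self_mem_Ici).mono Ioi_subset_Ici_self)
    exact (hcont.mono Ioi_subset_Ici_self).stronglyMeasurableAtFilter_nhdsWithin measurableSet_Ioi 0
  have hexp : HasDerivWithinAt (fun u : ℝ => Real.exp (α * u)) α (Ici 0) 0 := by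
    have : HasDerivAt (fun u : ℝ => Real.exp (α * u)) (Real.exp (α * 0) * (α * 1)) 0 :=
      ((hasDerivAt_id (0 : ℝ)).const_mul α).exp
    simpa using this.hasDerivWithinAt
  have hF : HasDerivWithinAt
      (fun u : ℝ => Real.exp (α * u) • (T.resolvent α f - ∫ t in (0 : ℝ)..u, φ t))
      (α • T.resolvent α f - f) (Ioi 0) 0 := by
    have := (hexp.fun_smul (hint.const_sub (T.resolvent α f))).mono Ioi_subset_Ici_self
    rw [hφ0] at this
    refine this.congr_deriv ?_
    simp
    abel
  rw [hasDerivWithinAt_iff_tendsto_slope' self_notMem_Ioi] at hF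
  refine hF.congr' ?_
  filter_upwards [self_mem_nhdsWithin] with t ht
  rw [T.op_resolvent hα f (le_of_lt ht), slope_def_module]
  simp [hφ]

end ContractionSemigroup

/-! ### A weak maximum principle for the resolvent -/

theorem IsSubMarkov.mem_Icc {S : Lp ℝ 2 μ →L[ℝ] Lp ℝ 2 μ} (hS : IsSubMarkov S) {c : ℝ}
    (hc : 0 < c) {f : Lp ℝ 2 μ} (hf : ∀ᵐ x ∂μ, 0 ≤ f x ∧ f x ≤ c) :
    ∀ᵐ x ∂μ, 0 ≤ S f x ∧ S f x ≤ c := by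
  have h := hS (c⁻¹ • f) (by
    filter_upwards [hf, Lp.coeFn_smul c⁻¹ f] with x h1 h2
    rw [h2, Pi.smul_apply, smul_eq_mul]
    exact ⟨mul_nonneg (inv_nonneg.2 hc.le) h1.1, by rw [inv_mul_le_one₀ hc]; exact h1.2⟩)
  rw [map_smul] at h
  filter_upwards [h, Lp.coeFn_smul c⁻¹ (S f)] with x h1 h2
  rw [h2, Pi.smul_apply, smul_eq_mul, inv_mul_le_one₀ hc] at h1
  exact ⟨nonneg_of_mul_nonneg_right h1.1 (inv_pos.2 hc), h1.2⟩

/-- The generator `Λ` of a sub-Markovian semigroup satisfies `(Λ u, u - u⁺ ∧ c) ≤ 0`. -/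
theorem ContractionSemigroup.HasGenerator.inner_sub_cutoff_nonpos {U : ContractionSemigroup μ}
    (hU : U.IsSubMarkovian) {u r w : Lp ℝ 2 μ} (hur : U.HasGenerator u r) {c : ℝ} (hc : 0 < c)
    (hw : w =ᵐ[μ] fun x => min (max (u x) 0) c) : inner ℝ r (u - w) ≤ 0 := by
  refine le_of_tendsto (hur.inner tendsto_const_nhds) ?_
  filter_upwards [self_mem_nhdsWithin] with t ht
  rw [real_inner_smul_left]
  refine mul_nonpos_of_nonneg_of_nonpos (inv_nonneg.2 (le_of_lt ht)) ?_
  have h1 : inner ℝ (U.op t (u - w)) (u - w) ≤ inner ℝ (u - w) (u - w) := by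
    rw [real_inner_self_eq_norm_mul_norm]
    exact (real_inner_le_norm _ _).trans (mul_le_mul_of_nonneg_right
      (U.isContractionSemigroup.norm_le t (le_of_lt ht) _) (norm_nonneg _))
  have h2 : inner ℝ (U.op t w) (u - w) ≤ inner ℝ w (u - w) := by
    rw [inner_eq_integral, inner_eq_integral]
    refine integral_mono_ae (integrable_mul_L2 _ _) (integrable_mul_L2 _ _) ?_
    have hmem := (hU t ht).mem_Icc hc (f := w) (by
      filter_upwards [hw] with x hx
      rw [hx]
      exact ⟨le_min (le_max_right _ _) hc.le, min_le_right _ _⟩)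
    filter_upwards [hmem, hw, Lp.coeFn_sub u w] with x hx hwx hsub
    rw [hsub, Pi.sub_apply, hwx]
    rcases le_total (u x) 0 with h0 | h0
    · rw [max_eq_right h0, min_eq_left hc.le]
      nlinarith [hx.1]
    · rw [max_eq_left h0]
      rcases le_total (u x) c with h | h
      · rw [min_eq_left h]
        simp
      · rw [min_eq_right h]
        nlinarith [hx.2]
  have h3 : inner ℝ (U.op t u - u) (u - w) = inner ℝ (U.op t (u - w)) (u - w) +
      inner ℝ (U.op t w) (u - w) - (inner ℝ (u - w) (u - w) + inner ℝ w (u - w)) := by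
    rw [← inner_add_left, ← inner_add_left, ← map_add, sub_add_cancel, inner_sub_left]
  rw [h3]
  linarith

namespace L2Form

variable {A : L2Form μ}

theorem normSq_eq (A : L2Form μ) (u : A.dom) : A.normSq u = A.form u u + ‖(u : Lp ℝ 2 μ)‖ ^ 2 := by
  rw [normSq, form₁, real_inner_self_eq_norm_sq]

theorem normSq_nonneg (hA : ∀ u : A.dom, 0 ≤ A.form u u) (u : A.dom) : 0 ≤ A.normSq u := by
  rw [normSq_eq]
  exact add_nonneg (hA u) (sq_nonneg _)

theorem norm_sq_le_normSq (hA : ∀ u : A.dom, 0 ≤ A.form u u) (u : A.dom) :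
    ‖(u : Lp ℝ 2 μ)‖ ^ 2 ≤ A.normSq u := by
  rw [normSq_eq]
  exact le_add_of_nonneg_left (hA u)

theorem form_add_add_form_sub (A : L2Form μ) (u v : A.dom) :
    A.form (u + v) (u + v) + A.form (u - v) (u - v) = 2 * A.form u u + 2 * A.form v v := by
  simp only [map_add, map_sub, LinearMap.add_apply, LinearMap.sub_apply]
  ring

theorem form_sub_le (hA : ∀ u : A.dom, 0 ≤ A.form u u) (u v : A.dom) :
    A.form (u - v) (u - v) ≤ 2 * A.form u u + 2 * A.form v v := by
  linarith [A.form_add_add_form_sub u v, hA (u + v)]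

theorem form_add_le (hA : ∀ u : A.dom, 0 ≤ A.form u u) (u v : A.dom) :
    A.form (u + v) (u + v) ≤ 2 * A.form u u + 2 * A.form v v := by
  linarith [A.form_add_add_form_sub u v, hA (u - v)]

theorem normSq_sub_le (hA : ∀ u : A.dom, 0 ≤ A.form u u) (u v : A.dom) :
    A.normSq (u - v) ≤ 2 * A.normSq u + 2 * A.normSq v := by
  have h1 := form_sub_le hA u v
  have h2 := parallelogram_law_with_norm ℝ (u : Lp ℝ 2 μ) v
  simp only [normSq_eq, Submodule.coe_sub]
  nlinarith [sq_nonneg ‖(u : Lp ℝ 2 μ) + v‖]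

theorem form_smul_smul (A : L2Form μ) (a : ℝ) (u : A.dom) :
    A.form (a • u) (a • u) = a ^ 2 * A.form u u := by
  simp only [map_smul, LinearMap.smul_apply, smul_eq_mul]
  ring

/-- The contraction properties for the cutoff `u⁺ ∧ c`. -/
theorem IsDirichlet.exists_cutoff (hA : A.IsDirichlet) (u : A.dom) {c : ℝ} (hc : 0 < c) :
    ∃ w : A.dom, ((w : Lp ℝ 2 μ) =ᵐ[μ] fun x => min (max ((u : Lp ℝ 2 μ) x) 0) c) ∧
      0 ≤ A.form u (u - w) ∧ A.form w w ≤ A.form u u := by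
  obtain ⟨w, hw, h1, h2⟩ := hA.unitContraction (c⁻¹ • u)
  refine ⟨c • w, ?_, ?_, ?_⟩
  · filter_upwards [hw, Lp.coeFn_smul c (w : Lp ℝ 2 μ),
      Lp.coeFn_smul c⁻¹ (u : Lp ℝ 2 μ)] with x h3 h4 h5
    rw [Submodule.coe_smul, h4, Pi.smul_apply, h3, Submodule.coe_smul, h5, Pi.smul_apply,
      smul_eq_mul, smul_eq_mul, mul_min_of_nonneg _ _ hc.le, mul_max_of_nonneg _ _ hc.le, mul_one,
      mul_zero, mul_inv_cancel_left₀ hc.ne']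
  · -- the sum of `A(v + w, v - w) ≥ 0` and `A(v - w, v - w) ≥ 0` is `2 A(v, v - w)`
    have h3 := hA.nonneg (c⁻¹ • u - w)
    have h4 : 0 ≤ A.form (c⁻¹ • u) (c⁻¹ • u - w) := by
      have : A.form (c⁻¹ • u + w) (c⁻¹ • u - w) + A.form (c⁻¹ • u - w) (c⁻¹ • u - w) =
          2 * A.form (c⁻¹ • u) (c⁻¹ • u - w) := by
        simp only [map_add, map_sub, LinearMap.add_apply, LinearMap.sub_apply]
        ring
      linarith
    have h5 : A.form u (u - c • w) = c ^ 2 * A.form (c⁻¹ • u) (c⁻¹ • u - w) := by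
      simp only [map_sub, map_smul, LinearMap.smul_apply, smul_eq_mul]
      field_simp
    rw [h5]
    positivity
  · have h3 : A.form (c⁻¹ • u + w) (c⁻¹ • u - w) + A.form (c⁻¹ • u - w) (c⁻¹ • u + w) =
        2 * A.form (c⁻¹ • u) (c⁻¹ • u) - 2 * A.form w w := by
      simp only [map_add, map_sub, LinearMap.add_apply, LinearMap.sub_apply]
      ring
    have h4 : A.form w w ≤ A.form (c⁻¹ • u) (c⁻¹ • u) := by linarith
    rw [form_smul_smul] at h4 ⊢
    calc c ^ 2 * A.form w w ≤ c ^ 2 * (c⁻¹ ^ 2 * A.form u u) :=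
          mul_le_mul_of_nonneg_left h4 (sq_nonneg c)
      _ = A.form u u := by field_simp

end L2Form

theorem abs_cutoff_sub_le (a b c : ℝ) :
    |min (max a 0) c - min (max b 0) c| ≤ |a - b| :=
  (abs_min_sub_min_le_max _ _ _ _).trans <| by
    rw [sub_self, abs_zero]
    refine max_le ((abs_max_sub_max_le_max _ _ _ _).trans ?_) (abs_nonneg _)
    rw [sub_self, abs_zero]
    exact max_le le_rfl (abs_nonneg _)

theorem norm_cutoff_sub_le {u v w z : Lp ℝ 2 μ} {c : ℝ}
    (hw : w =ᵐ[μ] fun x => min (max (u x) 0) c) (hz : z =ᵐ[μ] fun x => min (max (v x) 0) c) :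
    ‖w - z‖ ≤ ‖u - v‖ := by
  refine Lp.norm_le_norm_of_ae_le ?_
  filter_upwards [hw, hz, Lp.coeFn_sub w z, Lp.coeFn_sub u v] with x h1 h2 h3 h4
  rw [h3, h4, Pi.sub_apply, Pi.sub_apply, h1, h2]
  exact abs_cutoff_sub_le _ _ _

theorem norm_cutoff_le {u w : Lp ℝ 2 μ} {c : ℝ} (hc : 0 < c)
    (hw : w =ᵐ[μ] fun x => min (max (u x) 0) c) : ‖w‖ ≤ ‖u‖ := by
  refine Lp.norm_le_norm_of_ae_le ?_
  filter_upwards [hw] with x h1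
  have h := abs_cutoff_sub_le (u x) 0 c
  rw [h1]
  simpa [min_eq_left hc.le] using h

/-- The closure of `Λ` in `V × V'` inherits `⟨Λ u, u - u⁺ ∧ c⟩ ≤ 0`. The functional `l = Λ u` is
replaced by an approximation `(Λ uₘ, ·)`, which is continuous on `L²`; this allows to pass to the
limit along the cutoffs of `uₙ`, which are bounded in `V` but converge only in `L²`. -/
theorem closureGraph_apply_sub_cutoff_nonpos {A : L2Form μ} (hA : A.IsDirichlet)
    {U : ContractionSemigroup μ} (hU : U.IsSubMarkovian) {u w : A.dom} {l : A.dom →ₗ[ℝ] ℝ}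
    (hul : (u, l) ∈ closureGraph A U) {c : ℝ} (hc : 0 < c)
    (hw : (w : Lp ℝ 2 μ) =ᵐ[μ] fun x => min (max ((u : Lp ℝ 2 μ) x) 0) c) : l (u - w) ≤ 0 := by
  obtain ⟨s, r, hsr, hs, hr⟩ := hul
  choose z hz hz1 hz2 using fun n => hA.exists_cutoff (s n) hc
  have hzn : ∀ n, A.normSq (z n) ≤ A.normSq (s n) := fun n => by
    rw [L2Form.normSq_eq, L2Form.normSq_eq]
    exact add_le_add (hz2 n) (pow_le_pow_left₀ (norm_nonneg _) (norm_cutoff_le hc (hz n)) 2)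
  obtain ⟨C, hC⟩ : ∃ C, ∀ n, A.normSq (s n - z n) ≤ C := by
    obtain ⟨B, hB⟩ := hs.bddAbove_range
    refine ⟨4 * (2 * B + 2 * A.normSq u), fun n => ?_⟩
    have h1 := L2Form.normSq_sub_le hA.nonneg (s n) (z n)
    have h2 := L2Form.normSq_sub_le hA.nonneg (s n - u) (-u)
    have h3 : A.normSq (s n - u) ≤ B := hB (mem_range_self n)
    rw [sub_neg_eq_add, sub_add_cancel] at h2
    have h4 : A.normSq (-u) = A.normSq u := by
      simp [L2Form.normSq_eq]
    linarith [hzn n]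
  have hsL2 : Tendsto (fun n => ‖(s n : Lp ℝ 2 μ) - u‖) atTop (𝓝 0) := by
    have h1 := (Real.continuous_sqrt.tendsto 0).comp hs
    rw [Real.sqrt_zero] at h1
    refine squeeze_zero (fun _ => norm_nonneg _) (fun n => ?_) h1
    exact Real.le_sqrt_of_sq_le (L2Form.norm_sq_le_normSq hA.nonneg (s n - u))
  have hsL2' : Tendsto (fun n => (s n : Lp ℝ 2 μ)) atTop (𝓝 u) :=
    tendsto_iff_norm_sub_tendsto_zero.2 hsL2
  have hzL2 : Tendsto (fun n => (z n : Lp ℝ 2 μ)) atTop (𝓝 w) :=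
    tendsto_iff_norm_sub_tendsto_zero.2 <| squeeze_zero (fun _ => norm_nonneg _)
      (fun n => norm_cutoff_sub_le (hz n) hw) hsL2
  set D := 2 * √C + √(A.normSq (u - w)) with hD
  have hbound : ∀ ε > 0, l (u - w) ≤ ε * D := by
    intro ε hε
    obtain ⟨n₀, hn₀⟩ := hr ε hε
    have hlim : inner ℝ (r n₀) ((u - w : A.dom) : Lp ℝ 2 μ) ≤ 2 * ε * √C := by
      refine le_of_tendsto (tendsto_const_nhds.inner (hsL2'.sub hzL2)) ?_
      filter_upwards [eventually_ge_atTop n₀] with n hn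
      have h1 := abs_le.1 (hn₀ n₀ le_rfl (s n - z n))
      have h2 := abs_le.1 (hn₀ n hn (s n - z n))
      have h3 := (hsr n).inner_sub_cutoff_nonpos hU hc (hz n)
      have h4 : √(A.normSq (s n - z n)) ≤ √C := Real.sqrt_le_sqrt (hC n)
      have h5 := mul_le_mul_of_nonneg_left h4 hε.le
      rw [Submodule.coe_sub] at h1 h2
      linarith [h1.2, h2.1]
    have h6 := abs_le.1 (hn₀ n₀ le_rfl (u - w))
    rw [hD]
    linarith [h6.1]
  have hDnn : 0 ≤ D := by positivity
  refine le_of_forall_pos_le_add fun ε hε => ?_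
  refine (hbound (ε / (D + 1)) (by positivity)).trans ?_
  rw [zero_add, div_mul_eq_mul_div, div_le_iff₀ (by positivity)]
  nlinarith

theorem L2Form.IsDirichlet.inner_sub_cutoff_nonneg {A : L2Form μ} (hA : A.IsDirichlet)
    {U : ContractionSemigroup μ} (hU : U.IsSubMarkovian) {α : ℝ} (hα : 0 < α) (f : Lp ℝ 2 μ)
    {c : ℝ} (hc : 0 < c) {z : Lp ℝ 2 μ}
    (hz : z =ᵐ[μ] fun x => min (max ((semigroup A U).resolvent α f x) 0) c) :
    0 ≤ inner ℝ (f - α • (semigroup A U).resolvent α f) ((semigroup A U).resolvent α f - z) := by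
  by_cases h : ∃ T : ContractionSemigroup μ, IsAssociated A U T
  · have hT : IsAssociated A U (semigroup A U) := by
      rw [semigroup, dif_pos h]
      exact h.choose_spec
    obtain ⟨w, hw, hwF, hwv⟩ := hT α hα f
    rw [← hw] at hz ⊢
    obtain ⟨v, hv, hv1, -⟩ := hA.exists_cutoff w hc
    have hvz : (v : Lp ℝ 2 μ) = z := Lp.ext (hv.trans hz.symm)
    have hl : (w, closureOp A U w) ∈ closureGraph A U := by
      have hex : ∃ l : A.dom →ₗ[ℝ] ℝ, (w, l) ∈ closureGraph A U := hwF
      rw [closureOp, dif_pos hex]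
      exact hex.choose_spec
    have h1 := closureGraph_apply_sub_cutoff_nonpos hA hU hl hc hv
    have h2 := hwv (w - v)
    rw [genForm, Submodule.coe_sub, hvz] at h2
    rw [inner_sub_left, real_inner_smul_left]
    linarith
  · -- otherwise the semigroup is constant, and `f = α G_α f`
    have hT : semigroup A U = ContractionSemigroup.trivial μ := by
      rw [semigroup, dif_neg h]
    have h1 := (semigroup A U).hasGenerator_resolvent hα f
    have h2 : (semigroup A U).HasGenerator ((semigroup A U).resolvent α f) 0 := by
      rw [ContractionSemigroup.HasGenerator, hT]
      simp [ContractionSemigroup.trivial]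
    have h3 := tendsto_nhds_unique h1 h2
    rw [← neg_sub, h3, neg_zero, inner_zero_left]

/-! ### The maximum principle for potentials, and reference functions -/

namespace ContractionSemigroup

/-- The weak maximum principle `(f - α G_α f, u - u⁺ ∧ c) ≥ 0` with `u = G_α f`; for `u ≥ 0` the
second argument is `(u - c)⁺`. Since `f - α G_α f = -L u`, this expresses that the semigroup is
sub-Markovian, in terms of its generator. The cutoff `u⁺ ∧ c` is given by a representative `z`. -/
def WeakMaximumPrinciple (T : ContractionSemigroup μ) : Prop :=
  ∀ α : ℝ, 0 < α → ∀ (f : Lp ℝ 2 μ) (c : ℝ), 0 < c → ∀ z : Lp ℝ 2 μ,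
    (z =ᵐ[μ] fun x => min (max (T.resolvent α f x) 0) c) →
      0 ≤ inner ℝ (f - α • T.resolvent α f) (T.resolvent α f - z)

variable {T : ContractionSemigroup μ} [SigmaFinite μ]

theorem WeakMaximumPrinciple.resolvent_le (hT : T.IsDualSubMarkovian)
    (hmax : T.WeakMaximumPrinciple) {f : Lp ℝ 2 μ} (hf : 0 ≤ f) {α : ℝ} (hα : 0 < α) {c : ℝ}
    (hc : 0 < c) (hfc : ∀ᵐ x ∂μ, 0 < f x → T.resolvent α f x ≤ c) :
    ∀ᵐ x ∂μ, T.resolvent α f x ≤ c := by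
  set w := T.resolvent α f with hw
  have hw0 : 0 ≤ w := hT.resolvent_nonneg hf α
  rw [← Lp.coeFn_nonneg] at hw0 hf
  have hmem : MemLp (fun x => min (max (w x) 0) c) 2 μ := by
    refine (Lp.memLp w).of_le ?_ ?_
    · exact ((Lp.aestronglyMeasurable w).sup aestronglyMeasurable_const).inf
        aestronglyMeasurable_const
    · refine Eventually.of_forall fun x => ?_
      have h := abs_cutoff_sub_le (w x) 0 c
      simpa [min_eq_left hc.le] using h
  have h := hmax α hα f c hc (hmem.toLp _) hmem.coeFn_toLp
  rw [← hw, inner_eq_integral] at h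
  have hle : ∀ᵐ x ∂μ, (f - α • w : Lp ℝ 2 μ) x * (w - hmem.toLp _ : Lp ℝ 2 μ) x =
      -(α * (w x * (w x - min (w x) c))) := by
    filter_upwards [hfc, hw0, hf, hmem.coeFn_toLp, Lp.coeFn_sub f (α • w), Lp.coeFn_smul α w,
      Lp.coeFn_sub w (hmem.toLp _)] with x h1 h2 h3 h4 h5 h6 h7
    have h2 : 0 ≤ w x := h2
    rw [h5, h7, Pi.sub_apply, Pi.sub_apply, h6, Pi.smul_apply, h4, max_eq_left h2, smul_eq_mul]
    rcases (h3 : 0 ≤ f x).eq_or_lt with h0 | h0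
    · rw [show f x = 0 from h0.symm]
      ring
    · rw [min_eq_left (h1 h0)]
      ring
  rw [integral_congr_ae hle, integral_neg, integral_const_mul] at h
  have hnn : 0 ≤ᵐ[μ] fun x => w x * (w x - min (w x) c) := by
    filter_upwards [hw0] with x hx
    exact mul_nonneg hx (sub_nonneg.2 (min_le_left _ _))
  have hint : Integrable (fun x => w x * (w x - min (w x) c)) μ := by
    have h1 : Integrable _ μ := ((integrable_mul_L2 (f - α • w) (w - hmem.toLp _)).congr hle).neg
    have h2 := h1.const_mul α⁻¹
    refine h2.congr (Eventually.of_forall fun x => ?_)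
    simp [hα.ne']
  have h0 : ∫ x, w x * (w x - min (w x) c) ∂μ = 0 :=
    le_antisymm (by nlinarith) (integral_nonneg_of_ae hnn)
  rw [integral_eq_zero_iff_of_nonneg_ae hnn hint] at h0
  filter_upwards [h0] with x hx
  by_contra! hcx
  rw [Pi.zero_apply, min_eq_right hcx.le] at hx
  have : 0 < w x * (w x - c) := mul_pos (hc.trans hcx) (sub_pos.2 hcx)
  exact this.ne' hx

/-- The maximum principle: a potential `G f` is bounded by its supremum on `{f > 0}`. -/
theorem WeakMaximumPrinciple.potential_le (hT : T.IsDualSubMarkovian)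
    (hmax : T.WeakMaximumPrinciple) {f : Lp ℝ 1 μ} (hf : 0 ≤ f) (hf2 : MemLp f 2 μ) {c : ℝ}
    (hc : 0 < c) (hfc : ∀ᵐ x ∂μ, 0 < f x → T.potential f x ≤ ENNReal.ofReal c) :
    ∀ᵐ x ∂μ, T.potential f x ≤ ENNReal.ofReal c := by
  have hff : f =ᵐ[μ] hf2.toLp f := hf2.coeFn_toLp.symm
  have hf₂ : 0 ≤ hf2.toLp f := by
    rw [← Lp.coeFn_nonneg] at hf ⊢
    filter_upwards [hf, hff] with x h1 h2
    rwa [← h2]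
  set α : ℕ → ℝ := fun k => 1 / ((k : ℝ) + 1)
  have hα : ∀ k, 0 < α k := fun k => Nat.one_div_pos_of_nat
  have hle : ∀ k, ∀ᵐ x ∂μ, T.resolvent (α k) (hf2.toLp f) x ≤ c := fun k => by
    refine hmax.resolvent_le hT hf₂ (hα k) hc ?_
    filter_upwards [hfc, hff, hT.ofReal_resolvent_le_potential hf₂ hff (hα k)] with x h1 h2 h3 h4
    rw [← h2] at h4
    exact (ENNReal.ofReal_le_ofReal_iff hc.le).1 (h3.trans (h1 h4))
  filter_upwards [ae_all_iff.2 hle,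
    hT.tendsto_resolvent hf₂ hff hα tendsto_one_div_add_atTop_nhds_zero_nat] with x h1 h2
  exact le_of_tendsto' h2 fun k => ENNReal.ofReal_le_ofReal (h1 k)

/-- A transient semigroup has a reference function. Given `g₀ > 0` with `G g₀ < ∞`, it is
`g₀ ∧ 1`, with a small weight on each layer `{k - 1 < G g₀ ≤ k}`; by the maximum principle the
potential of the restriction of `g₀ ∧ 1` to such a layer is bounded by the values of `G g₀` on
the layer. -/
theorem IsTransient.exists_isReference (hT : T.IsDualSubMarkovian)
    (hmax : T.WeakMaximumPrinciple) (htr : T.IsTransient) : ∃ g : Lp ℝ 1 μ, T.IsReference g := by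
  obtain ⟨g₀, hg₀, hG⟩ := htr
  set N : E → ℕ := fun x => ⌈(T.potential g₀ x).toReal⌉₊
  set m : E → ℝ := fun x => min (g₀ x) 1
  have hN : AEMeasurable N μ :=
    Nat.measurable_ceil.comp_aemeasurable (T.aemeasurable_potential g₀).ennreal_toReal
  have hm : AEStronglyMeasurable m μ :=
    (Lp.aestronglyMeasurable g₀).inf aestronglyMeasurable_const
  have hm0 : ∀ᵐ x ∂μ, 0 < m x ∧ m x ≤ g₀ x ∧ m x ≤ 1 := by
    filter_upwards [hg₀] with x hx
    exact ⟨lt_min hx one_pos, min_le_left _ _, min_le_right _ _⟩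
  have hex : ∀ φ : ℕ → ℝ, ∃ F : Lp ℝ 1 μ,
      (∀ n, |φ n| ≤ 1) → F =ᵐ[μ] fun x => φ (N x) * m x := by
    intro φ
    by_cases hφ : ∀ n, |φ n| ≤ 1
    · have hmem : MemLp (fun x => φ (N x) * m x) 1 μ := by
        refine (Lp.memLp g₀).of_le ?_ ?_
        · exact (((measurable_of_countable φ).comp_aemeasurable hN).aestronglyMeasurable).mul hm
        · filter_upwards [hm0] with x hx
          rw [norm_mul, Real.norm_eq_abs, Real.norm_of_nonneg hx.1.le,
            Real.norm_of_nonneg (hx.1.le.trans hx.2.1)]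
          exact (mul_le_of_le_one_left hx.1.le (hφ _)).trans hx.2.1
      exact ⟨hmem.toLp _, fun _ => hmem.coeFn_toLp⟩
    · exact ⟨0, fun h => absurd h hφ⟩
  choose F hF using hex
  -- `e k` is the indicator of the layer `N = k`
  set e : ℕ → ℕ → ℝ := fun k n => if n = k then 1 else 0
  have he : ∀ k n, |e k n| ≤ 1 := fun k n => by
    simp only [e]
    split_ifs <;> simp
  have he0 : ∀ k, 0 ≤ F (e k) := fun k => by
    rw [← Lp.coeFn_nonneg]
    filter_upwards [hF _ (he k), hm0] with x h1 h2
    rw [h1]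
    refine mul_nonneg ?_ h2.1.le
    simp only [e]
    split_ifs <;> simp
  have hlayer : ∀ k, ∀ᵐ x ∂μ, T.potential (F (e k)) x ≤ ENNReal.ofReal ((k : ℝ) + 1) := by
    intro k
    have hle : F (e k) ≤ g₀ := by
      rw [← Lp.coeFn_le]
      filter_upwards [hF _ (he k), hm0] with x h1 h2
      rw [h1]
      exact (mul_le_of_le_one_left h2.1.le ((le_abs_self _).trans (he k _))).trans h2.2.1
    refine hmax.potential_le hT (he0 k) (memLp_two_of_bdd (C := 1) ?_) (by positivity) ?_
    · filter_upwards [hF _ (he k), hm0] with x h1 h2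
      rw [h1, abs_mul, abs_of_nonneg h2.1.le]
      exact (mul_le_of_le_one_left h2.1.le (he k _)).trans h2.2.2
    · filter_upwards [hF _ (he k), hG, hT.potential_mono hle] with x h1 h2 h3 h4
      have hNx : N x = k := by
        by_contra hne
        rw [h1] at h4
        simp [e, hne] at h4
      refine h3.trans ?_
      rw [← ENNReal.ofReal_toReal h2.ne]
      refine ENNReal.ofReal_le_ofReal ?_
      have := Nat.le_ceil (T.potential g₀ x).toReal
      change (T.potential g₀ x).toReal ≤ (N x : ℝ) at this
      rw [hNx] at this
      linarith
  -- the weight `wₖ` of a layer satisfies `∑ wₖ (k + 1) ≤ 1`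
  set w : ℕ → ℝ := fun k => ((k : ℝ) + 1)⁻¹ * (1 / 2) ^ (k + 1)
  have hw0 : ∀ k, 0 < w k := fun k => by positivity
  have hw1 : ∀ k, w k ≤ 1 := fun k =>
    mul_le_one₀ (inv_le_one_of_one_le₀ (by linarith [k.cast_nonneg (α := ℝ)])) (by positivity)
      (pow_le_one₀ (by norm_num) (by norm_num))
  set φ : ℕ → ℕ → ℝ := fun K n => if n < K then w n else 0
  have hφ : ∀ K n, |φ K n| ≤ 1 := fun K n => by
    simp only [φ]
    split_ifs
    · rw [abs_of_pos (hw0 n)]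
      exact hw1 n
    · simp
  have hwabs : ∀ n, |w n| ≤ 1 := fun n => by
    rw [abs_of_pos (hw0 n)]
    exact hw1 n
  have hsucc : ∀ K, F (φ (K + 1)) = F (φ K) + w K • F (e K) := fun K => by
    refine Lp.ext ?_
    filter_upwards [hF _ (hφ (K + 1)), hF _ (hφ K), hF _ (he K),
      Lp.coeFn_add (F (φ K)) (w K • F (e K)), Lp.coeFn_smul (w K) (F (e K))] with x h1 h2 h3 h4 h5
    rw [h1, h4, Pi.add_apply, h2, h5, Pi.smul_apply, h3, smul_eq_mul]
    simp only [φ, e]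
    rcases lt_trichotomy (N x) K with h | h | h
    · simp [h, h.ne, h.trans (Nat.lt_succ_self K)]
    · simp [h]
    · simp [h.ne', h.not_gt, (Nat.succ_le_of_lt h).not_gt]
  have hpart : ∀ n K : ℕ, ∀ᵐ x ∂μ,
      T.partialPotential (F (φ K)) n x ≤ 1 - (1 / 2) ^ K := by
    intro n K
    induction K with
    | zero =>
      have h0 : F (φ 0) = 0 := by
        refine Lp.ext ?_
        filter_upwards [hF _ (hφ 0), Lp.coeFn_zero ℝ 1 μ] with x h1 h2
        rw [h1, h2]
        simp [φ]
      have : T.partialPotential (F (φ 0)) n = 0 := by simp [partialPotential, h0]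
      rw [this]
      filter_upwards [Lp.coeFn_zero ℝ 1 μ] with x hx
      rw [hx]
      simp
    | succ K ih =>
      have hadd : T.partialPotential (F (φ (K + 1))) n =
          T.partialPotential (F (φ K)) n + w K • T.partialPotential (F (e K)) n := by
        rw [hsucc K, partialPotential,
          hT.l1_isContractionSemigroup.integral_add_vec _ _ n.cast_nonneg]
        simp only [map_smul, intervalIntegral.integral_smul]
        rfl
      filter_upwards [ih, hlayer K,
        hT.ofReal_partialPotential_le_potential (he0 K) (n.cast_nonneg (α := ℝ)),
        Lp.coeFn_add (T.partialPotential (F (φ K)) n) (w K • T.partialPotential (F (e K)) n),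
        Lp.coeFn_smul (w K) (T.partialPotential (F (e K)) n)] with x h1 h2 h3 h4 h5
      have h6 : T.partialPotential (F (e K)) n x ≤ (K : ℝ) + 1 :=
        (ENNReal.ofReal_le_ofReal_iff (by positivity)).1 (h3.trans h2)
      rw [hadd, h4, Pi.add_apply, h5, Pi.smul_apply, smul_eq_mul]
      have h7 : w K * T.partialPotential (F (e K)) n x ≤ (1 / 2) ^ (K + 1) := by
        calc w K * T.partialPotential (F (e K)) n x ≤ w K * ((K : ℝ) + 1) :=
              mul_le_mul_of_nonneg_left h6 (hw0 K).le
          _ = (1 / 2) ^ (K + 1) := by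
              simp only [w]
              field_simp
      have h8 : (1 / 2 : ℝ) ^ (K + 1) = (1 / 2) ^ K / 2 := by ring
      linarith
  have hconv : Tendsto (fun K => F (φ K)) atTop (𝓝 (F w)) := by
    refine tendsto_Lp_of_dominated ENNReal.one_ne_top (Lp.memLp g₀) (fun K => ?_) ?_
    · filter_upwards [hF _ (hφ K), hm0] with x h1 h2
      rw [h1, abs_mul, abs_of_nonneg h2.1.le]
      exact (mul_le_of_le_one_left h2.1.le (hφ K _)).trans h2.2.1
    · filter_upwards [ae_all_iff.2 fun K => hF _ (hφ K), hF _ hwabs] with x h1 h2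
      refine tendsto_const_nhds.congr' ?_
      filter_upwards [eventually_gt_atTop (N x)] with K hK
      rw [h1 K, h2]
      simp [φ, hK]
  refine ⟨F w, ?_, ⟨1, ?_⟩, 1, ?_⟩
  · filter_upwards [hF _ hwabs, hm0] with x h1 h2
    rw [h1]
    exact mul_pos (hw0 _) h2.1
  · filter_upwards [hF _ hwabs, hm0] with x h1 h2
    rw [h1, abs_mul, abs_of_nonneg h2.1.le]
    exact (mul_le_of_le_one_left h2.1.le (hwabs _)).trans h2.2.2
  · have hfin : ∀ n : ℕ, ∀ᵐ x ∂μ, T.partialPotential (F w) n x ≤ 1 := by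
      intro n
      obtain ⟨ns, -, hns⟩ := exists_subseq_ae_tendsto
        (hT.l1_isContractionSemigroup.tendsto_integral hconv n.cast_nonneg)
      filter_upwards [hns, ae_all_iff.2 (hpart n)] with x h1 h2
      refine le_of_tendsto' h1 fun i => (h2 (ns i)).trans ?_
      have : (0 : ℝ) ≤ (1 / 2) ^ ns i := by positivity
      linarith
    filter_upwards [ae_all_iff.2 hfin] with x hx
    exact iSup_le fun n => ENNReal.ofReal_le_ofReal (hx n)

end ContractionSemigroup

/-! ### Convex combinations of sequences with bounded energy -/

section Mazur

variable {V : Type*} [AddCommGroup V] [Module ℝ V]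

theorem form_convexComb (B : V →ₗ[ℝ] V →ₗ[ℝ] ℝ) (u v : V) {a b : ℝ} (hab : a + b = 1) :
    B (a • u + b • v) (a • u + b • v) = a * B u u + b * B v v - a * b * B (u - v) (u - v) := by
  obtain rfl : b = 1 - a := by linarith
  simp only [map_add, map_sub, map_smul, LinearMap.add_apply, LinearMap.sub_apply,
    LinearMap.smul_apply, smul_eq_mul]
  ring

theorem convex_form_le {B : V →ₗ[ℝ] V →ₗ[ℝ] ℝ} (hB : ∀ u, 0 ≤ B u u) (M : ℝ) :
    Convex ℝ {u | B u u ≤ M} := by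
  intro u hu v hv a b ha hb hab
  have hu : B u u ≤ M := hu
  have hv : B v v ≤ M := hv
  change B (a • u + b • v) (a • u + b • v) ≤ M
  rw [form_convexComb B u v hab]
  have h1 := mul_nonneg (mul_nonneg ha hb) (hB (u - v))
  have h2 := mul_le_mul_of_nonneg_left hu ha
  have h3 := mul_le_mul_of_nonneg_left hv hb
  have h4 : a * M + b * M = M := by rw [← add_mul, hab, one_mul]
  linarith

/-- A sequence with bounded energy has convex combinations of its tails that are Cauchy for the
energy: almost minimize the energy on the convex hull of each tail, and use the parallelogram
law. -/
theorem exists_cauchy_convexHull {B : V →ₗ[ℝ] V →ₗ[ℝ] ℝ} (hB : ∀ u, 0 ≤ B u u) {x : ℕ → V}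
    {M : ℝ} (hM : ∀ n, B (x n) (x n) ≤ M) :
    ∃ c : ℕ → V, (∀ n, c n ∈ convexHull ℝ (x '' Ici n)) ∧
      ∀ ε > (0 : ℝ), ∃ n₀ : ℕ, ∀ m ≥ n₀, ∀ n ≥ n₀, B (c m - c n) (c m - c n) < ε := by
  set K : ℕ → Set V := fun n => convexHull ℝ (x '' Ici n) with hK
  set δ : ℕ → ℝ := fun n => sInf ((fun u => B u u) '' K n) with hδ
  have hxK : ∀ n, x n ∈ K n := fun n => subset_convexHull ℝ _ ⟨n, self_mem_Ici, rfl⟩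
  have hKanti : Antitone K := fun m n hmn =>
    convexHull_mono (image_mono (Ici_subset_Ici.2 hmn))
  have hbdd : ∀ n, BddBelow ((fun u => B u u) '' K n) := fun n =>
    ⟨0, by rintro _ ⟨u, -, rfl⟩; exact hB u⟩
  have hne : ∀ n, ((fun u => B u u) '' K n).Nonempty := fun n => ⟨_, x n, hxK n, rfl⟩
  have hδmono : Monotone δ := fun m n hmn =>
    csInf_le_csInf (hbdd m) (hne n) (image_mono (hKanti hmn))
  have hδle : ∀ n, ∀ u ∈ K n, δ n ≤ B u u := fun n u hu => csInf_le (hbdd n) ⟨u, hu, rfl⟩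
  have hδM : BddAbove (range δ) :=
    ⟨M, by rintro _ ⟨n, rfl⟩; exact (hδle n _ (hxK n)).trans (hM n)⟩
  have hδlim := tendsto_atTop_ciSup hδmono hδM
  set d := ⨆ n, δ n
  have hδd : ∀ n, δ n ≤ d := fun n => le_ciSup hδM n
  have hc : ∀ n : ℕ, ∃ u ∈ K n, B u u < δ n + 1 / ((n : ℝ) + 1) := fun n => by
    obtain ⟨_, ⟨u, hu, rfl⟩, hlt⟩ := exists_lt_of_csInf_lt (hne n)
      (lt_add_of_pos_right (δ n) (Nat.one_div_pos_of_nat (n := n) (α := ℝ)))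
    exact ⟨u, hu, hlt⟩
  choose c hcK hclt using hc
  refine ⟨c, hcK, fun ε hε => ?_⟩
  have h1 : ∀ᶠ n : ℕ in atTop, d - ε / 16 < δ n :=
    (tendsto_order.1 hδlim).1 _ (by linarith)
  have h2 : ∀ᶠ n : ℕ in atTop, 1 / ((n : ℝ) + 1) < ε / 16 :=
    (tendsto_order.1 tendsto_one_div_add_atTop_nhds_zero_nat).2 _ (by positivity)
  obtain ⟨n₀, hn₀⟩ := eventually_atTop.1 (h1.and h2)
  refine ⟨n₀, fun m hm n hn => ?_⟩
  have hmid : (1 / 2 : ℝ) • c m + (1 / 2 : ℝ) • c n ∈ K n₀ :=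
    (convex_convexHull ℝ _) (hKanti hm (hcK m)) (hKanti hn (hcK n)) (by norm_num) (by norm_num)
      (by norm_num)
  have h3 := hδle n₀ _ hmid
  rw [form_convexComb B _ _ (by norm_num)] at h3
  linarith [(hn₀ m hm).2, (hn₀ n hn).2, (hn₀ n₀ le_rfl).1, hclt m, hclt n, hδd m, hδd n]

theorem ae_tendsto_of_mem_convexHull (ι : V →ₗ[ℝ] Lp ℝ 2 μ) {x c : ℕ → V} {u : E → ℝ}
    (hx : ∀ᵐ y ∂μ, Tendsto (fun n => ι (x n) y) atTop (𝓝 (u y)))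
    (hc : ∀ n, c n ∈ convexHull ℝ (x '' Ici n)) :
    ∀ᵐ y ∂μ, Tendsto (fun n => ι (c n) y) atTop (𝓝 (u y)) := by
  have hmem : ∀ n, ∀ᵐ y ∂μ, ι (c n) y ∈ convexHull ℝ ((fun k => ι (x k) y) '' Ici n) := by
    intro n
    have hconv : Convex ℝ
        {v : V | ∀ᵐ y ∂μ, ι v y ∈ convexHull ℝ ((fun k => ι (x k) y) '' Ici n)} := by
      intro v hv w hw a b ha hb hab
      filter_upwards [hv, hw, Lp.coeFn_add (a • ι v) (b • ι w), Lp.coeFn_smul a (ι v),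
        Lp.coeFn_smul b (ι w)] with y h1 h2 h3 h4 h5
      rw [map_add, map_smul, map_smul, h3, Pi.add_apply, h4, h5]
      exact convex_convexHull ℝ _ h1 h2 ha hb hab
    refine convexHull_min ?_ hconv (hc n)
    rintro _ ⟨k, hk, rfl⟩
    change ∀ᵐ y ∂μ, ι (x k) y ∈ convexHull ℝ ((fun k => ι (x k) y) '' Ici n)
    exact Eventually.of_forall fun y =>
      subset_convexHull ℝ _ (mem_image_of_mem (fun k => ι (x k) y) hk)
  filter_upwards [hx, ae_all_iff.2 hmem] with y h1 h2
  rw [Metric.tendsto_atTop] at h1 ⊢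
  intro ε hε
  obtain ⟨n₀, hn₀⟩ := h1 ε hε
  refine ⟨n₀, fun n hn => ?_⟩
  rw [← Metric.mem_ball]
  refine convexHull_min ?_ (convex_ball _ _) (h2 n)
  rintro _ ⟨k, hk, rfl⟩
  exact hn₀ k (hn.trans hk)

theorem tendsto_of_mem_convexHull {H : Type*} [NormedAddCommGroup H] [NormedSpace ℝ H]
    (ι : V →ₗ[ℝ] H) {x c : ℕ → V} {u : H} (hx : Tendsto (fun n => ι (x n)) atTop (𝓝 u))
    (hc : ∀ n, c n ∈ convexHull ℝ (x '' Ici n)) :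
    Tendsto (fun n => ι (c n)) atTop (𝓝 u) := by
  rw [Metric.tendsto_atTop] at hx ⊢
  intro ε hε
  obtain ⟨n₀, hn₀⟩ := hx ε hε
  refine ⟨n₀, fun n hn => ?_⟩
  have h : convexHull ℝ (x '' Ici n) ⊆ ι ⁻¹' Metric.ball u ε := by
    refine convexHull_min ?_ ((convex_ball u ε).linear_preimage ι)
    rintro _ ⟨k, hk, rfl⟩
    exact hn₀ k (hn.trans hk)
  exact h (hc n)

end Mazur

/-! ### Weak convergence for Dirichlet forms, and the extended Dirichlet space -/

namespace L2Form

variable {A : L2Form μ}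

/-- The form `A₁` as a bilinear map. -/
noncomputable def bilin₁ (A : L2Form μ) : A.dom →ₗ[ℝ] A.dom →ₗ[ℝ] ℝ :=
  A.form + (innerₗ (Lp ℝ 2 μ)).domRestrict₁₂ A.dom A.dom

theorem bilin₁_self (A : L2Form μ) (u : A.dom) : A.bilin₁ u u = A.normSq u := rfl

theorem form_le_normSq (A : L2Form μ) (u : A.dom) : A.form u u ≤ A.normSq u := by
  rw [normSq_eq]
  exact le_add_of_nonneg_right (sq_nonneg _)

theorem form_add_le_weighted (hA : ∀ u : A.dom, 0 ≤ A.form u u) (u v : A.dom) {δ : ℝ}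
    (hδ : 0 < δ) :
    A.form (u + v) (u + v) ≤ (1 + δ) * A.form u u + (1 + δ⁻¹) * A.form v v := by
  have h1 := hA (δ • u - v)
  have h2 : A.form (δ • u - v) (δ • u - v) =
      δ ^ 2 * A.form u u - δ * (A.form u v + A.form v u) + A.form v v := by
    simp only [map_sub, map_smul, LinearMap.sub_apply, LinearMap.smul_apply, smul_eq_mul]
    ring
  have h3 : A.form (u + v) (u + v) =
      A.form u u + (A.form u v + A.form v u) + A.form v v := by
    simp only [map_add, LinearMap.add_apply]
    ring
  have h4 : A.form u v + A.form v u ≤ δ * A.form u u + δ⁻¹ * A.form v v := by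
    rw [h2] at h1
    have h5 : δ⁻¹ * (δ * (A.form u v + A.form v u)) ≤
        δ⁻¹ * (δ ^ 2 * A.form u u + A.form v v) :=
      mul_le_mul_of_nonneg_left (by linarith) (inv_nonneg.2 hδ.le)
    rw [inv_mul_cancel_left₀ hδ.ne', mul_add, pow_two, mul_assoc,
      inv_mul_cancel_left₀ hδ.ne'] at h5
    exact h5
  rw [h3]
  linarith

/-- A sequence with bounded energy that converges in `L²` has its limit in the form domain, and
convex combinations of its tails converge to the limit in the form norm. -/
theorem IsDirichlet.exists_convexHull_tendsto (hA : A.IsDirichlet) {x : ℕ → A.dom} {M : ℝ}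
    (hM : ∀ n, A.form (x n) (x n) ≤ M) {u : Lp ℝ 2 μ}
    (hx : Tendsto (fun n => (x n : Lp ℝ 2 μ)) atTop (𝓝 u)) :
    ∃ w : A.dom, (w : Lp ℝ 2 μ) = u ∧ ∃ c : ℕ → A.dom,
      (∀ n, c n ∈ convexHull ℝ (x '' Ici n)) ∧
      Tendsto (fun n => A.normSq (c n - w)) atTop (𝓝 0) := by
  obtain ⟨R, hR⟩ := hx.norm.bddAbove_range
  have hR : ∀ n, ‖(x n : Lp ℝ 2 μ)‖ ≤ R := fun n => hR (mem_range_self n)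
  obtain ⟨c, hc, hcauchy⟩ := exists_cauchy_convexHull (B := A.bilin₁)
    (fun u => normSq_nonneg hA.nonneg u) (x := x) (M := M + R ^ 2) fun n => by
      rw [bilin₁_self, normSq_eq]
      exact add_le_add (hM n) (pow_le_pow_left₀ (norm_nonneg _) (hR n) 2)
  obtain ⟨w, hw⟩ := hA.complete c hcauchy
  refine ⟨w, ?_, c, hc, hw⟩
  have h1 : Tendsto (fun n => (c n : Lp ℝ 2 μ)) atTop (𝓝 u) :=
    tendsto_of_mem_convexHull A.dom.subtype hx hc
  have h2 : Tendsto (fun n => (c n : Lp ℝ 2 μ)) atTop (𝓝 w) := by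
    rw [tendsto_iff_norm_sub_tendsto_zero]
    have h3 := (Real.continuous_sqrt.tendsto 0).comp hw
    rw [Real.sqrt_zero] at h3
    refine squeeze_zero (fun _ => norm_nonneg _) (fun n => ?_) h3
    exact Real.le_sqrt_of_sq_le (norm_sq_le_normSq hA.nonneg (c n - w))
  exact tendsto_nhds_unique h2 h1

/-- The energy is lower semicontinuous with respect to convergence in `L²`. -/
theorem IsDirichlet.exists_form_le_of_tendsto (hA : A.IsDirichlet) {x : ℕ → A.dom} {M : ℝ}
    (hM : ∀ n, A.form (x n) (x n) ≤ M) {u : Lp ℝ 2 μ}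
    (hx : Tendsto (fun n => (x n : Lp ℝ 2 μ)) atTop (𝓝 u)) :
    ∃ w : A.dom, (w : Lp ℝ 2 μ) = u ∧ A.form w w ≤ M := by
  obtain ⟨w, hw, c, hc, hcw⟩ := hA.exists_convexHull_tendsto hM hx
  refine ⟨w, hw, ?_⟩
  have hcM : ∀ n, A.form (c n) (c n) ≤ M := fun n =>
    convexHull_min (by rintro _ ⟨k, -, rfl⟩; exact hM k) (convex_form_le hA.nonneg M) (hc n)
  have hform : Tendsto (fun n => A.form (c n - w) (c n - w)) atTop (𝓝 0) :=
    squeeze_zero (fun n => hA.nonneg _) (fun n => A.form_le_normSq _) hcw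
  have hM0 : 0 ≤ M := (hA.nonneg _).trans (hM 0)
  have hδ : ∀ δ > 0, A.form w w ≤ (1 + δ) * M := by
    intro δ hδ
    have h1 : Tendsto (fun n => (1 + δ) * M + (1 + δ⁻¹) * A.form (c n - w) (c n - w)) atTop
        (𝓝 ((1 + δ) * M + (1 + δ⁻¹) * 0)) := (hform.const_mul _).const_add _
    rw [mul_zero, add_zero] at h1
    refine ge_of_tendsto' h1 fun n => ?_
    have h2 := form_add_le_weighted hA.nonneg (c n) (-(c n - w)) hδ
    have h3 : A.form (-(c n - w)) (-(c n - w)) = A.form (c n - w) (c n - w) := by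
      simp only [map_neg, LinearMap.neg_apply, neg_neg]
    rw [h3, neg_sub, add_sub_cancel] at h2
    have h4 := mul_le_mul_of_nonneg_left (hcM n) (by positivity : 0 ≤ 1 + δ)
    linarith
  refine le_of_forall_pos_le_add fun ε hε => (hδ (ε / (M + 1)) (by positivity)).trans ?_
  have : ε / (M + 1) * M ≤ ε := by
    rw [div_mul_eq_mul_div, div_le_iff₀ (by positivity)]
    nlinarith
  linarith

/-- A linear functional that is bounded for the energy seminorm. -/
def EnergyBounded (A : L2Form μ) (l : A.dom →ₗ[ℝ] ℝ) : Prop :=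
  ∃ K : ℝ, ∀ u : A.dom, |l u| ≤ K * √(A.form u u)

theorem EnergyBounded.neg {l : A.dom →ₗ[ℝ] ℝ} (hl : A.EnergyBounded l) : A.EnergyBounded (-l) := by
  obtain ⟨K, hK⟩ := hl
  exact ⟨K, fun u => by simpa using hK u⟩

theorem EnergyBounded.tendsto_zero {l : A.dom →ₗ[ℝ] ℝ} (hl : A.EnergyBounded l) {c : ℕ → A.dom}
    (hc : Tendsto (fun n => A.form (c n) (c n)) atTop (𝓝 0)) :
    Tendsto (fun n => l (c n)) atTop (𝓝 0) := by
  obtain ⟨K, hK⟩ := hl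
  refine squeeze_zero_norm (fun n => hK (c n)) ?_
  have h := ((Real.continuous_sqrt.tendsto 0).comp hc).const_mul K
  simpa using h

theorem IsSectorial.energyBounded_left (hs : A.IsSectorial) (v : A.dom) :
    A.EnergyBounded (A.form.flip v) := by
  obtain ⟨K, hK⟩ := hs
  refine ⟨K * √(A.form v v), fun u => (hK u v).trans_eq ?_⟩
  ring

theorem IsSectorial.energyBounded_symm (hs : A.IsSectorial) (v : A.dom) :
    A.EnergyBounded (A.form.flip v + A.form v) := by
  obtain ⟨K, hK⟩ := hs
  refine ⟨2 * K * √(A.form v v), fun u => ?_⟩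
  rw [LinearMap.add_apply, LinearMap.flip_apply]
  refine (abs_add_le _ _).trans ((add_le_add (hK u v) (hK v u)).trans_eq ?_)
  ring

/-- A sequence `x` with `limsup l (xₙ) > 0` has a subsequence on which `l` is bounded below by a
positive constant, and this bound passes to convex combinations. -/
theorem eventually_lt_of_convexHull {x : ℕ → A.dom} {l : A.dom →ₗ[ℝ] ℝ} {ε : ℝ}
    (h : ∀ φ : ℕ → ℕ, StrictMono φ → ∃ c : ℕ → A.dom,
      (∀ n, c n ∈ convexHull ℝ ((x ∘ φ) '' Ici n)) ∧ ∃ n, l (c n) < ε) :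
    ∀ᶠ n in atTop, l (x n) < ε := by
  by_contra hcon
  rw [not_eventually] at hcon
  obtain ⟨φ, hφ, hφε⟩ := extraction_of_frequently_atTop hcon
  obtain ⟨c, hc, n, hn⟩ := h φ hφ
  have h1 : convexHull ℝ ((x ∘ φ) '' Ici n) ⊆ l ⁻¹' Ici ε := by
    refine convexHull_min ?_ ((convex_Ici ε).linear_preimage l)
    rintro _ ⟨k, -, rfl⟩
    exact not_lt.1 (hφε k)
  exact absurd hn (not_lt.2 (h1 (hc n)))

theorem IsDirichlet.eventually_lt_of_tendsto_L2 (hA : A.IsDirichlet) {x : ℕ → A.dom} {M : ℝ}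
    (hM : ∀ n, A.form (x n) (x n) ≤ M)
    (hx : Tendsto (fun n => (x n : Lp ℝ 2 μ)) atTop (𝓝 0)) {l : A.dom →ₗ[ℝ] ℝ}
    (hl : A.EnergyBounded l) {ε : ℝ} (hε : 0 < ε) : ∀ᶠ n in atTop, l (x n) < ε := by
  refine eventually_lt_of_convexHull fun φ hφ => ?_
  obtain ⟨w, hw, c, hc, hcw⟩ := hA.exists_convexHull_tendsto (x := x ∘ φ) (fun n => hM (φ n))
    (hx.comp hφ.tendsto_atTop)
  have hw0 : w = 0 := Subtype.ext hw
  rw [hw0] at hcw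
  simp only [sub_zero] at hcw
  have h1 := hl.tendsto_zero
    (squeeze_zero (fun n => hA.nonneg _) (fun n => A.form_le_normSq _) hcw)
  exact ⟨c, hc, ((tendsto_order.1 h1).2 ε hε).exists⟩

theorem IsDirichlet.exists_posPart (hA : A.IsDirichlet) (u : A.dom) :
    ∃ p : A.dom, ((p : Lp ℝ 2 μ) =ᵐ[μ] fun x => max ((u : Lp ℝ 2 μ) x) 0) ∧
      A.form p p ≤ A.form u u := by
  choose w hw hw1 hw2 using fun k : ℕ =>
    hA.exists_cutoff u (by positivity : (0 : ℝ) < (k : ℝ) + 1)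
  have hsup : ((u : Lp ℝ 2 μ) ⊔ 0 : Lp ℝ 2 μ) =ᵐ[μ] fun x => max ((u : Lp ℝ 2 μ) x) 0 := by
    filter_upwards [Lp.coeFn_sup (u : Lp ℝ 2 μ) 0, Lp.coeFn_zero ℝ 2 μ] with x h1 h2
    rw [h1, Pi.sup_apply, h2]
    rfl
  have hlim : Tendsto (fun k => (w k : Lp ℝ 2 μ)) atTop (𝓝 ((u : Lp ℝ 2 μ) ⊔ 0)) := by
    refine tendsto_Lp_of_dominated ENNReal.ofNat_ne_top (Lp.memLp (u : Lp ℝ 2 μ)).norm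
      (fun k => ?_) ?_
    · filter_upwards [hw k] with x hx
      rw [hx]
      have h := abs_cutoff_sub_le ((u : Lp ℝ 2 μ) x) 0 ((k : ℝ) + 1)
      simpa [min_eq_left (by positivity : (0 : ℝ) ≤ (k : ℝ) + 1)] using h
    · filter_upwards [hsup, ae_all_iff.2 hw] with x h1 h2
      rw [h1]
      obtain ⟨n, hn⟩ := exists_nat_ge (max ((u : Lp ℝ 2 μ) x) 0)
      refine tendsto_const_nhds.congr' ?_
      filter_upwards [eventually_ge_atTop n] with k hk
      rw [h2 k, min_eq_left]
      have : (n : ℝ) ≤ k := by exact_mod_cast hk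
      linarith
  obtain ⟨p, hp, hpM⟩ := hA.exists_form_le_of_tendsto hw2 hlim
  exact ⟨p, by rw [hp]; exact hsup, hpM⟩

/-- Positive and negative part of an element of the form domain; their mutual energy is
nonpositive. -/
theorem IsDirichlet.exists_posPart_negPart (hA : A.IsDirichlet) (u : A.dom) :
    ∃ p q : A.dom, ((p : Lp ℝ 2 μ) =ᵐ[μ] fun x => max ((u : Lp ℝ 2 μ) x) 0) ∧
      ((q : Lp ℝ 2 μ) =ᵐ[μ] fun x => max (-(u : Lp ℝ 2 μ) x) 0) ∧ u = p - q ∧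
      A.form p p ≤ A.form u u ∧ A.form q q ≤ A.form u u ∧ A.form p q + A.form q p ≤ 0 := by
  obtain ⟨p, hp, hpu⟩ := hA.exists_posPart u
  obtain ⟨q, hq, hqu⟩ := hA.exists_posPart (-u)
  have hq : (q : Lp ℝ 2 μ) =ᵐ[μ] fun x => max (-(u : Lp ℝ 2 μ) x) 0 := by
    filter_upwards [hq, Lp.coeFn_neg (u : Lp ℝ 2 μ)] with x h1 h2
    rw [h1, Submodule.coe_neg, h2, Pi.neg_apply]
  have hqu : A.form q q ≤ A.form u u := by simpa using hqu
  refine ⟨p, q, hp, hq, ?_, hpu, hqu, ?_⟩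
  · refine Subtype.ext (Lp.ext ?_)
    filter_upwards [hp, hq, Lp.coeFn_sub (p : Lp ℝ 2 μ) q] with x h1 h2 h3
    rw [Submodule.coe_sub, h3, Pi.sub_apply, h1, h2]
    rcases le_total ((u : Lp ℝ 2 μ) x) 0 with h | h
    · rw [max_eq_right h, max_eq_left (by linarith)]
      ring
    · rw [max_eq_left h, max_eq_right (by linarith)]
      ring
  · -- `p` is also the positive part of `p - t q`, for every `t > 0`
    have ht : ∀ t > 0, A.form p q + A.form q p ≤ t * A.form q q := by
      intro t ht
      obtain ⟨p', hp', hle⟩ := hA.exists_posPart (p - t • q)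
      have hpp : p' = p := by
        refine Subtype.ext (Lp.ext ?_)
        filter_upwards [hp', hp, hq, Lp.coeFn_sub (p : Lp ℝ 2 μ) (t • (q : Lp ℝ 2 μ)),
          Lp.coeFn_smul t (q : Lp ℝ 2 μ)] with x h1 h2 h3 h4 h5
        rw [h1, Submodule.coe_sub, Submodule.coe_smul, h4, Pi.sub_apply, h5, Pi.smul_apply, h2, h3,
          smul_eq_mul]
        rcases le_total ((u : Lp ℝ 2 μ) x) 0 with h | h
        · rw [max_eq_right h, max_eq_left (by linarith : 0 ≤ -(u : Lp ℝ 2 μ) x)]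
          exact max_eq_right (by nlinarith)
        · rw [max_eq_left h, max_eq_right (by linarith : -(u : Lp ℝ 2 μ) x ≤ 0), mul_zero, sub_zero,
            max_eq_left h]
      rw [hpp] at hle
      have h6 : A.form (p - t • q) (p - t • q) =
          A.form p p - t * (A.form p q + A.form q p) + t * (t * A.form q q) := by
        simp only [map_sub, map_smul, LinearMap.sub_apply, LinearMap.smul_apply, smul_eq_mul]
        ring
      rw [h6] at hle
      exact le_of_mul_le_mul_left (by linarith) ht
    have hq0 := hA.nonneg q
    refine le_of_forall_pos_le_add fun ε hε => ?_
    refine (ht (ε / (A.form q q + 1)) (by positivity)).trans ?_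
    rw [zero_add, div_mul_eq_mul_div, div_le_iff₀ (by positivity)]
    nlinarith

/-- With `q = (p - v)⁺`, so that `v + q = p ∨ v` and `p - q = p ∧ v`, one has
`A(p ∨ v, p ∨ v) + A(p ∧ v, p ∧ v) ≤ A(p, p) + A(v, v)`. -/
theorem IsDirichlet.exists_sup (hA : A.IsDirichlet) (p v : A.dom) :
    ∃ q : A.dom, ((q : Lp ℝ 2 μ) =ᵐ[μ] fun x => max ((p : Lp ℝ 2 μ) x - (v : Lp ℝ 2 μ) x) 0) ∧
      A.form (v + q) (v + q) + A.form (p - q) (p - q) ≤ A.form p p + A.form v v := by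
  obtain ⟨q, q', hq, -, hpv, -, -, hmut⟩ := hA.exists_posPart_negPart (p - v)
  refine ⟨q, ?_, ?_⟩
  · filter_upwards [hq, Lp.coeFn_sub (p : Lp ℝ 2 μ) v] with x h1 h2
    rw [h1, Submodule.coe_sub, h2, Pi.sub_apply]
  · obtain rfl : p = v + (q - q') := by rw [← hpv, add_sub_cancel]
    simp only [map_add, map_sub, LinearMap.add_apply, LinearMap.sub_apply]
    linarith

/-- Let `pₙ ≥ 0` have bounded energy and converge to `0` a.e. Then the symmetrized form satisfies
`limsup A(pₙ, v) ≤ 0` for all `v ≥ 0` in the domain. Here `pₙ` is split into `pₙ ∧ t v`, which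
converges to `0` weakly, and `q = (pₙ - t v)⁺`, for which the energy of `pₙ ∨ t v = t v + q`
gives a bound of order `1 / t`. -/
theorem IsDirichlet.eventually_symm_lt (hA : A.IsDirichlet) (hs : A.IsSectorial) {p : ℕ → A.dom}
    {M : ℝ} (hM : ∀ n, A.form (p n) (p n) ≤ M) (hp : ∀ n, 0 ≤ (p n : Lp ℝ 2 μ))
    (hp0 : ∀ᵐ x ∂μ, Tendsto (fun n => (p n : Lp ℝ 2 μ) x) atTop (𝓝 0)) {v : A.dom}
    (hv : 0 ≤ (v : Lp ℝ 2 μ)) {η : ℝ} (hη : 0 < η) :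
    ∀ᶠ n in atTop, A.form (p n) v + A.form v (p n) < η := by
  have hM0 : 0 ≤ M := (hA.nonneg _).trans (hM 0)
  set t : ℝ := (2 * M + 1) / η
  have ht : 0 < t := by positivity
  have htM : M < t * (η / 2) := by
    simp only [t]
    field_simp
    linarith
  choose q hq hqle using fun n => hA.exists_sup (p n) (t • v)
  have hEr : ∀ n, A.form (p n - q n) (p n - q n) ≤ M + t ^ 2 * A.form v v := fun n => by
    have h1 := hqle n
    rw [form_smul_smul] at h1
    linarith [hM n, hA.nonneg (t • v + q n)]
  have hr0 : Tendsto (fun n => ((p n - q n : A.dom) : Lp ℝ 2 μ)) atTop (𝓝 0) := by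
    have hmin : ∀ n, ((p n - q n : A.dom) : Lp ℝ 2 μ) =ᵐ[μ]
        fun x => min ((p n : Lp ℝ 2 μ) x) (t * (v : Lp ℝ 2 μ) x) := fun n => by
      filter_upwards [hq n, Lp.coeFn_sub (p n : Lp ℝ 2 μ) (q n),
        Lp.coeFn_smul t (v : Lp ℝ 2 μ)] with x h1 h2 h3
      rw [Submodule.coe_smul, h3, Pi.smul_apply, smul_eq_mul] at h1
      rw [Submodule.coe_sub, h2, Pi.sub_apply, h1]
      rcases le_total ((p n : Lp ℝ 2 μ) x) (t * (v : Lp ℝ 2 μ) x) with h | h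
      · rw [max_eq_right (by linarith), min_eq_left h, sub_zero]
      · rw [max_eq_left (by linarith), min_eq_right h, sub_sub_cancel]
    refine tendsto_Lp_of_dominated ENNReal.ofNat_ne_top
      ((Lp.memLp (v : Lp ℝ 2 μ)).const_mul t) (fun n => ?_) ?_
    · filter_upwards [hmin n, (Lp.coeFn_nonneg _).2 (hp n),
        (Lp.coeFn_nonneg _).2 hv] with x h1 h2 h3
      rw [h1, abs_of_nonneg (le_min h2 (mul_nonneg ht.le h3))]
      exact min_le_right _ _
    · filter_upwards [ae_all_iff.2 hmin, hp0, (Lp.coeFn_nonneg _).2 hv,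
        Lp.coeFn_zero ℝ 2 μ] with x h1 h2 h3 h4
      rw [h4]
      have h5 := h2.min (tendsto_const_nhds (x := t * (v : Lp ℝ 2 μ) x))
      rw [min_eq_left (mul_nonneg ht.le h3)] at h5
      exact h5.congr fun n => (h1 n).symm
  filter_upwards [hA.eventually_lt_of_tendsto_L2 hEr hr0 (hs.energyBounded_symm v)
    (half_pos hη)] with n hn
  rw [LinearMap.add_apply, LinearMap.flip_apply] at hn
  have h1 := hqle n
  have h2 : A.form (t • v + q n) (t • v + q n) =
      A.form (t • v) (t • v) + t * (A.form v (q n) + A.form (q n) v) + A.form (q n) (q n) := by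
    simp only [map_add, map_smul, LinearMap.add_apply, LinearMap.smul_apply, smul_eq_mul]
    ring
  have h3 : A.form v (q n) + A.form (q n) v < η / 2 := by
    refine lt_of_mul_lt_mul_left (lt_of_le_of_lt ?_ htM) ht.le
    linarith [hM n, hA.nonneg (q n), hA.nonneg (p n - q n)]
  simp only [map_sub, LinearMap.sub_apply] at hn
  linarith

theorem IsDirichlet.eventually_lt_of_ae_tendsto (hA : A.IsDirichlet) (hs : A.IsSectorial)
    {p : ℕ → A.dom} {M : ℝ} (hM : ∀ n, A.form (p n) (p n) ≤ M)
    (hp : ∀ n, 0 ≤ (p n : Lp ℝ 2 μ))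
    (hp0 : ∀ᵐ x ∂μ, Tendsto (fun n => (p n : Lp ℝ 2 μ) x) atTop (𝓝 0)) {l : A.dom →ₗ[ℝ] ℝ}
    (hl : A.EnergyBounded l) {ε : ℝ} (hε : 0 < ε) : ∀ᶠ n in atTop, l (p n) < ε := by
  refine eventually_lt_of_convexHull fun φ hφ => ?_
  obtain ⟨c, hc, hcauchy⟩ := exists_cauchy_convexHull (B := A.form) hA.nonneg (x := p ∘ φ)
    (fun n => hM (φ n))
  have hcM : ∀ n, A.form (c n) (c n) ≤ M := fun n =>
    convexHull_min (by rintro _ ⟨k, -, rfl⟩; exact hM (φ k)) (convex_form_le hA.nonneg M) (hc n)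
  have hcnn : ∀ n, 0 ≤ (c n : Lp ℝ 2 μ) := fun n => by
    have h1 : convexHull ℝ ((p ∘ φ) '' Ici n) ⊆ A.dom.subtype ⁻¹' Ici 0 := by
      refine convexHull_min ?_ ((convex_Ici 0).linear_preimage A.dom.subtype)
      rintro _ ⟨k, -, rfl⟩
      exact hp (φ k)
    exact h1 (hc n)
  have hc0 : ∀ᵐ x ∂μ, Tendsto (fun n => (c n : Lp ℝ 2 μ) x) atTop (𝓝 0) :=
    ae_tendsto_of_mem_convexHull A.dom.subtype (x := p ∘ φ) (u := fun _ => 0)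
      (by filter_upwards [hp0] with x hx using hx.comp hφ.tendsto_atTop) hc
  refine ⟨c, hc, ?_⟩
  -- `A(cₘ, cₘ) ≤ A(cₘ - cₙ, cₘ - cₙ) + A(cₙ, cₘ) + A(cₘ, cₙ)`, and `n → ∞`
  have hform : Tendsto (fun m => A.form (c m) (c m)) atTop (𝓝 0) := by
    refine tendsto_order.2 ⟨fun a ha => Eventually.of_forall fun m =>
      ha.trans_le (hA.nonneg _), fun η hη => ?_⟩
    obtain ⟨n₀, hn₀⟩ := hcauchy (η / 2) (half_pos hη)
    filter_upwards [eventually_ge_atTop n₀] with m hm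
    obtain ⟨n, hn, hn'⟩ := ((hA.eventually_symm_lt hs hcM hcnn hc0 (hcnn m) (half_pos hη)).and
      (eventually_ge_atTop n₀)).exists
    have h1 := hn₀ m hm n hn'
    simp only [map_sub, LinearMap.sub_apply] at h1
    linarith [hA.nonneg (c n)]
  exact ((tendsto_order.1 (hl.tendsto_zero hform)).2 ε hε).exists

/-- If a sequence in the domain of a sectorial Dirichlet form has bounded energy and converges to
`0` almost everywhere, then it converges to `0` weakly with respect to the form. -/
theorem IsDirichlet.tendsto_zero_of_ae_tendsto (hA : A.IsDirichlet) (hs : A.IsSectorial)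
    {d : ℕ → A.dom} {M : ℝ} (hM : ∀ n, A.form (d n) (d n) ≤ M)
    (hd : ∀ᵐ x ∂μ, Tendsto (fun n => (d n : Lp ℝ 2 μ) x) atTop (𝓝 0)) {l : A.dom →ₗ[ℝ] ℝ}
    (hl : A.EnergyBounded l) : Tendsto (fun n => l (d n)) atTop (𝓝 0) := by
  have key : ∀ p : ℕ → A.dom, (∀ n, A.form (p n) (p n) ≤ M) → (∀ n, 0 ≤ (p n : Lp ℝ 2 μ)) →
      (∀ᵐ x ∂μ, Tendsto (fun n => (p n : Lp ℝ 2 μ) x) atTop (𝓝 0)) →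
      Tendsto (fun n => l (p n)) atTop (𝓝 0) := by
    intro p hpM hp hp0
    refine tendsto_order.2 ⟨fun a ha => ?_, fun a ha =>
      hA.eventually_lt_of_ae_tendsto hs hpM hp hp0 hl ha⟩
    filter_upwards [hA.eventually_lt_of_ae_tendsto hs hpM hp hp0 hl.neg (neg_pos.2 ha)] with n hn
    rw [LinearMap.neg_apply] at hn
    linarith
  choose p q hp hq hpq hpM hqM hmut using fun n => hA.exists_posPart_negPart (d n)
  have h1 := key p (fun n => (hpM n).trans (hM n))
    (fun n => by
      rw [← Lp.coeFn_nonneg]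
      filter_upwards [hp n] with x hx
      rw [hx]
      exact le_max_right _ _)
    (by
      filter_upwards [hd, ae_all_iff.2 hp] with x h1 h2
      have h3 := h1.max (tendsto_const_nhds (x := (0 : ℝ)))
      rw [max_self] at h3
      exact h3.congr fun n => (h2 n).symm)
  have h2 := key q (fun n => (hqM n).trans (hM n))
    (fun n => by
      rw [← Lp.coeFn_nonneg]
      filter_upwards [hq n] with x hx
      rw [hx]
      exact le_max_right _ _)
    (by
      filter_upwards [hd, ae_all_iff.2 hq] with x h1 h2
      have h3 := h1.neg.max (tendsto_const_nhds (x := (0 : ℝ)))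
      rw [neg_zero, max_self] at h3
      exact h3.congr fun n => (h2 n).symm)
  have h3 := h1.sub h2
  rw [sub_zero] at h3
  refine h3.congr fun n => ?_
  conv_rhs => rw [hpq n]
  rw [map_sub]

/-- The a.e. limit of a sequence with bounded energy is in the extended Dirichlet space. -/
theorem IsDirichlet.inExtended_of_ae_tendsto (hA : A.IsDirichlet) {x : ℕ → A.dom} {M : ℝ}
    (hM : ∀ n, A.form (x n) (x n) ≤ M) {h : E → ℝ}
    (hx : ∀ᵐ y ∂μ, Tendsto (fun n => (x n : Lp ℝ 2 μ) y) atTop (𝓝 (h y))) :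
    A.InExtended h := by
  obtain ⟨c, hc, hcauchy⟩ := exists_cauchy_convexHull (B := A.form) hA.nonneg hM
  exact ⟨aestronglyMeasurable_of_tendsto_ae atTop
    (fun n => Lp.aestronglyMeasurable (x n : Lp ℝ 2 μ)) hx, c, hcauchy,
    ae_tendsto_of_mem_convexHull A.dom.subtype hx hc⟩

theorem exists_form_le_of_cauchy (hA : ∀ u : A.dom, 0 ≤ A.form u u) {s : ℕ → A.dom}
    (hs : ∀ ε > (0 : ℝ), ∃ n₀ : ℕ, ∀ m ≥ n₀, ∀ n ≥ n₀, A.form (s m - s n) (s m - s n) < ε) :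
    ∃ M, ∀ n, A.form (s n) (s n) ≤ M := by
  obtain ⟨n₀, hn₀⟩ := hs 1 one_pos
  refine ⟨2 + ∑ k ∈ Finset.range (n₀ + 1), 2 * A.form (s k) (s k), fun n => ?_⟩
  have hnn : ∀ k ∈ Finset.range (n₀ + 1), 0 ≤ 2 * A.form (s k) (s k) := fun k _ =>
    mul_nonneg two_pos.le (hA _)
  rcases le_total n n₀ with h | h
  · have h1 := Finset.single_le_sum hnn (Finset.mem_range.2 (Nat.lt_succ_of_le h))
    linarith [hA (s n)]
  · have h1 := Finset.single_le_sum hnn (Finset.mem_range.2 (Nat.lt_succ_self n₀))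
    have h2 := form_add_le hA (s n - s n₀) (s n₀)
    rw [sub_add_cancel] at h2
    linarith [hn₀ n h n₀ le_rfl]

/-- The extended form can be computed along every sequence of bounded energy that converges almost
everywhere. -/
theorem IsDirichlet.tendsto_extForm (hA : A.IsDirichlet) (hs : A.IsSectorial) {x : ℕ → A.dom}
    {M : ℝ} (hM : ∀ n, A.form (x n) (x n) ≤ M) {h : E → ℝ}
    (hx : ∀ᵐ y ∂μ, Tendsto (fun n => (x n : Lp ℝ 2 μ) y) atTop (𝓝 (h y))) (v : A.dom) :
    Tendsto (fun n => A.form (x n) v) atTop (𝓝 (A.extForm h v)) := by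
  have hex := (hA.inExtended_of_ae_tendsto hM hx).2
  obtain ⟨hcauchy, hae⟩ := hex.choose_spec
  rw [extForm, dif_pos hex]
  set s := hex.choose
  obtain ⟨K, hK⟩ := hs
  have hconv : CauchySeq fun n => A.form (s n) v := by
    rw [Metric.cauchySeq_iff]
    intro ε hε
    have hD : 0 ≤ |K| * √(A.form v v) := by positivity
    obtain ⟨n₀, hn₀⟩ := hcauchy ((ε / (|K| * √(A.form v v) + 1)) ^ 2) (by positivity)
    refine ⟨n₀, fun m hm n hn => ?_⟩
    rw [Real.dist_eq, ← LinearMap.sub_apply, ← map_sub]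
    have h1 : √(A.form (s m - s n) (s m - s n)) ≤ ε / (|K| * √(A.form v v) + 1) :=
      Real.sqrt_le_iff.2 ⟨by positivity, (hn₀ m hm n hn).le⟩
    calc |A.form (s m - s n) v| ≤ K * √(A.form (s m - s n) (s m - s n)) * √(A.form v v) := hK _ _
      _ ≤ |K| * √(A.form (s m - s n) (s m - s n)) * √(A.form v v) := by
          gcongr
          exact le_abs_self K
      _ = |K| * √(A.form v v) * √(A.form (s m - s n) (s m - s n)) := by ring
      _ ≤ |K| * √(A.form v v) * (ε / (|K| * √(A.form v v) + 1)) :=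
          mul_le_mul_of_nonneg_left h1 hD
      _ < ε := by
          rw [mul_div_assoc', div_lt_iff₀ (by positivity)]
          nlinarith
  have hlim := hconv.tendsto_limUnder
  obtain ⟨M', hM'⟩ := exists_form_le_of_cauchy hA.nonneg hcauchy
  have hdiff := hA.tendsto_zero_of_ae_tendsto ⟨K, hK⟩ (d := fun n => x n - s n)
    (M := 2 * M + 2 * M')
    (fun n => (form_sub_le hA.nonneg _ _).trans (by linarith [hM n, hM' n]))
    (by
      filter_upwards [hx, hae, ae_all_iff.2 fun n =>
        Lp.coeFn_sub (x n : Lp ℝ 2 μ) (s n)] with y h1 h2 h3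
      have h4 := h1.sub h2
      rw [sub_self] at h4
      exact h4.congr fun n => (h3 n).symm)
    (IsSectorial.energyBounded_left ⟨K, hK⟩ v)
  have h5 := hdiff.add hlim
  rw [zero_add] at h5
  refine h5.congr fun n => ?_
  rw [LinearMap.flip_apply, map_sub, LinearMap.sub_apply, sub_add_cancel]

end L2Form

/-! ### The potential of a reference function -/

theorem L2Form.eval_of_mem {A : L2Form μ} {w : Lp ℝ 2 μ} (h : w ∈ A.dom) (v : A.dom) :
    A.eval w v = A.form ⟨w, h⟩ v := dif_pos h

namespace ContractionSemigroup

variable {T : ContractionSemigroup μ} {g : Lp ℝ 1 μ}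

theorem IsReference.toL2_ae_eq (hg : T.IsReference g) : g =ᵐ[μ] hg.toL2 :=
  hg.memLp_two.coeFn_toLp.symm

theorem IsReference.nonneg (hg : T.IsReference g) : 0 ≤ g := by
  rw [← Lp.coeFn_nonneg]
  filter_upwards [hg.pos] with x hx using hx.le

theorem IsReference.toL2_nonneg (hg : T.IsReference g) : 0 ≤ hg.toL2 := by
  rw [← Lp.coeFn_nonneg]
  filter_upwards [hg.pos, hg.toL2_ae_eq] with x hx h
  rw [← h]
  exact hx.le

theorem IsReference.potential_lt_top (hg : T.IsReference g) :
    ∀ᵐ x ∂μ, T.potential g x < ∞ := by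
  obtain ⟨C, hC⟩ := hg.potential_bdd
  filter_upwards [hC] with x hx
  exact hx.trans_lt ENNReal.ofReal_lt_top

variable [SigmaFinite μ]

/-- The approximations `G_α g` of the potential of a reference function are uniformly bounded. -/
theorem IsReference.exists_resolvent_le (hT : T.IsDualSubMarkovian) (hg : T.IsReference g) :
    ∃ C : ℝ, 0 ≤ C ∧ (∀ᵐ x ∂μ, (T.potential g x).toReal ≤ C) ∧
      ∀ α > 0, ∀ᵐ x ∂μ, 0 ≤ T.resolvent α hg.toL2 x ∧ T.resolvent α hg.toL2 x ≤ C := by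
  obtain ⟨C, hC⟩ := hg.potential_bdd
  refine ⟨max C 0, le_max_right _ _, ?_, fun α hα => ?_⟩
  · filter_upwards [hC] with x hx
    have h := ENNReal.toReal_mono ENNReal.ofReal_ne_top hx
    rwa [ENNReal.toReal_ofReal'] at h
  · filter_upwards [hC, hT.ofReal_resolvent_le_potential hg.toL2_nonneg hg.toL2_ae_eq hα,
      (Lp.coeFn_nonneg _).2 (hT.resolvent_nonneg hg.toL2_nonneg α)] with x h1 h2 h3
    refine ⟨h3, (ENNReal.ofReal_le_ofReal_iff (le_max_right _ _)).1 ?_⟩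
    exact (h2.trans h1).trans (ENNReal.ofReal_le_ofReal (le_max_left _ _))

theorem IsReference.tendsto_resolvent (hT : T.IsDualSubMarkovian) (hg : T.IsReference g)
    {α : ℕ → ℝ} (hα : ∀ k, 0 < α k) (hα0 : Tendsto α atTop (𝓝 0)) :
    ∀ᵐ x ∂μ, Tendsto (fun k => T.resolvent (α k) hg.toL2 x) atTop
      (𝓝 (T.potential g x).toReal) := by
  filter_upwards [hT.tendsto_resolvent hg.toL2_nonneg hg.toL2_ae_eq hα hα0, hg.potential_lt_top,
    ae_all_iff.2 fun k =>
      (Lp.coeFn_nonneg _).2 (hT.resolvent_nonneg hg.toL2_nonneg (α k))] with x h1 h2 h3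
  refine ((ENNReal.tendsto_toReal h2.ne).comp h1).congr fun k => ?_
  exact ENNReal.toReal_ofReal (h3 k)

section Perturbation

variable {E₀ : L2Form μ} {N : Lp ℝ 2 μ →ₗ.[ℝ] Lp ℝ 2 μ}

theorem IsReference.resolvent_mem (hT : T.IsDualSubMarkovian)
    (hN : IsLinearPerturbation T E₀ N) (hg : T.IsReference g) {α : ℝ} (hα : 0 < α) :
    T.resolvent α hg.toL2 ∈ E₀.dom := by
  obtain ⟨C, -, -, hC⟩ := hg.exists_resolvent_le hT
  refine hN.mem_dom _ _ (T.hasGenerator_resolvent hα hg.toL2) ⟨C, ?_⟩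
  filter_upwards [hC α hα] with x hx
  exact abs_le.2 ⟨by linarith, hx.2⟩

/-- The energies of the approximations `u = G_α g`, and also the numbers `α (u, u)`, are bounded:
`E⁰(u, u) ≤ (-L u, u) = (g, u) - α (u, u)` and `(g, u) ≤ ‖Gg‖_∞ ‖g‖₁`. -/
theorem IsReference.exists_form_add_le (hT : T.IsDualSubMarkovian)
    (hN : IsLinearPerturbation T E₀ N) (hg : T.IsReference g) :
    ∃ M : ℝ, ∀ (α : ℝ) (hα : 0 < α),
      E₀.form ⟨_, hg.resolvent_mem hT hN hα⟩ ⟨_, hg.resolvent_mem hT hN hα⟩ +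
        α * ‖T.resolvent α hg.toL2‖ ^ 2 ≤ M := by
  obtain ⟨C, -, -, hC⟩ := hg.exists_resolvent_le hT
  refine ⟨∫ x, g x * C ∂μ, fun α hα => ?_⟩
  have hbdd : EssBdd μ (T.resolvent α hg.toL2) := ⟨C, by
    filter_upwards [hC α hα] with x hx
    exact abs_le.2 ⟨by linarith, hx.2⟩⟩
  have h := hN.domination ⟨_, hg.resolvent_mem hT hN hα⟩ _
    (T.hasGenerator_resolvent hα hg.toL2) hbdd
  rw [neg_sub, inner_sub_left, real_inner_smul_left, real_inner_self_eq_norm_sq] at h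
  have h1 : inner ℝ hg.toL2 (T.resolvent α hg.toL2) ≤ ∫ x, g x * C ∂μ := by
    rw [inner_eq_integral]
    refine integral_mono_ae (integrable_mul_L2 _ _) ((integrable_L1 g).mul_const C) ?_
    filter_upwards [hC α hα, hg.toL2_ae_eq, hg.pos] with x h2 h3 h4
    rw [← h3]
    exact mul_le_mul_of_nonneg_left h2.2 h4.le
  change _ ≤ inner ℝ hg.toL2 (T.resolvent α hg.toL2) - α * ‖T.resolvent α hg.toL2‖ ^ 2 at h
  linarith

theorem IsReference.exists_form_le (hT : T.IsDualSubMarkovian)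
    (hN : IsLinearPerturbation T E₀ N) (hg : T.IsReference g) :
    ∃ M : ℝ, ∀ (α : ℝ) (hα : 0 < α),
      E₀.form ⟨_, hg.resolvent_mem hT hN hα⟩ ⟨_, hg.resolvent_mem hT hN hα⟩ ≤ M := by
  obtain ⟨M, hM⟩ := hg.exists_form_add_le hT hN
  exact ⟨M, fun α hα => (le_add_of_nonneg_right (by positivity)).trans (hM α hα)⟩

theorem IsReference.inExtended (hT : T.IsDualSubMarkovian) (hE₀ : E₀.IsDirichlet)
    (hN : IsLinearPerturbation T E₀ N) (hg : T.IsReference g) :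
    E₀.InExtended (fun x => (T.potential g x).toReal) := by
  obtain ⟨M, hM⟩ := hg.exists_form_le hT hN
  have hα : ∀ k : ℕ, (0 : ℝ) < 1 / ((k : ℝ) + 1) := fun k => Nat.one_div_pos_of_nat
  exact hE₀.inExtended_of_ae_tendsto (x := fun k => ⟨_, hg.resolvent_mem hT hN (hα k)⟩)
    (fun k => hM _ (hα k))
    (hg.tendsto_resolvent hT hα tendsto_one_div_add_atTop_nhds_zero_nat)

theorem IsReference.tendsto_form (hT : T.IsDualSubMarkovian) (hE₀ : E₀.IsDirichlet)
    (hE₀s : E₀.IsSectorial) (hN : IsLinearPerturbation T E₀ N) (hg : T.IsReference g)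
    {α : ℕ → ℝ} (hα : ∀ k, 0 < α k) (hα0 : Tendsto α atTop (𝓝 0)) (u : E₀.dom) :
    Tendsto (fun k => E₀.form ⟨_, hg.resolvent_mem hT hN (hα k)⟩ u) atTop
      (𝓝 (E₀.extForm (fun x => (T.potential g x).toReal) u)) := by
  obtain ⟨M, hM⟩ := hg.exists_form_le hT hN
  exact hE₀.tendsto_extForm hE₀s (x := fun k => ⟨_, hg.resolvent_mem hT hN (hα k)⟩)
    (fun k => hM _ (hα k)) (hg.tendsto_resolvent hT hα hα0) u

theorem IsReference.tendsto_eval (hT : T.IsDualSubMarkovian) (hE₀ : E₀.IsDirichlet)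
    (hE₀s : E₀.IsSectorial) (hN : IsLinearPerturbation T E₀ N) (hg : T.IsReference g)
    (u : E₀.dom) :
    Tendsto (fun α : ℝ => E₀.eval (T.resolvent α hg.toL2) u) (𝓝[>] 0)
      (𝓝 (E₀.extForm (fun x => (T.potential g x).toReal) u)) := by
  refine tendsto_of_seq_tendsto fun α hα => ?_
  obtain ⟨hα0, hpos⟩ := tendsto_nhdsWithin_iff.1 hα
  obtain ⟨n₀, hn₀⟩ := eventually_atTop.1 hpos
  rw [← tendsto_add_atTop_iff_nat n₀]
  have hpos' : ∀ k, 0 < α (k + n₀) := fun k => hn₀ _ (Nat.le_add_left _ _)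
  refine (hg.tendsto_form hT hE₀ hE₀s hN hpos'
    (hα0.comp (tendsto_add_atTop_nat n₀)) u).congr fun k => ?_
  exact (L2Form.eval_of_mem (hg.resolvent_mem hT hN (hpos' k)) u).symm

/-- `α G_α g → 0` in `L²` as `α ↓ 0`, since `α ‖G_α g‖²` is bounded. -/
theorem IsReference.tendsto_smul_resolvent (hT : T.IsDualSubMarkovian) (hE₀ : E₀.IsDirichlet)
    (hN : IsLinearPerturbation T E₀ N) (hg : T.IsReference g) {α : ℕ → ℝ} (hα : ∀ k, 0 < α k)
    (hα0 : Tendsto α atTop (𝓝 0)) :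
    Tendsto (fun k => α k • T.resolvent (α k) hg.toL2) atTop (𝓝 0) := by
  obtain ⟨M, hM⟩ := hg.exists_form_add_le hT hN
  have h1 : Tendsto (fun k => √(α k * M)) atTop (𝓝 0) := by
    have := (Real.continuous_sqrt.tendsto _).comp (hα0.mul_const M)
    rwa [zero_mul, Real.sqrt_zero] at this
  refine squeeze_zero_norm (fun k => ?_) h1
  refine Real.le_sqrt_of_sq_le ?_
  rw [norm_smul, Real.norm_of_nonneg (hα k).le, mul_pow, pow_two (α k), mul_assoc]
  refine mul_le_mul_of_nonneg_left ?_ (hα k).le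
  linarith [hM (α k) (hα k), hE₀.nonneg ⟨_, hg.resolvent_mem hT hN (hα k)⟩]

theorem IsReference.integral_mul_eq (hT : T.IsDualSubMarkovian) (hE₀ : E₀.IsDirichlet)
    (hE₀s : E₀.IsSectorial) (hN : IsLinearPerturbation T E₀ N) (hg : T.IsReference g)
    (u : SpaceD E₀ N) :
    ∫ x, u.val x * g x ∂μ = E₀.extForm (fun x => (T.potential g x).toReal) u.inForm +
      ∫ x, (T.potential g x).toReal * u.image x ∂μ := by
  obtain ⟨C, hC0, -, hC⟩ := hg.exists_resolvent_le hT
  set α : ℕ → ℝ := fun k => 1 / ((k : ℝ) + 1)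
  have hα : ∀ k, 0 < α k := fun k => Nat.one_div_pos_of_nat
  have hα0 : Tendsto α atTop (𝓝 0) := tendsto_one_div_add_atTop_nhds_zero_nat
  have hdec : ∀ k, inner ℝ (hg.toL2 - α k • T.resolvent (α k) hg.toL2) u.val =
      E₀.form ⟨_, hg.resolvent_mem hT hN (hα k)⟩ u.inForm +
        ∫ x, T.resolvent (α k) hg.toL2 x * u.image x ∂μ := by
    intro k
    have h := hN.decomposition ⟨_, hg.resolvent_mem hT hN (hα k)⟩ _
      (T.hasGenerator_resolvent (hα k) hg.toL2) ⟨C, by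
        filter_upwards [hC (α k) (hα k)] with x hx
        exact abs_le.2 ⟨by linarith, hx.2⟩⟩ u.inForm u.mem_op
    rw [neg_sub] at h
    exact h
  have hL : Tendsto (fun k => inner ℝ (hg.toL2 - α k • T.resolvent (α k) hg.toL2) u.val) atTop
      (𝓝 (inner ℝ (hg.toL2 - 0) u.val)) :=
    (tendsto_const_nhds.sub (hg.tendsto_smul_resolvent hT hE₀ hN hα hα0)).inner
      tendsto_const_nhds
  have hI : Tendsto (fun k => ∫ x, T.resolvent (α k) hg.toL2 x * u.image x ∂μ) atTop
      (𝓝 (∫ x, (T.potential g x).toReal * u.image x ∂μ)) := by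
    have hint : Integrable u.image μ := u.integrable
    refine tendsto_integral_of_dominated_convergence (fun x => C * ‖u.image x‖)
      (fun k => (Lp.aestronglyMeasurable _).mul (Lp.aestronglyMeasurable _))
      (hint.norm.const_mul C) (fun k => ?_) ?_
    · filter_upwards [hC (α k) (hα k)] with x hx
      rw [norm_mul, Real.norm_of_nonneg hx.1]
      exact mul_le_mul_of_nonneg_right hx.2 (norm_nonneg _)
    · filter_upwards [hg.tendsto_resolvent hT hα hα0] with x hx
      exact hx.mul_const _
  have hR := (hg.tendsto_form hT hE₀ hE₀s hN hα hα0 u.inForm).add hI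
  have h := tendsto_nhds_unique (hL.congr hdec) hR
  rw [← h, sub_zero, inner_eq_integral]
  refine integral_congr_ae ?_
  filter_upwards [hg.toL2_ae_eq] with x hx
  rw [hx, mul_comm]

end Perturbation

end ContractionSemigroup

/-! ### Hopf's maximal inequality, and recurrence of irreducible semigroups -/

theorem integral_nonneg_L1 {f : Lp ℝ 1 μ} (hf : 0 ≤ f) : 0 ≤ ∫ x, f x ∂μ :=
  integral_nonneg_of_ae ((Lp.coeFn_nonneg f).2 hf)

/-- Hopf's maximal inequality: for a positive contraction `P` of `L¹` and
`sₖ = f + P f + ⋯ + P^(k-1) f`, the integral of `f` over the set where `max(s₁, …, sₙ) > 0` is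
nonnegative. The set is given as `{m > 0}`, where `m = max(0, s₁, …, sₙ)`. -/
theorem setIntegral_nonneg_of_maximal {P : Lp ℝ 1 μ →L[ℝ] Lp ℝ 1 μ}
    (hP : ∀ f, 0 ≤ f → 0 ≤ P f) (hP1 : ∀ f, ‖P f‖ ≤ ‖f‖) (f : Lp ℝ 1 μ) (n : ℕ) :
    ∃ m : Lp ℝ 1 μ, (∀ᵐ x ∂μ, 0 < m x ↔
        ∃ k ∈ Finset.range (n + 1), 0 < (∑ j ∈ Finset.range k, (P ^ j) f : Lp ℝ 1 μ) x) ∧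
      0 ≤ ∫ x in {x | 0 < m x}, f x ∂μ := by
  set s : ℕ → Lp ℝ 1 μ := fun k => ∑ j ∈ Finset.range k, (P ^ j) f with hs
  have hs0 : s 0 = 0 := by simp [hs]
  have hsucc : ∀ k, s (k + 1) = f + P (s k) := fun k => by
    simp only [hs, Finset.sum_range_succ', map_sum, pow_succ', pow_zero]
    rw [add_comm]
    rfl
  have hne : (Finset.range (n + 1)).Nonempty := ⟨0, by simp⟩
  set m : Lp ℝ 1 μ := (Finset.range (n + 1)).sup' hne s with hm
  have hsm : ∀ k ∈ Finset.range (n + 1), s k ≤ m := fun k hk => Finset.le_sup' s hk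
  have hm0 : 0 ≤ m := by
    rw [← hs0]
    exact hsm 0 (by simp)
  have hmx : ∀ᵐ x ∂μ, m x = (Finset.range (n + 1)).sup' hne fun k => s k x := by
    have key : ∀ (t : Finset ℕ) (ht : t.Nonempty),
        ∀ᵐ x ∂μ, (t.sup' ht s : Lp ℝ 1 μ) x = t.sup' ht fun k => s k x := by
      intro t ht
      induction ht using Finset.Nonempty.cons_induction with
      | singleton a => simp
      | cons a t hat ht ih =>
        rw [Finset.sup'_cons ht]
        filter_upwards [ih, Lp.coeFn_sup (s a) (t.sup' ht s)] with x h1 h2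
        rw [h2, Pi.sup_apply, h1, Finset.sup'_cons ht]
    exact key _ _
  have hPm : ∀ k ∈ Finset.range (n + 1), s (k + 1) ≤ f + P m := fun k hk => by
    rw [hsucc]
    refine add_le_add le_rfl ?_
    rw [← sub_nonneg, ← map_sub]
    exact hP _ (sub_nonneg.2 (hsm k hk))
  have hmeas : MeasurableSet {x | 0 < m x} :=
    measurableSet_lt measurable_const (Lp.stronglyMeasurable m).measurable
  refine ⟨m, ?_, ?_⟩
  · filter_upwards [hmx] with x hx
    rw [hx, Finset.lt_sup'_iff]
  · -- on `{m > 0}` the maximum is attained at some `sₖ` with `k ≥ 1`, so `m - P m ≤ f` there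
    have hle : ∀ᵐ x ∂μ, x ∈ {x | 0 < m x} → m x - P m x ≤ f x := by
      have h1 : ∀ᵐ x ∂μ, ∀ k ∈ Finset.range (n + 1), s (k + 1) x ≤ f x + P m x := by
        refine ae_all_iff.2 fun k => ?_
        by_cases hk : k ∈ Finset.range (n + 1)
        · filter_upwards [(Lp.coeFn_le _ _).2 (hPm k hk), Lp.coeFn_add f (P m)] with x h2 h3 _
          rwa [h3, Pi.add_apply] at h2
        · exact Eventually.of_forall fun x h => absurd h hk
      filter_upwards [h1, hmx, Lp.coeFn_zero ℝ 1 μ] with x h2 h3 h4 h5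
      obtain ⟨k, hk, hkx⟩ := Finset.exists_mem_eq_sup' hne fun k => s k x
      have h5 : 0 < m x := h5
      rw [h3, hkx] at h5 ⊢
      cases k with
      | zero =>
        rw [hs0, h4] at h5
        exact absurd h5 (lt_irrefl _)
      | succ k =>
        have := h2 k (by rw [Finset.mem_range] at hk ⊢; omega)
        linarith
    have hint : ∀ h : Lp ℝ 1 μ, IntegrableOn h {x | 0 < m x} μ := fun h =>
      (integrable_L1 h).integrableOn
    have h1 : ∫ x in {x | 0 < m x}, (m x - P m x) ∂μ ≤ ∫ x in {x | 0 < m x}, f x ∂μ :=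
      setIntegral_mono_on_ae ((hint m).sub (hint (P m))) (hint f) hmeas hle
    rw [integral_sub (hint m) (hint (P m))] at h1
    have h2 : ∫ x in {x | 0 < m x}, m x ∂μ = ∫ x, m x ∂μ := by
      refine setIntegral_eq_integral_of_ae_compl_eq_zero ?_
      filter_upwards [(Lp.coeFn_nonneg _).2 hm0] with x h3 h4
      exact le_antisymm (not_lt.1 h4) h3
    have h3 : ∫ x in {x | 0 < m x}, P m x ∂μ ≤ ∫ x, P m x ∂μ :=
      setIntegral_le_integral (integrable_L1 _) ((Lp.coeFn_nonneg _).2 (hP m hm0))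
    have h4 : ∫ x, P m x ∂μ ≤ ∫ x, m x ∂μ := by
      rw [← norm_eq_integral_of_nonneg hm0, ← norm_eq_integral_of_nonneg (hP m hm0)]
      exact hP1 m
    linarith

namespace ContractionSemigroup

variable {T : ContractionSemigroup μ} [SigmaFinite μ]

/-- If `Gg = ∞` a.e. for some integrable `g ≥ 0`, then `∫₀ᵐ T_t f dt = 0` a.e. on `{Gf < ∞}`. Here
Hopf's inequality is applied to `a ∫₀ᵐ T_t g dt - ∫₀ᵐ T_t f dt` and the operator `T_m`, and
`a ↓ 0`. -/
theorem IsDualSubMarkovian.partialPotential_eq_zero (hT : T.IsDualSubMarkovian) {f g : Lp ℝ 1 μ}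
    (hf : 0 ≤ f) (hg : 0 ≤ g) (hG : ∀ᵐ x ∂μ, T.potential g x = ∞) {m : ℕ} (hm : 0 < m) :
    ∀ᵐ x ∂μ, T.potential f x < ∞ → T.partialPotential f m x = 0 := by
  set D : Set E := {x | T.potential f x < ∞} with hD
  have hDmeas : NullMeasurableSet D μ :=
    nullMeasurableSet_lt (T.aemeasurable_potential f) aemeasurable_const
  have hm0 : (0 : ℝ) ≤ m := m.cast_nonneg
  set F := T.partialPotential f m with hF
  set Γ := T.partialPotential g m with hΓ
  have hF0 : 0 ≤ F := hT.partialPotential_nonneg hf hm0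
  have hΓ0 : 0 ≤ Γ := hT.partialPotential_nonneg hg hm0
  have hQ := hT.l1_isContractionSemigroup
  have hfin : ∀ᵐ x ∂μ, ∀ k : ℕ, ENNReal.ofReal (T.partialPotential f (k * m) x) ≤
      T.potential f x :=
    ae_all_iff.2 fun k => hT.ofReal_partialPotential_le_potential hf (by positivity)
  have hmono : ∀ᵐ x ∂μ, ∀ k : ℕ, T.partialPotential g k x ≤ T.partialPotential g (k * m) x :=
    ae_all_iff.2 fun k => (Lp.coeFn_le _ _).2 <|
      hT.partialPotential_mono hg k.cast_nonneg
        (le_mul_of_one_le_right k.cast_nonneg (by exact_mod_cast hm))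
  have hbound : ∀ a > 0, ∫ x, D.indicator F x ∂μ ≤ a * ∫ x, Γ x ∂μ := by
    intro a ha
    choose M hM hM0 using fun n => setIntegral_nonneg_of_maximal
      (fun f hf => hT.l1Op_nonneg hm0 hf) (fun f => hT.norm_l1Op_le hm0 f) (a • Γ - F) n
    have hsum : ∀ k : ℕ, ∑ j ∈ Finset.range k, (T.l1Op m ^ j) (a • Γ - F) =
        a • T.partialPotential g (k * m) - T.partialPotential f (k * m) := fun k => by
      have h1 : T.partialPotential g (k * m) = ∑ j ∈ Finset.range k, (T.l1Op m ^ j) Γ :=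
        hQ.integral_nat_mul g hm0 k
      have h2 : T.partialPotential f (k * m) = ∑ j ∈ Finset.range k, (T.l1Op m ^ j) F :=
        hQ.integral_nat_mul f hm0 k
      rw [h1, h2, Finset.smul_sum, ← Finset.sum_sub_distrib]
      simp only [map_sub, map_smul]
    have hmeas : ∀ n, MeasurableSet {x | 0 < M n x} := fun n =>
      measurableSet_lt measurable_const (Lp.stronglyMeasurable (M n)).measurable
    have hlim : Tendsto (fun n => ∫ x, ({x | 0 < M n x} ∩ D).indicator F x ∂μ) atTop
        (𝓝 (∫ x, D.indicator F x ∂μ)) := by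
      refine tendsto_integral_of_dominated_convergence (fun x => ‖F x‖) (fun n =>
        (Lp.aestronglyMeasurable F).indicator₀ ((hmeas n).nullMeasurableSet.inter hDmeas))
        (integrable_L1 F).norm (fun n => Eventually.of_forall fun x =>
          norm_indicator_le_norm_self _ _) ?_
      have hsumx : ∀ᵐ x ∂μ, ∀ k : ℕ,
          (∑ j ∈ Finset.range k, (T.l1Op m ^ j) (a • Γ - F) : Lp ℝ 1 μ) x =
            a * T.partialPotential g (k * m) x - T.partialPotential f (k * m) x := by
        refine ae_all_iff.2 fun k => ?_
        rw [hsum k]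
        filter_upwards [Lp.coeFn_sub (a • T.partialPotential g (k * m))
          (T.partialPotential f (k * m)), Lp.coeFn_smul a (T.partialPotential g (k * m))]
          with x h1 h2
        rw [h1, Pi.sub_apply, h2, Pi.smul_apply, smul_eq_mul]
      filter_upwards [ae_all_iff.2 hM, hsumx, hfin, hmono, hG] with x h1 h2 h3 h4 h5
      by_cases hx : x ∈ D
      · -- `∫₀^{km} T_t g dt` exceeds every bound, while `∫₀^{km} T_t f dt ≤ Gf < ∞`
        obtain ⟨k, hk⟩ : ∃ k : ℕ, (T.potential f x).toReal / a < T.partialPotential g k x := by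
          have h6 : ENNReal.ofReal ((T.potential f x).toReal / a) < T.potential g x := by
            rw [h5]
            exact ENNReal.ofReal_lt_top
          rw [potential_eq T g, lt_iSup_iff] at h6
          obtain ⟨k, hk⟩ := h6
          exact ⟨k, ((ENNReal.ofReal_lt_ofReal_iff_of_nonneg (by positivity)).1 hk)⟩
        have h7 : T.partialPotential f (k * m) x ≤ (T.potential f x).toReal :=
          (ENNReal.ofReal_le_iff_le_toReal (ne_of_lt hx)).1 (h3 k)
        have h8 : (T.potential f x).toReal < a * T.partialPotential g (k * m) x := by
          rw [div_lt_iff₀ ha] at hk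
          nlinarith [h4 k]
        refine tendsto_const_nhds.congr' ?_
        filter_upwards [eventually_ge_atTop k] with n hn
        have h9 : 0 < M n x := (h1 n).2 ⟨k, Finset.mem_range.2 (by omega), by
          rw [h2 k]
          linarith⟩
        have h10 : x ∈ {x | 0 < M n x} ∩ D := ⟨h9, hx⟩
        rw [indicator_of_mem hx, indicator_of_mem h10]
      · rw [indicator_of_notMem hx]
        refine tendsto_const_nhds.congr fun n => ?_
        rw [indicator_of_notMem fun h => hx h.2]
    refine le_of_tendsto' hlim fun n => ?_
    have h1 : ∫ x, ({x | 0 < M n x} ∩ D).indicator F x ∂μ ≤ ∫ x in {x | 0 < M n x}, F x ∂μ := by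
      rw [← integral_indicator (hmeas n)]
      refine integral_mono_ae
        ((integrable_L1 F).indicator₀ ((hmeas n).nullMeasurableSet.inter hDmeas))
        ((integrable_L1 F).indicator (hmeas n)) ?_
      filter_upwards [(Lp.coeFn_nonneg _).2 hF0] with x hx
      have hx : 0 ≤ F x := hx
      by_cases h1 : x ∈ {x | 0 < M n x}
      · rw [indicator_of_mem h1]
        exact indicator_apply_le' (fun _ => le_rfl) fun _ => hx
      · rw [indicator_of_notMem h1, indicator_of_notMem fun h => h1 h.1]
    have h2 : ∫ x in {x | 0 < M n x}, (a • Γ - F : Lp ℝ 1 μ) x ∂μ =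
        a * ∫ x in {x | 0 < M n x}, Γ x ∂μ - ∫ x in {x | 0 < M n x}, F x ∂μ := by
      rw [← integral_const_mul, ← integral_sub ((integrable_L1 Γ).integrableOn.const_mul a)
        (integrable_L1 F).integrableOn]
      refine integral_congr_ae (ae_restrict_of_ae ?_)
      filter_upwards [Lp.coeFn_sub (a • Γ) F, Lp.coeFn_smul a Γ] with x h3 h4
      rw [h3, Pi.sub_apply, h4, Pi.smul_apply, smul_eq_mul]
    have h3 : ∫ x in {x | 0 < M n x}, Γ x ∂μ ≤ ∫ x, Γ x ∂μ :=
      setIntegral_le_integral (integrable_L1 _) ((Lp.coeFn_nonneg _).2 hΓ0)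
    have h4 := hM0 n
    rw [h2] at h4
    nlinarith
  have hnn : 0 ≤ᵐ[μ] D.indicator F := by
    filter_upwards [(Lp.coeFn_nonneg _).2 hF0] with x hx
    exact indicator_apply_nonneg fun _ => hx
  have hint : Integrable (D.indicator F) μ := (integrable_L1 F).indicator₀ hDmeas
  have hle : ∫ x, D.indicator F x ∂μ ≤ 0 := by
    have hΓi : 0 ≤ ∫ x, Γ x ∂μ := integral_nonneg_L1 hΓ0
    refine le_of_forall_pos_le_add fun ε hε => ?_
    refine (hbound (ε / ((∫ x, Γ x ∂μ) + 1)) (by positivity)).trans ?_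
    rw [zero_add, div_mul_eq_mul_div, div_le_iff₀ (by positivity)]
    nlinarith
  have hzero := (integral_eq_zero_iff_of_nonneg_ae hnn hint).1
    (le_antisymm hle (integral_nonneg_of_ae hnn))
  filter_upwards [hzero] with x hx hxD
  have hxD : x ∈ D := hxD
  rwa [indicator_of_mem hxD] at hx

/-- On `{Gg < ∞}` one has `T_t φ = 0` for `0 ≤ φ ∈ L²` supported in `{Gg = ∞}`: apply `T_t` to
`φ ∧ (k⁻¹ ∫₀ⁿ T_s g ds)`, which converges to `φ` as `n → ∞`; the result is at most `k⁻¹ Gg`. -/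
theorem IsDualSubMarkovian.op_eq_zero (hT : T.IsDualSubMarkovian) {g : Lp ℝ 1 μ} (hg : 0 ≤ g)
    {φ : Lp ℝ 2 μ} (hφ : 0 ≤ φ) (hsupp : ∀ᵐ x ∂μ, T.potential g x < ∞ → φ x = 0) {t : ℝ}
    (ht : 0 ≤ t) : ∀ᵐ x ∂μ, T.potential g x < ∞ → T.op t φ x = 0 := by
  have hk : ∀ k : ℕ, ∀ᵐ x ∂μ, T.potential g x < ∞ →
      ((k : ℝ) + 1) * T.op t φ x ≤ (T.potential g x).toReal := by
    intro k
    set c : ℝ := ((k : ℝ) + 1)⁻¹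
    have hc : 0 < c := by positivity
    set ψ : ℕ → E → ℝ := fun n x => min (φ x) (c * T.partialPotential g n x)
    have hpp : ∀ n : ℕ, 0 ≤ T.partialPotential g n := fun n =>
      hT.partialPotential_nonneg hg n.cast_nonneg
    have hψ : ∀ n, AEStronglyMeasurable (ψ n) μ := fun n =>
      (Lp.aestronglyMeasurable φ).inf ((Lp.aestronglyMeasurable _).const_mul c)
    have hψnn : ∀ n, ∀ᵐ x ∂μ, 0 ≤ ψ n x := fun n => by
      filter_upwards [(Lp.coeFn_nonneg _).2 hφ, (Lp.coeFn_nonneg _).2 (hpp n)] with x h1 h2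
      exact le_min h1 (mul_nonneg hc.le h2)
    have hψ2 : ∀ n, MemLp (ψ n) 2 μ := fun n => by
      refine (Lp.memLp φ).of_le (hψ n) ?_
      filter_upwards [hψnn n] with x h1
      rw [Real.norm_of_nonneg h1]
      exact (min_le_left _ _).trans (le_abs_self _)
    have hψ1 : ∀ n, MemLp (ψ n) 1 μ := fun n => by
      refine ((Lp.memLp (T.partialPotential g n)).const_mul c).of_le (hψ n) ?_
      filter_upwards [hψnn n] with x h1
      rw [Real.norm_of_nonneg h1]
      exact (min_le_right _ _).trans (le_abs_self _)
    have hlim : Tendsto (fun n => (hψ2 n).toLp (ψ n)) atTop (𝓝 φ) := by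
      refine tendsto_Lp_of_dominated ENNReal.ofNat_ne_top (Lp.memLp φ) (fun n => ?_) ?_
      · filter_upwards [(hψ2 n).coeFn_toLp, hψnn n] with x h1 h2
        rw [h1, abs_of_nonneg h2]
        exact min_le_left _ _
      · have hmono : ∀ᵐ x ∂μ, ∀ n n' : ℕ, n ≤ n' →
            T.partialPotential g n x ≤ T.partialPotential g n' x := by
          refine ae_all_iff.2 fun n => ae_all_iff.2 fun n' => ?_
          by_cases h : n ≤ n'
          · filter_upwards [(Lp.coeFn_le _ _).2 (hT.partialPotential_mono hg n.cast_nonneg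
              (Nat.cast_le.2 h))] with x hx _ using hx
          · exact Eventually.of_forall fun x h' => absurd h' h
        filter_upwards [ae_all_iff.2 fun n => (hψ2 n).coeFn_toLp, ae_all_iff.2 hψnn, hsupp,
          hmono] with x h1 h2 h3 h4
        rcases eq_or_ne (T.potential g x) ∞ with h5 | h5
        · have h6 : ENNReal.ofReal (c⁻¹ * φ x) < T.potential g x := by
            rw [h5]
            exact ENNReal.ofReal_lt_top
          rw [potential_eq, lt_iSup_iff] at h6
          obtain ⟨n₀, hn₀⟩ := h6
          have h7 : c⁻¹ * φ x < T.partialPotential g n₀ x :=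
            lt_of_not_ge fun h => hn₀.not_ge (ENNReal.ofReal_le_ofReal h)
          refine tendsto_const_nhds.congr' ?_
          filter_upwards [eventually_ge_atTop n₀] with n hn
          rw [h1 n, eq_comm]
          refine min_eq_left ?_
          have h8 := h7.le.trans (h4 n₀ n hn)
          rwa [inv_mul_le_iff₀ hc] at h8
        · have h6 := h3 h5.lt_top
          rw [h6]
          refine tendsto_const_nhds.congr fun n => ?_
          rw [h1 n]
          refine le_antisymm (h2 n) ?_
          rw [← h6]
          exact min_le_left _ _
    obtain ⟨ns, -, hns⟩ := exists_subseq_ae_tendsto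
      (((T.op t).continuous.tendsto φ).comp hlim)
    have hup : ∀ n : ℕ, ∀ᵐ x ∂μ, T.potential g x < ∞ →
        ((k : ℝ) + 1) * T.op t ((hψ2 n).toLp (ψ n)) x ≤ (T.potential g x).toReal := by
      intro n
      have h1 : (hψ1 n).toLp (ψ n) ≤ c • T.partialPotential g n := by
        rw [← Lp.coeFn_le]
        filter_upwards [(hψ1 n).coeFn_toLp, Lp.coeFn_smul c (T.partialPotential g n)] with x h2 h3
        rw [h2, h3]
        exact min_le_right _ _
      have h2 : T.l1Op t ((hψ1 n).toLp (ψ n)) ≤ c • T.partialPotential g (t + n) := by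
        refine (hT.l1Op_mono ht h1).trans ?_
        rw [map_smul]
        exact smul_le_smul_of_nonneg_left (hT.l1Op_partialPotential_le hg ht n.cast_nonneg) hc.le
      filter_upwards [(Lp.coeFn_le _ _).2 h2, Lp.coeFn_smul c (T.partialPotential g (t + n)),
        hT.isL1Extension ht _ _ ((hψ1 n).coeFn_toLp.trans (hψ2 n).coeFn_toLp.symm),
        hT.ofReal_partialPotential_le_potential hg (add_nonneg ht n.cast_nonneg)]
        with x h3 h4 h5 h6 h7
      rw [h4, h5, Pi.smul_apply, smul_eq_mul, le_inv_mul_iff₀ (by positivity)] at h3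
      exact h3.trans ((ENNReal.ofReal_le_iff_le_toReal h7.ne).1 h6)
    filter_upwards [hns, ae_all_iff.2 hup] with x h1 h2 h3
    exact le_of_tendsto' (h1.const_mul _) fun i => h2 (ns i) h3
  filter_upwards [ae_all_iff.2 hk, (Lp.coeFn_nonneg _).2 (hT.op_nonneg ht hφ)] with x h1 h2 h3
  refine le_antisymm ?_ h2
  by_contra! hpos
  obtain ⟨k, hk⟩ := exists_nat_gt ((T.potential g x).toReal / T.op t φ x)
  rw [div_lt_iff₀ hpos] at hk
  linarith [h1 k h3]

/-- `{Gg = ∞}` is weakly invariant. -/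
theorem IsDualSubMarkovian.exists_isWeaklyInvariant (hT : T.IsDualSubMarkovian) {g : Lp ℝ 1 μ}
    (hg : 0 ≤ g) : ∃ B : Set E, T.IsWeaklyInvariant B ∧ ∀ᵐ x ∂μ, x ∈ B ↔ T.potential g x = ∞ := by
  have hmeas := T.aemeasurable_potential g
  have hB : MeasurableSet (hmeas.mk _ ⁻¹' {∞}) := hmeas.measurable_mk (measurableSet_singleton ∞)
  have hBiff : ∀ᵐ x ∂μ, x ∈ hmeas.mk _ ⁻¹' {∞} ↔ T.potential g x = ∞ := by
    filter_upwards [hmeas.ae_eq_mk] with x hx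
    rw [hx]
    rfl
  refine ⟨_, ⟨hB, fun t ht f => ?_⟩, hBiff⟩
  set φ := ((Lp.memLp f).indicator hB).toLp _ with hφ
  have hsupp : ∀ᵐ x ∂μ, T.potential g x < ∞ → |φ| x = 0 := by
    filter_upwards [hBiff, ((Lp.memLp f).indicator hB).coeFn_toLp, Lp.coeFn_abs φ]
      with x h1 h2 h3 h4
    rw [h3, hφ, h2, indicator_of_notMem (fun h => h4.ne (h1.1 h)), abs_zero]
  filter_upwards [hT.op_eq_zero hg (abs_nonneg φ) hsupp ht.le, hBiff,
    (Lp.coeFn_le _ _).2 (abs_op_le (hT.adjoint_op ht.le) φ), Lp.coeFn_abs (T.op t φ)]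
    with x h1 h2 h3 h4 h5
  rw [h1 (lt_top_iff_ne_top.2 fun h => h5 (h2.2 h)), h4] at h3
  exact abs_nonpos_iff.1 h3

omit [SigmaFinite μ] in
/-- On a `σ`-finite space there is a strictly positive integrable function. -/
theorem exists_pos_L1 (μ : Measure E) [SigmaFinite μ] : ∃ g : Lp ℝ 1 μ, ∀ᵐ x ∂μ, 0 < g x := by
  obtain ⟨g, hg, hgm, hgi⟩ := exists_pos_lintegral_lt_of_sigmaFinite μ one_ne_zero
  have hmem : MemLp (fun x => (g x : ℝ)) 1 μ := by
    refine memLp_one_iff_integrable.2 ⟨hgm.coe_nnreal_real.aestronglyMeasurable, ?_⟩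
    rw [hasFiniteIntegral_iff_enorm]
    refine lt_of_eq_of_lt (lintegral_congr fun x => ?_) (hgi.trans ENNReal.one_lt_top)
    simp
  refine ⟨hmem.toLp _, ?_⟩
  filter_upwards [hmem.coeFn_toLp] with x hx
  rw [hx]
  exact_mod_cast hg x

/-- A strictly irreducible semigroup is transient or recurrent. -/
theorem IsStrictlyIrreducible.isTransient_or_isRecurrent (hT : T.IsDualSubMarkovian)
    (hirr : T.IsStrictlyIrreducible) : T.IsTransient ∨ T.IsRecurrent := by
  obtain ⟨g, hg⟩ := exists_pos_L1 μ
  have hg0 : 0 ≤ g := by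
    rw [← Lp.coeFn_nonneg]
    filter_upwards [hg] with x hx using hx.le
  obtain ⟨B, hB, hBiff⟩ := hT.exists_isWeaklyInvariant hg0
  rcases hirr B hB with h | h
  · left
    refine ⟨g, hg, ?_⟩
    filter_upwards [hBiff, measure_eq_zero_iff_ae_notMem.1 h] with x h1 h2
    exact lt_top_iff_ne_top.2 fun h => h2 (h1.2 h)
  · right
    have hG : ∀ᵐ x ∂μ, T.potential g x = ∞ := by
      filter_upwards [hBiff, measure_eq_zero_iff_ae_notMem.1 h] with x h1 h2
      exact h1.1 (not_not.1 h2)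
    intro f hf
    have hpp := ae_all_iff.2 fun m : ℕ => hT.partialPotential_eq_zero
      ((Lp.coeFn_nonneg f).1 hf) hg0 hG m.succ_pos
    have hzero := hT.partialPotential_mono ((Lp.coeFn_nonneg f).1 hf) le_rfl
      (zero_le_one' ℝ)
    filter_upwards [hpp, (Lp.coeFn_le _ _).2 hzero] with x h1 h2
    by_cases hfin : T.potential f x < ∞
    · left
      rw [potential_eq]
      refine le_antisymm (iSup_le fun n => ?_) zero_le
      cases n with
      | zero =>
        have h3 := h1 0 hfin
        rw [Nat.cast_succ, Nat.cast_zero, zero_add] at h3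
        rw [h3] at h2
        rw [Nat.cast_zero, ENNReal.ofReal_of_nonpos h2]
      | succ n => rw [h1 n hfin, ENNReal.ofReal_zero]
    · right
      exact not_lt_top_iff.1 hfin

end ContractionSemigroup

/-! ### Cutoffs exclude transience -/

/-- The identity `(g, χ) = E⁰(Gg, χ) + ∫ Gg Nχ dμ` along the cutoffs gives `∫ g dμ = 0`. -/
theorem ContractionSemigroup.IsReference.eq_zero_of_hasCutoffs [SigmaFinite μ]
    {T : ContractionSemigroup μ} {g : Lp ℝ 1 μ} (hT : T.IsDualSubMarkovian) {E₀ : L2Form μ}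
    {N : Lp ℝ 2 μ →ₗ.[ℝ] Lp ℝ 2 μ} (hE₀ : E₀.IsDirichlet) (hE₀s : E₀.IsSectorial)
    (hN : IsLinearPerturbation T E₀ N) (hg : T.IsReference g) (hcut : HasCutoffs E₀ N) :
    μ = 0 := by
  obtain ⟨χ, hχ, hχ1, hlim⟩ := hcut
  obtain ⟨C, hC0, hC, -⟩ := hg.exists_resolvent_le hT
  have h1 := hlim _ (hg.inExtended hT hE₀ hN) (Eventually.of_forall fun x => ENNReal.toReal_nonneg)
    ⟨C, by
      filter_upwards [hC] with x hx
      rwa [abs_of_nonneg ENNReal.toReal_nonneg]⟩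
  have h2 : Tendsto (fun n => ∫ x, (χ n).val x * g x ∂μ) atTop (𝓝 0) :=
    h1.congr fun n => (hg.integral_mul_eq hT hE₀ hE₀s hN (χ n)).symm
  have h3 : Tendsto (fun n => ∫ x, (χ n).val x * g x ∂μ) atTop (𝓝 (∫ x, g x ∂μ)) := by
    refine tendsto_integral_of_dominated_convergence (fun x => ‖g x‖)
      (fun n => (Lp.aestronglyMeasurable _).mul (Lp.aestronglyMeasurable _))
      (integrable_L1 g).norm (fun n => ?_) ?_
    · filter_upwards [hχ n] with x hx
      rw [norm_mul, Real.norm_of_nonneg hx.1]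
      exact mul_le_of_le_one_left (norm_nonneg _) hx.2
    · filter_upwards [hχ1] with x hx
      simpa using hx.mul_const (g x)
  have h4 := tendsto_nhds_unique h3 h2
  rw [integral_eq_zero_iff_of_nonneg_ae ((Lp.coeFn_nonneg _).2 hg.nonneg) (integrable_L1 g)] at h4
  rw [← ae_eq_bot, ← eventually_false_iff_eq_bot]
  filter_upwards [h4, hg.pos] with x h5 h6
  exact h6.ne' h5

end GenDirichlet

theorem theorem2p6 {E : Type*} [TopologicalSpace E] [T2Space E] [MeasurableSpace E] [BorelSpace E]
    (hE : borel E = ⨆ f : C(E, ℝ), MeasurableSpace.comap f (borel ℝ))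
    (μ : Measure E) [SigmaFinite μ]
    (A : GenDirichlet.L2Form μ) (hA : A.IsDirichlet)
    (U : GenDirichlet.ContractionSemigroup μ) (hU : U.IsSubMarkovian) (hUA : U.RestrictsTo A)
    (T : GenDirichlet.ContractionSemigroup μ) (hT : T = GenDirichlet.semigroup A U)
    (hTdual : T.IsDualSubMarkovian)
    (E₀ : GenDirichlet.L2Form μ) (hE₀ : E₀.IsDirichlet) (hE₀s : E₀.IsSectorial)
    (N : Lp ℝ 2 μ →ₗ.[ℝ] Lp ℝ 2 μ) (hN : GenDirichlet.IsLinearPerturbation T E₀ N) :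
    (T.IsTransient →
      (∃ g : Lp ℝ 1 μ, T.IsReference g) ∧
      ∀ (g : Lp ℝ 1 μ) (hg : T.IsReference g),
        E₀.InExtended (fun x => (T.potential g x).toReal) ∧
        (∀ α : ℝ, 0 < α → T.resolvent α hg.toL2 ∈ E₀.dom) ∧
        (∀ u : E₀.dom, Tendsto (fun α : ℝ => E₀.eval (T.resolvent α hg.toL2) u) (𝓝[>] 0)
          (𝓝 (E₀.extForm (fun x => (T.potential g x).toReal) u))) ∧
        (∀ u : GenDirichlet.SpaceD E₀ N,
          ∫ x, u.val x * g x ∂μ =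
            E₀.extForm (fun x => (T.potential g x).toReal) u.inForm +
              ∫ x, (T.potential g x).toReal * u.image x ∂μ)) ∧
    (μ ≠ 0 → GenDirichlet.HasCutoffs E₀ N → ¬ T.IsTransient) ∧
    (T.IsStrictlyIrreducible → GenDirichlet.HasCutoffs E₀ N → T.IsRecurrent) := by
  have hmax : T.WeakMaximumPrinciple := fun α hα f c hc z hz => by
    subst hT
    exact hA.inner_sub_cutoff_nonneg hU hα f hc hz
  have hnot : μ ≠ 0 → GenDirichlet.HasCutoffs E₀ N → ¬ T.IsTransient := fun hμ hcut htr => by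
    obtain ⟨g, hg⟩ := htr.exists_isReference hTdual hmax
    exact hμ (hg.eq_zero_of_hasCutoffs hTdual hE₀ hE₀s hN hcut)
  refine ⟨fun htr => ⟨htr.exists_isReference hTdual hmax, fun g hg =>
    ⟨hg.inExtended hTdual hE₀ hN, fun α hα => hg.resolvent_mem hTdual hN hα,
      hg.tendsto_eval hTdual hE₀ hE₀s hN, hg.integral_mul_eq hTdual hE₀ hE₀s hN⟩⟩,
    hnot, fun hirr hcut => ?_⟩
  rcases hirr.isTransient_or_isRecurrent hTdual with htr | hrec
  · rcases eq_or_ne μ 0 with rfl | hμ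
    · intro f _
      simp
    · exact absurd htr (hnot hμ hcut)
  · exact hrec
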